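/- Let $n\ge 1$, $s\in(0,1)$, $p>2$, let $C_{n,s,p}>0$ be a (normalization) constant, and let $\Omega\subset\mathbb R^n$ be a bounded domain satisfying the uniform exterior tangent sphere condition: there is $\rho>0$ such that every $x\in\partial\Omega$ lies on the boundary of a closed ball of radius $\rho$ that does not meet $\Omega$. Let $f:\mathbb R^n\to\mathbb R$ satisfy $\|f\|_{L^\infty(\Omega)}<\infty$, and let $u:\mathbb R^n\to\mathbb R$ belong to $C^{1,1}_{loc}(\Omega)\cap L_{ps}$, where $$L_{ps}=\Big\{u\in L^1_{loc}(\mathbb R^n)\;:\;\int_{\mathbb R^n}\frac{|u(x)|^{p-1}}{1+|x|^{n+ps}}\,dx<\infty\Big\}.$$ Suppose that $u$ solves $(-\Delta)^s_p u=f$ in $\Omega$, $u\equiv 0$ in $\mathbb R^n\setminus\Omega$, i.e. for every $x\in\Omega$ $$C_{n,s,p}\lim_{\varepsilon\to0^+}\int_{\mathbb R^n\setminus B_\varepsilon(x)}\frac{|u(x)-u(y)|^{p-2}(u(x)-u(y))}{|x-y|^{n+ps}}\,dy=f(x),$$ and that $u$ has zero boundary values on $\partial\Omega$ in the weak sense that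 for every $\varepsilon>0$ each of the functions $w=(u-\varepsilon)^+$ and $w=(-u-\varepsilon)^+$ satisfies $$\int_{\mathbb R^n}\int_{\mathbb R^n}\frac{|w(x)-w(y)|^p}{|x-y|^{n+ps}}\,dx\,dy<\infty$$ (this holds, for example, if $u$ is continuous on $\mathbb R^n$, or if $u\in W^{s,p}(\mathbb R^n)$). Then $u$ is bounded, and there exists $\nu\in(0,s)$ such that (i) there are $c,\delta>0$ with $|u(x)|\le c\,\operatorname{dist}(x,\partial\Omega)^\nu$ for all $x\in\Omega$ with $\operatorname{dist}(x,\partial\Omega)<\delta$; (ii) $u\in C^\nu(\overline\Omega)$, i.e. there is $C>0$ with $|u(x)-u(y)|\le C|x-y|^\nu$ for all $x,y\in\overline\Omega$. -/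

import Mathlib

open MeasureTheory Filter Topology

/-- Uniform exterior tangent sphere condition: every boundary point of `Ω` lies on the boundary of a
ball of a fixed radius `ρ` that does not meet `Ω`. -/
def ExteriorTangentSphere {n : ℕ} (Ω : Set (EuclideanSpace ℝ (Fin n))) : Prop :=
  ∃ ρ : ℝ, 0 < ρ ∧ ∀ x ∈ frontier Ω, ∃ z : EuclideanSpace ℝ (Fin n),
    dist z x = ρ ∧ Disjoint (Metric.closedBall z ρ) Ω

/-- The space `L_{sp}(ℝⁿ)`: `u ∈ L¹_loc` and `∫ |u|^(p-1) / (1 + |x|^(n+sp)) < ∞`. -/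
def MemLsp {n : ℕ} (s p : ℝ) (u : EuclideanSpace ℝ (Fin n) → ℝ) : Prop :=
  LocallyIntegrable u volume ∧
    Integrable (fun x => |u x| ^ (p - 1) / (1 + ‖x‖ ^ ((n : ℝ) + s * p))) volume

/-- `u ∈ C^{1,1}_loc(Ω)` for an open set `Ω`: `u` is differentiable in `Ω` and its derivative is
locally Lipschitz there. -/
def C11Loc {n : ℕ} (Ω : Set (EuclideanSpace ℝ (Fin n))) (u : EuclideanSpace ℝ (Fin n) → ℝ) : Prop :=
  DifferentiableOn ℝ u Ω ∧ LocallyLipschitzOn Ω (fderiv ℝ u)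

/-- The truncated integral
`∫_{ℝⁿ \ B_ε(x)} |u(x) - u(y)|^(p-2) (u(x) - u(y)) / |x - y|^(n+ps) dy`. -/
noncomputable def truncFracPLap {n : ℕ} (s p : ℝ) (u : EuclideanSpace ℝ (Fin n) → ℝ)
    (x : EuclideanSpace ℝ (Fin n)) (ε : ℝ) : ℝ :=
  ∫ y in (Metric.ball x ε)ᶜ,
    |u x - u y| ^ (p - 2) * (u x - u y) / ‖x - y‖ ^ ((n : ℝ) + p * s)

/-- `(-Δ)^s_p u(x) = L` in the principal value sense, with normalization constant `K`. -/
def HasFracPLap {n : ℕ} (K s p : ℝ) (u : EuclideanSpace ℝ (Fin n) → ℝ)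
    (x : EuclideanSpace ℝ (Fin n)) (L : ℝ) : Prop :=
  Tendsto (fun ε : ℝ => K * truncFracPLap s p u x ε) (𝓝[>] 0) (𝓝 L)

/-- Finiteness of the Gagliardo seminorm of `w` in `W^{s,p}(ℝⁿ)`. -/
def FiniteGagliardo {n : ℕ} (s p : ℝ) (w : EuclideanSpace ℝ (Fin n) → ℝ) : Prop :=
  (∫⁻ x, ∫⁻ y, ENNReal.ofReal (|w x - w y| ^ p / ‖x - y‖ ^ ((n : ℝ) + s * p))) < ⊤

/-- Zero boundary values in the weak sense, for a function that vanishes outside a bounded open set: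
for every `ε > 0` the truncations `(u - ε)⁺` and `(-u - ε)⁺` have finite Gagliardo seminorm.
For `u ∈ C^{1,1}_loc(Ω)` this holds if `u` is continuous on `ℝⁿ` (the truncations are then Lipschitz
with compact support), and also if `u` itself has finite Gagliardo seminorm. -/
def WeakZeroBoundaryValues {n : ℕ} (s p : ℝ) (u : EuclideanSpace ℝ (Fin n) → ℝ) : Prop :=
  ∀ ε : ℝ, 0 < ε →
    FiniteGagliardo s p (fun x => max (u x - ε) 0) ∧
    FiniteGagliardo s p (fun x => max (-u x - ε) 0)

/-- `u` solves `(-Δ)^s_p u = f` in `Ω`, `u ≡ 0` in `ℝⁿ \ Ω`: `u` belongs to the class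
`C^{1,1}_loc(Ω) ∩ L_{sp}(ℝⁿ)` in which the operator is defined pointwise, the equation holds at every
point of `Ω`, and the zero Dirichlet data are attained outside `Ω` and, weakly, on its boundary. -/
structure IsDirichletSolution {n : ℕ} (K s p : ℝ) (Ω : Set (EuclideanSpace ℝ (Fin n)))
    (f u : EuclideanSpace ℝ (Fin n) → ℝ) : Prop where
  memLsp : MemLsp s p u
  c11 : C11Loc Ω u
  eqn : ∀ x ∈ Ω, HasFracPLap K s p u x (f x)
  zero_outside : ∀ x, x ∉ Ω → u x = 0
  zero_boundary : WeakZeroBoundaryValues s p u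

/-! The proof rests on a growth lemma (`GrowthProperty`, `exists_growth_constants`). Let `u` be at
most `m + M` in a ball of radius `r`, exceed this only by a slowly growing tail outside, and be at
most `m` on a fixed fraction of the ball. If the bound on the operator is small against the natural
scale `M ^ (p - 1) * r ^ (-(p * s))`, then `u ≤ m + (1 - θ) * M` in the half ball. To see this, cut
`u` down to a quadratic barrier `b` of oscillation about `θ * M`, and let `w` be the part cut off.
Where `w > 0`, the function `u - w` equals `b`. There the low level set contributes a fixed multiple
of `M ^ (p - 1) * r ^ (-(p * s))` to its fractional `p`-Laplacian, while barrier and tail cost only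
a multiple of `θ ^ (p - 1)` of it (`barrier_lower_bound`). For small `θ` this contradicts the bound
on `u` unless `w = 0`.

The contradiction is reached in two ways. In a ball inside `Ω` it is read off at a maximum point of
`w`. In a ball meeting the boundary a maximum need not be attained in `Ω`, since `u` is not assumed
continuous there. `IsSubsolution.ae_eq_zero` then tests with `w` times a cut-off exhausting `Ω`; the
cut-off errors vanish in the limit, being dominated through a fractional Hardy inequality that
follows from the exterior balls. Finite Gagliardo seminorm is known only for truncations at positive
levels, so the barrier must stay positive, whence `0 ≤ m` in this case.

The same comparison with a constant in place of `b` gives boundedness. At a boundary point an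
exterior ball supplies the set where `u = 0`, and iterating the growth lemma over dyadic radii gives
decay at a rate `ν` (`IsSubsolution.boundary_decay`). At an interior point `u` or `-u` is below its
mid-level on half of the ball, and the iteration, started at the distance to the boundary from the
decay already proved, gives the Hölder bound (`IsSubsolution.holder`). All this is one-sided and is
applied to `u` and `-u`. The `C^{1,1}` hypothesis makes the principal value converge locally
uniformly, so `f` is continuous in `Ω` and its essential bound holds at every point. -/

/-! ### Inequalities for odd and real powers -/

/-- The odd power `t ↦ |t|^(p-2) t`. -/
noncomputable def signedPow (p t : ℝ) : ℝ := |t| ^ (p - 2) * t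

lemma signedPow_neg (p t : ℝ) : signedPow p (-t) = -signedPow p t := by
  simp [signedPow]

lemma signedPow_of_nonneg {p t : ℝ} (hp : 1 < p) (ht : 0 ≤ t) : signedPow p t = t ^ (p - 1) := by
  rcases ht.eq_or_lt with rfl | ht
  · simp [signedPow, Real.zero_rpow (by linarith : p - 1 ≠ 0)]
  · rw [signedPow, abs_of_pos ht]
    nth_rewrite 2 [← Real.rpow_one t]
    rw [← Real.rpow_add ht]
    congr 1
    ring

lemma signedPow_nonneg {p t : ℝ} (ht : 0 ≤ t) : 0 ≤ signedPow p t := by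
  unfold signedPow; positivity

lemma abs_signedPow {p : ℝ} (hp : 1 < p) (t : ℝ) : |signedPow p t| = |t| ^ (p - 1) := by
  rcases le_total 0 t with ht | ht
  · rw [abs_of_nonneg (signedPow_nonneg ht), signedPow_of_nonneg hp ht, abs_of_nonneg ht]
  · have h : 0 ≤ -t := by linarith
    rw [← abs_neg, ← signedPow_neg, abs_of_nonneg (signedPow_nonneg h), signedPow_of_nonneg hp h,
      abs_of_nonpos ht]

lemma signedPow_mono {p : ℝ} (hp : 1 < p) : Monotone (signedPow p) := by
  have key : ∀ a b : ℝ, 0 ≤ a → a ≤ b → signedPow p a ≤ signedPow p b := fun a b ha hab => by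
    rw [signedPow_of_nonneg hp ha, signedPow_of_nonneg hp (ha.trans hab)]
    exact Real.rpow_le_rpow ha hab (by linarith)
  intro a b hab
  rcases le_total 0 a with ha | ha
  · exact key a b ha hab
  · rcases le_total 0 b with hb | hb
    · have h1 := signedPow_nonneg (p := p) (t := -a) (by linarith)
      have h2 := signedPow_nonneg (p := p) hb
      rw [signedPow_neg] at h1
      linarith
    · have h1 := key (-b) (-a) (by linarith) (by linarith)
      rw [signedPow_neg, signedPow_neg] at h1
      linarith

lemma continuous_signedPow {p : ℝ} (hp : 2 < p) : Continuous (signedPow p) := by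
  unfold signedPow
  exact (continuous_abs.rpow_const fun _ => Or.inr (by linarith)).mul continuous_id

lemma neg_rpow_le_signedPow {p c t : ℝ} (hp : 1 < p) (hc : 0 ≤ c) (h : -c ≤ t) :
    -c ^ (p - 1) ≤ signedPow p t := by
  have := signedPow_mono hp h
  rwa [signedPow_neg, signedPow_of_nonneg hp hc] at this

lemma rpow_le_signedPow {p c t : ℝ} (hp : 1 < p) (hc : 0 ≤ c) (h : c ≤ t) :
    c ^ (p - 1) ≤ signedPow p t := by
  have := signedPow_mono hp h
  rwa [signedPow_of_nonneg hp hc] at this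

/-- Bernoulli's inequality at `b / a`, scaled by `a ^ r`. -/
lemma rpow_sub_rpow_le {r a b : ℝ} (hr : 1 ≤ r) (hb : 0 ≤ b) (hab : b ≤ a) :
    a ^ r - b ^ r ≤ r * a ^ (r - 1) * (a - b) := by
  rcases (hb.trans hab).eq_or_lt with ha | ha
  · obtain rfl : b = a := by linarith
    simp
  have h := one_add_mul_self_le_rpow_one_add (s := b / a - 1) (by linarith [div_nonneg hb ha.le]) hr
  rw [show 1 + (b / a - 1) = b / a by ring, Real.div_rpow hb ha.le] at h
  have h2 := mul_le_mul_of_nonneg_left h (Real.rpow_nonneg ha.le r)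
  rw [mul_div_cancel₀ _ (by positivity)] at h2
  rw [Real.rpow_sub ha, Real.rpow_one]
  have h3 : a ^ r * (1 + r * (b / a - 1)) = a ^ r - r * (a ^ r / a) * (a - b) := by
    field_simp
    ring
  linarith

/-- The mean value bound for the odd power. Its derivative is bounded near zero because `p > 2`. -/
lemma abs_signedPow_sub_le {p N a b : ℝ} (hp : 2 < p) (ha : |a| ≤ N) (hb : |b| ≤ N) :
    |signedPow p a - signedPow p b| ≤ (p - 1) * N ^ (p - 2) * |a - b| := by
  have key : ∀ a b : ℝ, |a| ≤ N → |b| ≤ N → b ≤ a →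
      signedPow p a - signedPow p b ≤ (p - 1) * N ^ (p - 2) * (a - b) := by
    have pos : ∀ a b : ℝ, |a| ≤ N → 0 ≤ b → b ≤ a →
        signedPow p a - signedPow p b ≤ (p - 1) * N ^ (p - 2) * (a - b) := fun a b ha hb hab => by
      rw [signedPow_of_nonneg (by linarith) hb, signedPow_of_nonneg (by linarith) (hb.trans hab)]
      refine (rpow_sub_rpow_le (by linarith) hb hab).trans ?_
      rw [abs_of_nonneg (hb.trans hab)] at ha
      rw [show p - 1 - 1 = p - 2 by ring]
      gcongr <;> linarith
    intro a b ha hb hab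
    rcases le_total 0 b with h0 | h0
    · exact pos a b ha h0 hab
    rcases le_total 0 a with h1 | h1
    -- For arguments of opposite sign the difference is a sum of two values `|t| ^ (p - 2) * |t|`,
    -- each bounded separately.
    · have e : ∀ t : ℝ, |t| ≤ N → |t| ^ (p - 2) ≤ (p - 1) * N ^ (p - 2) := fun t ht => by
        have : |t| ^ (p - 2) ≤ N ^ (p - 2) :=
          Real.rpow_le_rpow (abs_nonneg _) ht (by linarith)
        have h3 : 0 ≤ N ^ (p - 2) := Real.rpow_nonneg ((abs_nonneg _).trans ht) _
        nlinarith
      have := mul_le_mul_of_nonneg_right (e a ha) h1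
      have := mul_le_mul_of_nonneg_right (e b hb) (neg_nonneg.2 h0)
      unfold signedPow
      linarith
    · have := pos (-b) (-a) (by simpa using hb) (by linarith) (by linarith)
      rw [signedPow_neg, signedPow_neg] at this
      linarith
  rcases le_total b a with h | h
  · rw [abs_of_nonneg (by linarith [signedPow_mono (p := p) (by linarith) h]),
      abs_of_nonneg (by linarith)]
    exact key a b ha hb h
  · rw [abs_sub_comm, abs_sub_comm a, abs_of_nonneg (by linarith [signedPow_mono (p := p) (by linarith) h]),
      abs_of_nonneg (by linarith)]
    exact key b a hb ha h

lemma add_rpow_le_two_rpow {r a b : ℝ} (hr : 0 ≤ r) (ha : 0 ≤ a) (hb : 0 ≤ b) :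
    (a + b) ^ r ≤ 2 ^ r * (a ^ r + b ^ r) := by
  have h1 : (a + b) ^ r ≤ (2 * max a b) ^ r :=
    Real.rpow_le_rpow (by positivity) (by linarith [le_max_left a b, le_max_right a b]) hr
  rw [Real.mul_rpow (by norm_num) (by positivity)] at h1
  refine h1.trans ?_
  gcongr
  rcases max_cases a b with ⟨h, -⟩ | ⟨h, -⟩ <;> rw [h] <;>
    linarith [Real.rpow_nonneg ha r, Real.rpow_nonneg hb r]

lemma rpow_sub_one_mul_le {p a b : ℝ} (hp : 1 < p) (ha : 0 ≤ a) (hb : 0 ≤ b) :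
    a ^ (p - 1) * b ≤ a ^ p + b ^ p := by
  have e : ∀ c : ℝ, 0 ≤ c → c ^ (p - 1) * c = c ^ p := fun c hc => by
    rcases hc.eq_or_lt with rfl | hc
    · simp [Real.zero_rpow (by linarith : p ≠ 0)]
    · nth_rewrite 2 [← Real.rpow_one c]
      rw [← Real.rpow_add hc]; simp
  rcases le_total a b with h | h
  · have := mul_le_mul_of_nonneg_right
      (Real.rpow_le_rpow ha h (by linarith : 0 ≤ p - 1)) hb
    rw [e b hb] at this
    linarith [Real.rpow_nonneg ha p]
  · have := mul_le_mul_of_nonneg_left h (Real.rpow_nonneg ha (p - 1))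
    rw [e a ha] at this
    linarith [Real.rpow_nonneg hb p]

/-! ### Radial integrals of powers of the norm -/

section Radial

variable {n : ℕ}

/-- `n` times the volume of the unit ball of `ℝⁿ`. -/
noncomputable def sphereMass (n : ℕ) : ℝ :=
  n * volume.real (Metric.ball (0 : EuclideanSpace ℝ (Fin n)) 1)

lemma volume_unit_ball_pos :
    0 < volume.real (Metric.ball (0 : EuclideanSpace ℝ (Fin n)) 1) :=
  ENNReal.toReal_pos (Metric.measure_ball_pos _ _ one_pos).ne' measure_ball_lt_top.ne

lemma sphereMass_pos (hn : 1 ≤ n) : 0 < sphereMass n := by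
  have : (0 : ℝ) < n := by exact_mod_cast hn
  exact mul_pos this volume_unit_ball_pos

lemma nontrivial_euclideanSpace (hn : 1 ≤ n) : Nontrivial (EuclideanSpace ℝ (Fin n)) := by
  have : Nonempty (Fin n) := ⟨⟨0, hn⟩⟩
  infer_instance

lemma natCast_pow_mul_rpow (hn : 1 ≤ n) {y a : ℝ} (hy : 0 < y) :
    y ^ (n - 1) * y ^ (a - n) = y ^ (a - 1) := by
  rw [← Real.rpow_natCast, ← Real.rpow_add hy, Nat.cast_sub hn]
  congr 1
  push_cast
  ring

lemma radial_ball (hn : 1 ≤ n) {a R : ℝ} (ha : 0 < a) (hR : 0 < R) :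
    IntegrableOn (fun h : EuclideanSpace ℝ (Fin n) => ‖h‖ ^ (a - n)) (Metric.ball 0 R) ∧
    ∫ h : EuclideanSpace ℝ (Fin n) in Metric.ball 0 R, ‖h‖ ^ (a - n) =
      sphereMass n * (R ^ a / a) := by
  have := nontrivial_euclideanSpace hn
  have ind : (Metric.ball (0 : EuclideanSpace ℝ (Fin n)) R).indicator (fun h => ‖h‖ ^ (a - n)) =
      fun h => (Set.Iio R).indicator (fun t : ℝ => t ^ (a - n)) ‖h‖ := by
    ext h; simp [Set.indicator]
  have heq : Set.EqOn (fun y : ℝ => y ^ (Module.finrank ℝ (EuclideanSpace ℝ (Fin n)) - 1) •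
      (Set.Iio R).indicator (fun t : ℝ => t ^ (a - n)) y)
      ((Set.Iio R).indicator fun t => t ^ (a - 1)) (Set.Ioi 0) := by
    intro y hy
    simp only [finrank_euclideanSpace, Fintype.card_fin, smul_eq_mul, Set.indicator]
    split_ifs
    · exact natCast_pow_mul_rpow hn hy
    · simp
  have hset : Set.Ioi (0 : ℝ) ∩ Set.Iio R = Set.Ioo 0 R := rfl
  have hi : IntegrableOn (fun t : ℝ => t ^ (a - 1)) (Set.Ioo 0 R) := by
    have := (intervalIntegral.intervalIntegrable_rpow' (a := 0) (b := R) (r := a - 1)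
      (by linarith)).1
    exact this.mono_set Set.Ioo_subset_Ioc_self
  constructor
  · rw [← integrable_indicator_iff Metric.isOpen_ball.measurableSet, ind,
      integrable_fun_norm_addHaar]
    rw [integrableOn_congr_fun heq measurableSet_Ioi, IntegrableOn,
      integrable_indicator_iff measurableSet_Iio, IntegrableOn,
      Measure.restrict_restrict measurableSet_Iio, Set.inter_comm, hset]
    exact hi
  · rw [← integral_indicator Metric.isOpen_ball.measurableSet, ind, integral_fun_norm_addHaar,
      setIntegral_congr_fun measurableSet_Ioi heq, setIntegral_indicator measurableSet_Iio, hset,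
      ← integral_Ioc_eq_integral_Ioo, ← intervalIntegral.integral_of_le hR.le,
      integral_rpow (Or.inl (by linarith))]
    simp [sphereMass, Real.zero_rpow ha.ne']
    ring

lemma radial_compl_ball (hn : 1 ≤ n) {a R : ℝ} (ha : 0 < a) (hR : 0 < R) :
    IntegrableOn (fun h : EuclideanSpace ℝ (Fin n) => ‖h‖ ^ (-a - n)) (Metric.ball 0 R)ᶜ ∧
    ∫ h : EuclideanSpace ℝ (Fin n) in (Metric.ball 0 R)ᶜ, ‖h‖ ^ (-a - n) =
      sphereMass n * (R ^ (-a) / a) := by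
  have := nontrivial_euclideanSpace hn
  have ms : MeasurableSet (Metric.ball (0 : EuclideanSpace ℝ (Fin n)) R)ᶜ :=
    Metric.isOpen_ball.measurableSet.compl
  have ind : (Metric.ball (0 : EuclideanSpace ℝ (Fin n)) R)ᶜ.indicator (fun h => ‖h‖ ^ (-a - n)) =
      fun h => (Set.Ici R).indicator (fun t : ℝ => t ^ (-a - n)) ‖h‖ := by
    ext h; simp [Set.indicator]
  have heq : Set.EqOn (fun y : ℝ => y ^ (Module.finrank ℝ (EuclideanSpace ℝ (Fin n)) - 1) •
      (Set.Ici R).indicator (fun t : ℝ => t ^ (-a - n)) y)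
      ((Set.Ici R).indicator fun t => t ^ (-a - 1)) (Set.Ioi 0) := by
    intro y hy
    simp only [finrank_euclideanSpace, Fintype.card_fin, smul_eq_mul, Set.indicator]
    split_ifs
    · exact natCast_pow_mul_rpow hn hy
    · simp
  have hset : Set.Ioi (0 : ℝ) ∩ Set.Ici R = Set.Ici R :=
    Set.inter_eq_right.2 fun x hx => lt_of_lt_of_le hR hx
  have hi : IntegrableOn (fun t : ℝ => t ^ (-a - 1)) (Set.Ici R) := by
    rw [integrableOn_Ici_iff_integrableOn_Ioi]
    exact integrableOn_Ioi_rpow_of_lt (by linarith) hR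
  constructor
  · rw [← integrable_indicator_iff ms, ind,
      integrable_fun_norm_addHaar]
    rw [integrableOn_congr_fun heq measurableSet_Ioi, IntegrableOn,
      integrable_indicator_iff measurableSet_Ici, IntegrableOn,
      Measure.restrict_restrict measurableSet_Ici, Set.inter_comm, hset]
    exact hi
  · rw [← integral_indicator ms, ind, integral_fun_norm_addHaar,
      setIntegral_congr_fun measurableSet_Ioi heq, setIntegral_indicator measurableSet_Ici, hset,
      integral_Ici_eq_integral_Ioi, integral_Ioi_rpow_of_lt (by linarith) hR]
    simp [sphereMass]
    ring

/-- Integrals over a punctured neighbourhood of `x`, translated to the origin. -/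
lemma setIntegral_sub_left (x : EuclideanSpace ℝ (Fin n)) (F : EuclideanSpace ℝ (Fin n) → ℝ)
    (S : Set (EuclideanSpace ℝ (Fin n))) (hS : MeasurableSet S) :
    ∫ y in {y | y - x ∈ S}, F (y - x) = ∫ h in S, F h := by
  rw [← integral_indicator hS, ← integral_indicator (by exact (measurable_sub_const x) hS),
    ← integral_sub_right_eq_self (S.indicator F) x]
  rfl

lemma integrableOn_sub_left (x : EuclideanSpace ℝ (Fin n)) {F : EuclideanSpace ℝ (Fin n) → ℝ}
    {S : Set (EuclideanSpace ℝ (Fin n))} (hS : MeasurableSet S) (hF : IntegrableOn F S) :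
    IntegrableOn (fun y => F (y - x)) {y | y - x ∈ S} := by
  rw [← integrable_indicator_iff hS] at hF
  rw [← integrable_indicator_iff (by exact (measurable_sub_const x) hS)]
  exact hF.comp_sub_right x

end Radial

/-! ### Tail integrability and cancellation in the principal value -/

section Tail

variable {n : ℕ}

/-- Measurable functions whose `(p-1)`-th power is integrable against `(1 + |y|)^(-n-ps)`. -/
def TailIntegrable (s p : ℝ) (u : EuclideanSpace ℝ (Fin n) → ℝ) : Prop :=
  Measurable u ∧ Integrable (fun y => |u y| ^ (p - 1) * (1 + ‖y‖) ^ (-((n : ℝ) + p * s)))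

lemma integrable_one_add_norm_rpow {s p : ℝ} (hps : 0 < p * s) :
    Integrable (fun y : EuclideanSpace ℝ (Fin n) => (1 + ‖y‖) ^ (-((n : ℝ) + p * s))) := by
  apply integrable_one_add_norm
  simpa using hps

/-- Off a ball about `x`, `1 + ‖y‖` is at most a multiple of `‖x - y‖`. The multiple depends on `x`
only through `R`, which gives dominating functions uniform in `x`. -/
lemma inv_rpow_norm_sub_le {q R ε : ℝ} (hq : 0 ≤ q) (hε : 0 < ε)
    {x y : EuclideanSpace ℝ (Fin n)} (hx : ‖x‖ ≤ R) (hxy : ε ≤ ‖x - y‖) :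
    (‖x - y‖ ^ q)⁻¹ ≤ ((1 + R) / ε + 1) ^ q * (1 + ‖y‖) ^ (-q) := by
  have hR : 0 ≤ R := (norm_nonneg _).trans hx
  have h0 : 0 < ‖x - y‖ := hε.trans_le hxy
  have h1 : 1 + ‖y‖ ≤ ((1 + R) / ε + 1) * ‖x - y‖ := by
    have h2 : ‖y‖ ≤ ‖x‖ + ‖x - y‖ := by
      have := norm_sub_le x (x - y); simpa using this
    have h3 : (1 + R) ≤ (1 + R) / ε * ‖x - y‖ := by
      rw [div_mul_eq_mul_div, le_div_iff₀ hε]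
      gcongr
    linarith
  have h4 := Real.rpow_le_rpow (by positivity) h1 hq
  rw [Real.mul_rpow (by positivity) (by positivity)] at h4
  rw [Real.rpow_neg (by positivity), ← div_eq_mul_inv, inv_eq_one_div,
    div_le_div_iff₀ (by positivity) (by positivity)]
  linarith

lemma abs_signedPow_sub_le_add {p : ℝ} (hp : 1 < p) (a b : ℝ) :
    |signedPow p (a - b)| ≤ 2 ^ (p - 1) * (|a| ^ (p - 1) + |b| ^ (p - 1)) := by
  rw [abs_signedPow hp]
  exact (Real.rpow_le_rpow (abs_nonneg _) (abs_sub a b) (by linarith)).trans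
    (add_rpow_le_two_rpow (by linarith) (abs_nonneg _) (abs_nonneg _))

lemma abs_kernel_le {s p R ε : ℝ} (hp : 1 < p) (hps : 0 < p * s) (hε : 0 < ε)
    {x y : EuclideanSpace ℝ (Fin n)} (hx : ‖x‖ ≤ R) (hxy : ε ≤ ‖x - y‖) (a b : ℝ) :
    |signedPow p (a - b) / ‖x - y‖ ^ ((n : ℝ) + p * s)| ≤
      (2 ^ (p - 1) * ((1 + R) / ε + 1) ^ ((n : ℝ) + p * s)) *
        (|a| ^ (p - 1) * (1 + ‖y‖) ^ (-((n : ℝ) + p * s)) +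
          |b| ^ (p - 1) * (1 + ‖y‖) ^ (-((n : ℝ) + p * s))) := by
  have h0 : 0 < ‖x - y‖ := hε.trans_le hxy
  rw [abs_div, abs_of_pos (Real.rpow_pos_of_pos h0 _), div_eq_mul_inv]
  have := mul_le_mul (abs_signedPow_sub_le_add hp a b)
    (inv_rpow_norm_sub_le (q := (n : ℝ) + p * s) (by positivity) hε hx hxy) (by positivity) (by positivity)
  refine this.trans (le_of_eq ?_)
  ring

lemma TailIntegrable.dominating {s p : ℝ} (hps : 0 < p * s)
    {u : EuclideanSpace ℝ (Fin n) → ℝ} (hu : TailIntegrable s p u) (C a : ℝ) :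
    Integrable fun y => C * (a * (1 + ‖y‖) ^ (-((n : ℝ) + p * s)) +
          |u y| ^ (p - 1) * (1 + ‖y‖) ^ (-((n : ℝ) + p * s))) :=
  ((((integrable_one_add_norm_rpow hps).const_mul a)).add hu.2).const_mul C

lemma measurable_kernel {s p : ℝ} (hp : 2 < p) {u : EuclideanSpace ℝ (Fin n) → ℝ}
    (hu : Measurable u) (x : EuclideanSpace ℝ (Fin n)) (a : ℝ) :
    Measurable fun y => signedPow p (a - u y) / ‖x - y‖ ^ ((n : ℝ) + p * s) :=
  ((continuous_signedPow hp).measurable.comp (measurable_const.sub hu)).div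
    ((measurable_const.sub measurable_id).norm.pow_const _)

lemma TailIntegrable.integrableOn {s p : ℝ} (hp : 2 < p) (hps : 0 < p * s)
    {u : EuclideanSpace ℝ (Fin n) → ℝ} (hu : TailIntegrable s p u)
    (x : EuclideanSpace ℝ (Fin n)) (a : ℝ) {ε : ℝ} (hε : 0 < ε) :
    IntegrableOn (fun y => signedPow p (a - u y) / ‖x - y‖ ^ ((n : ℝ) + p * s))
      (Metric.ball x ε)ᶜ := by
  refine Integrable.mono' (hu.dominating hps
    (2 ^ (p - 1) * ((1 + ‖x‖) / ε + 1) ^ ((n : ℝ) + p * s)) (|a| ^ (p - 1))).integrableOn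
    (measurable_kernel hp hu.1 x a).aestronglyMeasurable ?_
  refine (ae_restrict_iff' Metric.isOpen_ball.measurableSet.compl).2 (ae_of_all _ fun y hy => ?_)
  refine abs_kernel_le (by linarith) hps hε le_rfl ?_ a (u y)
  simpa [dist_eq_norm, norm_sub_rev] using hy

lemma TailIntegrable.mono {s p C : ℝ} (hp : 1 < p) {u v : EuclideanSpace ℝ (Fin n) → ℝ}
    (hu : TailIntegrable s p u) (hC : 0 ≤ C) (hv : Measurable v) (h : ∀ y, |v y| ≤ C * |u y|) :
    TailIntegrable s p v := by
  refine ⟨hv, (hu.2.const_mul (C ^ (p - 1))).mono'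
    (((hv.abs.pow_const _).mul ((measurable_const.add measurable_norm).pow_const _)).aestronglyMeasurable)
    (ae_of_all _ fun y => ?_)⟩
  rw [Real.norm_of_nonneg (by positivity), ← mul_assoc, ← Real.mul_rpow hC (abs_nonneg _)]
  gcongr
  exact h y

lemma truncFracPLap_eq (s p : ℝ) (u : EuclideanSpace ℝ (Fin n) → ℝ)
    (x : EuclideanSpace ℝ (Fin n)) (ε : ℝ) :
    truncFracPLap s p u x ε =
      ∫ y in (Metric.ball x ε)ᶜ, signedPow p (u x - u y) / ‖x - y‖ ^ ((n : ℝ) + p * s) := rfl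

/-- The annulus `ε ≤ |y - x| < R`. -/
def annulus (x : EuclideanSpace ℝ (Fin n)) (ε R : ℝ) : Set (EuclideanSpace ℝ (Fin n)) :=
  (Metric.ball x ε)ᶜ ∩ Metric.ball x R

lemma measurableSet_annulus (x : EuclideanSpace ℝ (Fin n)) (ε R : ℝ) :
    MeasurableSet (annulus x ε R) :=
  Metric.isOpen_ball.measurableSet.compl.inter Metric.isOpen_ball.measurableSet

lemma compl_ball_eq_union {x : EuclideanSpace ℝ (Fin n)} {ε R : ℝ} (h : ε ≤ R) :
    (Metric.ball x ε)ᶜ = annulus x ε R ∪ (Metric.ball x R)ᶜ := by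
  ext y
  simp only [annulus, Set.mem_compl_iff, Metric.mem_ball, Set.mem_union, Set.mem_inter_iff]
  constructor
  · intro h1
    by_cases h2 : dist y x < R
    · exact Or.inl ⟨h1, h2⟩
    · exact Or.inr h2
  · rintro (h1 | h1)
    · exact h1.1
    · exact fun h2 => h1 (h2.trans_le h)

lemma setIntegral_compl_ball_split {x : EuclideanSpace ℝ (Fin n)} {ε R : ℝ} (h : ε ≤ R)
    {F : EuclideanSpace ℝ (Fin n) → ℝ} (hF : IntegrableOn F (Metric.ball x ε)ᶜ) :
    ∫ y in (Metric.ball x ε)ᶜ, F y =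
      (∫ y in annulus x ε R, F y) + ∫ y in (Metric.ball x R)ᶜ, F y := by
  have hu := compl_ball_eq_union (x := x) h
  rw [hu] at hF ⊢
  refine setIntegral_union ?_ Metric.isOpen_ball.measurableSet.compl
    (hF.mono_set Set.subset_union_left) (hF.mono_set Set.subset_union_right)
  exact Set.disjoint_left.2 fun y h1 h2 => h2 h1.2

lemma annulus_eq_preimage (x : EuclideanSpace ℝ (Fin n)) (ε R : ℝ) :
    annulus x ε R = {y | y - x ∈ annulus 0 ε R} := by
  ext y
  simp [annulus, dist_eq_norm]

lemma compl_ball_eq_preimage (x : EuclideanSpace ℝ (Fin n)) (R : ℝ) :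
    (Metric.ball x R)ᶜ = {y | y - x ∈ (Metric.ball 0 R)ᶜ} := by
  ext y
  simp [dist_eq_norm]

/-- Cancellation in the principal value: the contribution of an annulus is controlled by
second differences. -/
lemma abs_setIntegral_annulus_le (hn : 1 ≤ n) {s p : ℝ} (hp : 2 < p) (hs1 : s < 1)
    (hs0 : 0 < s) {φ : EuclideanSpace ℝ (Fin n) → ℝ} (hφ : Measurable φ)
    {x : EuclideanSpace ℝ (Fin n)} {ε R Λ N : ℝ} (hε : 0 < ε) (hR : 0 < R)
    (hN : 0 ≤ N) (hΛ : 0 ≤ Λ)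
    (h1 : ∀ h, ‖h‖ < R → |φ (x + h) - φ x| ≤ N * ‖h‖)
    (h2 : ∀ h, ‖h‖ < R → |φ (x + h) + φ (x - h) - 2 * φ x| ≤ 2 * Λ * ‖h‖ ^ 2) :
    |∫ y in annulus x ε R, signedPow p (φ x - φ y) / ‖x - y‖ ^ ((n : ℝ) + p * s)| ≤
      (p - 1) * N ^ (p - 2) * Λ * (sphereMass n * (R ^ (p - p * s) / (p - p * s))) := by
  set q := (n : ℝ) + p * s with hq
  have hps : 0 < p - p * s := by nlinarith
  have hq0 : 0 ≤ q := by positivity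
  let g : EuclideanSpace ℝ (Fin n) → ℝ := fun h => signedPow p (φ x - φ (x + h)) / ‖h‖ ^ q
  have hg : Measurable g :=
    ((continuous_signedPow hp).measurable.comp
      (measurable_const.sub (hφ.comp (measurable_const_add x)))).div (measurable_norm.pow_const _)
  have e1 : ∫ y in annulus x ε R, signedPow p (φ x - φ y) / ‖x - y‖ ^ q =
      ∫ h in annulus 0 ε R, g h := by
    rw [← setIntegral_sub_left x g _ (measurableSet_annulus _ _ _), annulus_eq_preimage]
    simp [g, norm_sub_rev]
  have mem : ∀ h ∈ annulus (0 : EuclideanSpace ℝ (Fin n)) ε R, ε ≤ ‖h‖ ∧ ‖h‖ < R := by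
    intro h hh; simpa [annulus] using hh
  have gi : IntegrableOn g (annulus 0 ε R) := by
    refine Measure.integrableOn_of_bounded (M := (N * R) ^ (p - 1) / ε ^ q) ?_
      hg.aestronglyMeasurable ?_
    · exact (measure_mono Set.inter_subset_right).trans_lt measure_ball_lt_top |>.ne
    · refine (ae_restrict_iff' (measurableSet_annulus _ _ _)).2 (ae_of_all _ fun h hh => ?_)
      obtain ⟨a1, a2⟩ := mem h hh
      rw [Real.norm_eq_abs, abs_div, abs_signedPow (by linarith),
        abs_of_nonneg (by positivity : 0 ≤ ‖h‖ ^ q)]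
      gcongr
      · linarith
      · rw [abs_sub_comm]
        exact (h1 h a2).trans (by gcongr)
  -- The annulus is symmetric, so `g h` may be replaced by the mean of `g h` and `g (-h)`, which
  -- removes the first-order part.
  have symm : ∫ h in annulus 0 ε R, g h = ∫ h in annulus 0 ε R, g (-h) := by
    rw [← integral_indicator (measurableSet_annulus _ _ _),
      ← integral_indicator (measurableSet_annulus _ _ _), ← integral_neg_eq_self]
    congr 1
    ext h
    simp [Set.indicator, annulus]
  have gin : IntegrableOn (fun h => g (-h)) (annulus 0 ε R) := by
    rw [← integrable_indicator_iff (measurableSet_annulus _ _ _)] at gi ⊢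
    refine gi.comp_neg.congr (ae_of_all _ fun h => ?_)
    simp [Set.indicator, annulus]
  have two : 2 * ∫ h in annulus 0 ε R, g h = ∫ h in annulus 0 ε R, (g h + g (-h)) := by
    rw [integral_add gi gin, ← symm]; ring
  set c := (p - 1) * N ^ (p - 2) * Λ with hc
  have c0 : 0 ≤ c := by
    have : 0 ≤ p - 1 := by linarith
    positivity
  have rb := radial_ball hn hps hR
  have bd : ∀ h ∈ annulus (0 : EuclideanSpace ℝ (Fin n)) ε R,
      ‖g h + g (-h)‖ ≤ 2 * c * ‖h‖ ^ (p - p * s - n) := by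
    intro h hh
    obtain ⟨a1, a2⟩ := mem h hh
    have hpos : 0 < ‖h‖ := hε.trans_le a1
    have a3 : |φ x - φ (x + h)| ≤ N * ‖h‖ := by rw [abs_sub_comm]; exact h1 h a2
    have a4 : |φ (x - h) - φ x| ≤ N * ‖h‖ := by
      have := h1 (-h) (by simpa using a2)
      simpa [sub_eq_add_neg] using this
    have a5 := abs_signedPow_sub_le hp a3 a4
    have a6 : |φ x - φ (x + h) - (φ (x - h) - φ x)| ≤ 2 * Λ * ‖h‖ ^ 2 := by
      rw [← abs_neg]
      convert h2 h a2 using 2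
      ring
    have a7 : g h + g (-h) =
        (signedPow p (φ x - φ (x + h)) - signedPow p (φ (x - h) - φ x)) / ‖h‖ ^ q := by
      simp only [g, norm_neg, ← sub_eq_add_neg]
      rw [← neg_sub (φ (x - h)) (φ x), signedPow_neg]
      ring
    rw [a7, Real.norm_eq_abs, abs_div, abs_of_nonneg (by positivity : 0 ≤ ‖h‖ ^ q),
      div_le_iff₀ (by positivity), mul_assoc, ← Real.rpow_add hpos]
    -- The two increments are of size `N * ‖h‖` and differ by `2 * Λ * ‖h‖ ^ 2`, so the numerator is
    -- of order `‖h‖ ^ p`; after division by the kernel the singularity is integrable because `s <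
    -- 1`.
    have a8 : p - p * s - n + q = (p - 2) + 2 := by rw [hq]; ring
    rw [a8, Real.rpow_add hpos, Real.rpow_two]
    refine a5.trans ?_
    rw [Real.mul_rpow hN hpos.le]
    have : (0 : ℝ) ≤ (p - 1) * (N ^ (p - 2) * ‖h‖ ^ (p - 2)) := by
      have : 0 ≤ p - 1 := by linarith
      positivity
    refine (mul_le_mul_of_nonneg_left a6 this).trans (le_of_eq ?_)
    rw [hc]; ring
  have fin : |∫ h in annulus 0 ε R, (g h + g (-h))| ≤
      2 * c * (sphereMass n * (R ^ (p - p * s) / (p - p * s))) := by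
    rw [← rb.2, ← integral_const_mul]
    refine (norm_integral_le_of_norm_le
      (IntegrableOn.mono_set (rb.1.const_mul (2 * c)) (Set.inter_subset_right : annulus 0 ε R ⊆ _))
      ((ae_restrict_iff' (measurableSet_annulus _ _ _)).2 (ae_of_all _ bd))).trans ?_
    exact setIntegral_mono_set (rb.1.const_mul (2 * c)) (ae_of_all _ fun h => by positivity)
      (ae_of_all _ fun h hh => hh.2)
  rw [← two, abs_mul, abs_two] at fin
  rw [e1]
  linarith

end Tail

/-! ### From pointwise solutions to one-sided bounds on truncated operators -/

section Subsolution

variable {n : ℕ}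

/-- Supplies the first and second differences required by `abs_setIntegral_annulus_le`, with
constants common to all points near `x₀`. Each one-sided Taylor remainder is at most `Λ * ‖h‖ ^ 2`,
and two of them add up. -/
lemma C11Loc.exists_bounds {Ω : Set (EuclideanSpace ℝ (Fin n))} (hΩ : IsOpen Ω)
    {u : EuclideanSpace ℝ (Fin n) → ℝ} (hu : C11Loc Ω u) {x₀ : EuclideanSpace ℝ (Fin n)}
    (hx₀ : x₀ ∈ Ω) : ∃ δ N Λ : ℝ, 0 < δ ∧ 0 ≤ N ∧ 0 ≤ Λ ∧ ∀ x ∈ Metric.ball x₀ δ, ∀ h, ‖h‖ < δ →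
      |u (x + h) - u x| ≤ N * ‖h‖ ∧ |u (x + h) + u (x - h) - 2 * u x| ≤ 2 * Λ * ‖h‖ ^ 2 := by
  obtain ⟨K, t, ht, hK⟩ := hu.2 hx₀
  rw [hΩ.nhdsWithin_eq hx₀] at ht
  obtain ⟨r, hr, hrt⟩ := Metric.mem_nhds_iff.1 (inter_mem ht (hΩ.mem_nhds hx₀))
  have hKd : ∀ a ∈ Metric.ball x₀ r, ∀ b ∈ Metric.ball x₀ r,
      ‖fderiv ℝ u a - fderiv ℝ u b‖ ≤ K * ‖a - b‖ := fun a ha b hb => by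
    rw [← dist_eq_norm, ← dist_eq_norm]
    exact hK.dist_le_mul a (hrt ha).1 b (hrt hb).1
  have hd : ∀ a ∈ Metric.ball x₀ r, DifferentiableAt ℝ u a := fun a ha =>
    hu.1.differentiableAt (hΩ.mem_nhds (hrt ha).2)
  refine ⟨r / 2, ‖fderiv ℝ u x₀‖ + K * r, K, by positivity, by positivity, by positivity, ?_⟩
  intro x hx h hh
  have hsub : Metric.closedBall x ‖h‖ ⊆ Metric.ball x₀ r := by
    intro y hy
    rw [Metric.mem_closedBall] at hy
    rw [Metric.mem_ball] at hx ⊢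
    linarith [dist_triangle y x x₀]
  have hxb : x ∈ Metric.closedBall x ‖h‖ := Metric.mem_closedBall_self (norm_nonneg _)
  have hp : x + h ∈ Metric.closedBall x ‖h‖ := by simp
  have hm : x - h ∈ Metric.closedBall x ‖h‖ := by simp
  constructor
  · have := Convex.norm_image_sub_le_of_norm_fderiv_le (f := u) (𝕜 := ℝ)
      (C := ‖fderiv ℝ u x₀‖ + K * r) (s := Metric.closedBall x ‖h‖)
      (fun a ha => hd a (hsub ha)) (fun a ha => ?_) (convex_closedBall _ _) hxb hp
    · simpa using this
    · have h1 := hKd a (hsub ha) x₀ (Metric.mem_ball_self hr)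
      have h2 : ‖a - x₀‖ ≤ r := by
        rw [← dist_eq_norm]; exact (Metric.mem_ball.1 (hsub ha)).le
      have h3 : ‖fderiv ℝ u a‖ ≤ ‖fderiv ℝ u x₀‖ + ‖fderiv ℝ u a - fderiv ℝ u x₀‖ := by
        have := norm_add_le (fderiv ℝ u x₀) (fderiv ℝ u a - fderiv ℝ u x₀)
        simpa using this
      have h4 : (K : ℝ) * ‖a - x₀‖ ≤ K * r := by gcongr
      linarith
  · have bd : ∀ a ∈ Metric.closedBall x ‖h‖, ‖fderiv ℝ u a - fderiv ℝ u x‖ ≤ K * ‖h‖ := by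
      intro a ha
      refine (hKd a (hsub ha) x (hsub hxb)).trans ?_
      gcongr
      rw [← dist_eq_norm]; exact ha
    have t1 := Convex.norm_image_sub_le_of_norm_fderiv_le' (f := u) (𝕜 := ℝ)
      (fun a ha => hd a (hsub ha)) bd (convex_closedBall _ _) hxb hp
    have t2 := Convex.norm_image_sub_le_of_norm_fderiv_le' (f := u) (𝕜 := ℝ)
      (fun a ha => hd a (hsub ha)) bd (convex_closedBall _ _) hxb hm
    have e1 : x + h - x = h := by abel
    have e2 : x - h - x = -h := by abel
    rw [e1] at t1
    rw [e2, norm_neg, map_neg] at t2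
    rw [Real.norm_eq_abs, abs_le] at t1 t2
    rw [abs_le]
    constructor <;> nlinarith

/-- Two truncations differ by an annulus integral, whose bound does not involve the inner radius;
that radius then tends to zero. The rate is uniform wherever `N` and `Λ` are. -/
lemma abs_truncFracPLap_sub_le (hn : 1 ≤ n) {K s p : ℝ} (hK : 0 < K) (hp : 2 < p) (hs0 : 0 < s)
    (hs1 : s < 1) {u : EuclideanSpace ℝ (Fin n) → ℝ} (hu : TailIntegrable s p u)
    {x : EuclideanSpace ℝ (Fin n)} {L δ N Λ ε : ℝ} (hL : HasFracPLap K s p u x L)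
    (hN : 0 ≤ N) (hΛ : 0 ≤ Λ)
    (hb : ∀ h, ‖h‖ < δ →
      |u (x + h) - u x| ≤ N * ‖h‖ ∧ |u (x + h) + u (x - h) - 2 * u x| ≤ 2 * Λ * ‖h‖ ^ 2)
    (hε : 0 < ε) (hεδ : ε ≤ δ) :
    |L / K - truncFracPLap s p u x ε| ≤
      (p - 1) * N ^ (p - 2) * Λ * (sphereMass n * (ε ^ (p - p * s) / (p - p * s))) := by
  have hps : 0 < p * s := by positivity
  have lim : Tendsto (fun ε' => |truncFracPLap s p u x ε' - truncFracPLap s p u x ε|) (𝓝[>] 0)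
      (𝓝 |L / K - truncFracPLap s p u x ε|) := by
    have h1 : Tendsto (fun ε' => truncFracPLap s p u x ε') (𝓝[>] 0) (𝓝 (L / K)) := by
      have := hL.div_const K
      refine this.congr fun ε' => ?_
      field_simp
    exact (h1.sub_const _).abs
  refine le_of_tendsto lim ?_
  filter_upwards [Ioo_mem_nhdsGT hε] with ε' hε'
  have hi := hu.integrableOn hp hps x (u x) hε'.1
  rw [truncFracPLap_eq, setIntegral_compl_ball_split hε'.2.le hi, truncFracPLap_eq,
    add_sub_cancel_right]
  exact abs_setIntegral_annulus_le hn hp hs1 hs0 hu.1 hε'.1 hε hN hΛ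
    (fun h hh => (hb h (hh.trans_le hεδ)).1) (fun h hh => (hb h (hh.trans_le hεδ)).2)

lemma continuousAt_truncFracPLap (hn : 1 ≤ n) {s p : ℝ} (hp : 2 < p) (hps : 0 < p * s)
    {u : EuclideanSpace ℝ (Fin n) → ℝ} (hu : TailIntegrable s p u)
    {x₀ : EuclideanSpace ℝ (Fin n)} (hc : ContinuousAt u x₀) {ε : ℝ} (hε : 0 < ε) :
    ContinuousAt (fun x => truncFracPLap s p u x ε) x₀ := by
  have := nontrivial_euclideanSpace hn
  have e : (fun x => truncFracPLap s p u x ε) = fun x => ∫ y, (Metric.ball x ε)ᶜ.indicator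
      (fun y => signedPow p (u x - u y) / ‖x - y‖ ^ ((n : ℝ) + p * s)) y := by
    ext x
    rw [truncFracPLap_eq, integral_indicator Metric.isOpen_ball.measurableSet.compl]
  rw [e]
  refine continuousAt_of_dominated (bound := fun y =>
    (2 ^ (p - 1) * ((1 + (‖x₀‖ + 1)) / ε + 1) ^ ((n : ℝ) + p * s)) *
      ((|u x₀| + 1) ^ (p - 1) * (1 + ‖y‖) ^ (-((n : ℝ) + p * s)) +
          |u y| ^ (p - 1) * (1 + ‖y‖) ^ (-((n : ℝ) + p * s)))) ?_ ?_
      (hu.dominating hps _ _) ?_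
  · exact Eventually.of_forall fun x => ((measurable_kernel hp hu.1 x (u x)).indicator
      Metric.isOpen_ball.measurableSet.compl).aestronglyMeasurable
  · have h1 : ∀ᶠ x in 𝓝 x₀, |u x| < |u x₀| + 1 :=
      hc.abs.eventually (gt_mem_nhds (by linarith))
    have h2 : ∀ᶠ x in 𝓝 x₀, ‖x‖ < ‖x₀‖ + 1 :=
      continuous_norm.continuousAt.eventually (gt_mem_nhds (by linarith))
    filter_upwards [h1, h2] with x hx1 hx2
    refine ae_of_all _ fun y => ?_
    by_cases hy : y ∈ (Metric.ball x ε)ᶜ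
    · rw [Set.indicator_of_mem hy]
      refine (abs_kernel_le (by linarith) hps hε hx2.le ?_ (u x) (u y)).trans ?_
      · simpa [dist_eq_norm, norm_sub_rev] using hy
      · gcongr
        linarith
    · rw [Set.indicator_of_notMem hy, norm_zero]
      positivity
  -- As `x` varies the excluded ball moves, and the integrand can jump only for `y` on the sphere of
  -- radius `ε` about `x₀`, a null set.
  · have hs : ∀ᵐ y : EuclideanSpace ℝ (Fin n), y ∉ Metric.sphere x₀ ε :=
      measure_eq_zero_iff_ae_notMem.1 (Measure.addHaar_sphere _ _ _)
    filter_upwards [hs] with y hy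
    have hd : ContinuousAt (fun x => dist y x) x₀ := by fun_prop
    rcases lt_or_gt_of_ne (show dist y x₀ ≠ ε from hy) with h | h
    · refine (continuousAt_const (y := (0 : ℝ))).congr ?_
      filter_upwards [hd.eventually (gt_mem_nhds h)] with x hx
      rw [Set.indicator_of_notMem]
      simpa using hx
    · have hc' : ContinuousAt
          (fun x => signedPow p (u x - u y) / ‖x - y‖ ^ ((n : ℝ) + p * s)) x₀ := by
        have h0 : 0 < ‖x₀ - y‖ := by
          rw [← dist_eq_norm, dist_comm]; exact hε.trans h
        refine ContinuousAt.div ((continuous_signedPow hp).continuousAt.comp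
          (hc.sub continuousAt_const)) ?_ (Real.rpow_pos_of_pos h0 _).ne'
        exact ContinuousAt.rpow_const (by fun_prop) (Or.inl h0.ne')
      refine hc'.congr ?_
      filter_upwards [hd.eventually (lt_mem_nhds h)] with x hx
      rw [Set.indicator_of_mem]
      simpa using hx.le

lemma tendsto_rpow_error {a : ℝ} (ha : 0 < a) (c d : ℝ) :
    Tendsto (fun ε : ℝ => c * (d * (ε ^ a / a))) (𝓝[>] 0) (𝓝 0) := by
  have h1 : ContinuousAt (fun ε : ℝ => c * (d * (ε ^ a / a))) 0 := by
    have : ContinuousAt (fun ε : ℝ => ε ^ a) 0 :=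
      Real.continuousAt_rpow_const _ _ (Or.inr ha.le)
    fun_prop
  have h2 := h1.tendsto.mono_left (nhdsWithin_le_nhds (s := Set.Ioi 0))
  simpa [Real.zero_rpow ha.ne'] using h2

/-- A function with controlled fractional `p`-Laplacian from above in `Ω`, zero exterior data and weak
nonpositive boundary values. -/
structure IsSubsolution (s p B : ℝ) (Ω : Set (EuclideanSpace ℝ (Fin n)))
    (u : EuclideanSpace ℝ (Fin n) → ℝ) : Prop where
  tail : TailIntegrable s p u
  cont : ContinuousOn u Ω
  zero_outside : ∀ x, x ∉ Ω → u x = 0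
  gagliardo : ∀ ε : ℝ, 0 < ε → FiniteGagliardo s p (fun x => max (u x - ε) 0)
  upper : ∀ S ⊆ Ω, IsCompact S → ∀ η : ℝ, 0 < η →
    ∀ᶠ ε in 𝓝[>] (0 : ℝ), ∀ x ∈ S, truncFracPLap s p u x ε ≤ B + η

section Dirichlet

variable {K s p : ℝ} {Ω : Set (EuclideanSpace ℝ (Fin n))} {f u : EuclideanSpace ℝ (Fin n) → ℝ}

/-- Allows every upper estimate to be applied to `-u` as well. -/
lemma IsDirichletSolution.neg (hu : IsDirichletSolution K s p Ω f u) :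
    IsDirichletSolution K s p Ω (fun x => -f x) (fun x => -u x) where
  memLsp := ⟨hu.memLsp.1.neg, by simpa using hu.memLsp.2⟩
  c11 := by
    have e : fderiv ℝ (fun x => -u x) = fun x => -fderiv ℝ u x := by
      ext1 x; exact fderiv_fun_neg
    refine ⟨hu.c11.1.fun_neg, ?_⟩
    rw [e]
    intro x hx
    obtain ⟨C, t, ht, h⟩ := hu.c11.2 hx
    exact ⟨C, t, ht, h.neg⟩
  eqn x hx := by
    have e : ∀ ε, truncFracPLap s p (fun x => -u x) x ε = -truncFracPLap s p u x ε := by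
      intro ε
      rw [truncFracPLap_eq, truncFracPLap_eq, ← integral_neg]
      congr 1
      ext y
      rw [← neg_div, ← signedPow_neg]
      congr 2
      ring
    have := (hu.eqn x hx).neg
    refine this.congr fun ε => ?_
    rw [e]; ring
  zero_outside x hx := by rw [hu.zero_outside x hx, neg_zero]
  zero_boundary ε hε := by
    have := hu.zero_boundary ε hε
    exact ⟨this.2, by simpa using this.1⟩

lemma IsDirichletSolution.continuousOn (hu : IsDirichletSolution K s p Ω f u) :
    ContinuousOn u Ω := hu.c11.1.continuousOn

lemma IsDirichletSolution.measurable (hΩ : IsOpen Ω) (hu : IsDirichletSolution K s p Ω f u) :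
    Measurable u := by
  classical
  have e : u = Ω.piecewise u (fun _ => 0) := by
    ext x
    by_cases h : x ∈ Ω
    · simp [h]
    · simp [h, hu.zero_outside x h]
  rw [e]
  exact ContinuousOn.measurable_piecewise hu.continuousOn continuousOn_const hΩ.measurableSet

lemma IsDirichletSolution.tailIntegrable (hn : 1 ≤ n) (hps : 0 < p * s) (hΩ : IsOpen Ω)
    (hu : IsDirichletSolution K s p Ω f u) : TailIntegrable s p u := by
  have hm := hu.measurable hΩ
  refine ⟨hm, hu.memLsp.2.mono'
    ((hm.abs.pow_const _).mul ((measurable_const.add measurable_norm).pow_const _)).aestronglyMeasurable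
    (ae_of_all _ fun y => ?_)⟩
  rw [Real.norm_of_nonneg (by positivity), mul_comm s p, Real.rpow_neg (by positivity),
    ← div_eq_mul_inv]
  have hn' : (1 : ℝ) ≤ n := by exact_mod_cast hn
  -- Superadditivity of powers with exponent at least one gives `1 + ‖y‖ ^ q ≤ (1 + ‖y‖) ^ q`, which
  -- compares the two weights.
  have := Real.add_rpow_le_rpow_add zero_le_one (norm_nonneg y)
    (by linarith : 1 ≤ (n : ℝ) + p * s)
  rw [Real.one_rpow] at this
  gcongr

/-- Near each point `f / K` is a uniform limit of truncated operators, and these are continuous. -/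
lemma IsDirichletSolution.continuousOn_rhs (hn : 1 ≤ n) (hK : 0 < K) (hp : 2 < p) (hs0 : 0 < s)
    (hs1 : s < 1) (hΩ : IsOpen Ω) (hu : IsDirichletSolution K s p Ω f u) :
    ContinuousOn f Ω := by
  have hps : 0 < p * s := by positivity
  have hps1 : 0 < p - p * s := by nlinarith
  have ht := hu.tailIntegrable hn hps hΩ
  have key : ContinuousOn (fun x => f x / K) Ω := by
    intro x₀ hx₀
    refine ContinuousAt.continuousWithinAt ?_
    obtain ⟨δ, N, Λ, hδ, hN, hΛ, hb⟩ := hu.c11.exists_bounds hΩ hx₀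
    refine continuousAt_of_locally_uniform_approx_of_continuousAt fun U hU => ?_
    obtain ⟨η, hη, hηU⟩ := Metric.mem_uniformity_dist.1 hU
    have ev := (tendsto_rpow_error hps1 ((p - 1) * N ^ (p - 2) * Λ) (sphereMass n)).eventually
      (gt_mem_nhds hη)
    obtain ⟨ε, h1, h2⟩ := (ev.and (Ioo_mem_nhdsGT hδ)).exists
    refine ⟨Ω ∩ Metric.ball x₀ δ, inter_mem (hΩ.mem_nhds hx₀) (Metric.ball_mem_nhds _ hδ),
      fun x => truncFracPLap s p u x ε, continuousAt_truncFracPLap hn hp hps ht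
        (hu.continuousOn.continuousAt (hΩ.mem_nhds hx₀)) h2.1, fun y hy => hηU ?_⟩
    rw [Real.dist_eq]
    exact (abs_truncFracPLap_sub_le hn hK hp hs0 hs1 ht (hu.eqn y hy.1) hN hΛ
      (hb y hy.2) h2.1 h2.2.le).trans_lt h1
  refine (key.mul_const K).congr fun x _ => ?_
  field_simp

/-- A continuous function exceeding its essential bound at one point would exceed it on a nonempty
open set, which has positive measure. -/
lemma IsDirichletSolution.abs_rhs_le (hn : 1 ≤ n) (hK : 0 < K) (hp : 2 < p) (hs0 : 0 < s)
    (hs1 : s < 1) (hΩ : IsOpen Ω) (hu : IsDirichletSolution K s p Ω f u)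
    (hf : eLpNorm f ⊤ (volume.restrict Ω) < ⊤) :
    ∀ x ∈ Ω, |f x| ≤ (eLpNorm f ⊤ (volume.restrict Ω)).toReal := by
  set B := (eLpNorm f ⊤ (volume.restrict Ω)).toReal
  have hc := hu.continuousOn_rhs hn hK hp hs0 hs1 hΩ
  have hae : ∀ᵐ x ∂(volume.restrict Ω), |f x| ≤ B := by
    have := ae_le_eLpNormEssSup (f := f) (μ := volume.restrict Ω)
    filter_upwards [this] with x hx
    rw [← eLpNorm_exponent_top] at hx
    have h2 := ENNReal.toReal_mono hf.ne hx
    simpa [B] using h2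
  by_contra! h
  obtain ⟨x, hx, hxB⟩ := h
  have ho : IsOpen (Ω ∩ {y | B < |f y|}) := by
    exact hc.abs.isOpen_inter_preimage hΩ isOpen_Ioi
  have hpos := ho.measure_pos volume ⟨x, hx, hxB⟩
  rw [ae_restrict_iff' hΩ.measurableSet] at hae
  refine hpos.ne' (measure_mono_null ?_ (ae_iff.1 hae))
  exact fun y hy h => absurd (h hy.1) (not_le.2 hy.2)

lemma IsDirichletSolution.isSubsolution (hn : 1 ≤ n) (hK : 0 < K) (hp : 2 < p) (hs0 : 0 < s)
    (hs1 : s < 1) (hΩ : IsOpen Ω) (hu : IsDirichletSolution K s p Ω f u) {B : ℝ}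
    (hf : ∀ x ∈ Ω, |f x| ≤ B) : IsSubsolution s p (B / K) Ω u := by
  have hps : 0 < p * s := by positivity
  have hps1 : 0 < p - p * s := by nlinarith
  have ht := hu.tailIntegrable hn hps hΩ
  refine ⟨ht, hu.continuousOn, hu.zero_outside, fun ε hε => (hu.zero_boundary ε hε).1, ?_⟩
  intro S hS hSc η hη
  -- The principal value converges uniformly near each point; compactness gives one threshold for
  -- `ε` on all of `S`.
  refine hSc.induction_on (p := fun S => ∀ᶠ ε in 𝓝[>] (0 : ℝ), ∀ x ∈ S,
    truncFracPLap s p u x ε ≤ B / K + η) (by simp) (fun S T hST h => ?_) (fun S T h1 h2 => ?_)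
    fun x₀ hx₀ => ?_
  · filter_upwards [h] with ε hε x hx using hε x (hST hx)
  · filter_upwards [h1, h2] with ε e1 e2 x hx using hx.elim (e1 x) (e2 x)
  obtain ⟨δ, N, Λ, hδ, hN, hΛ, hb⟩ := hu.c11.exists_bounds hΩ (hS hx₀)
  refine ⟨Ω ∩ Metric.ball x₀ δ, mem_nhdsWithin_of_mem_nhds
    (inter_mem (hΩ.mem_nhds (hS hx₀)) (Metric.ball_mem_nhds _ hδ)), ?_⟩
  filter_upwards [(tendsto_rpow_error hps1 ((p - 1) * N ^ (p - 2) * Λ) (sphereMass n)).eventually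
      (gt_mem_nhds hη), Ioo_mem_nhdsGT hδ] with ε h1 h2 x hx
  have h3 := abs_truncFracPLap_sub_le hn hK hp hs0 hs1 ht (hu.eqn x hx.1) hN hΛ
      (hb x hx.2) h2.1 h2.2.le
  have h4 : f x / K ≤ B / K := by
    gcongr; exact (le_abs_self _).trans (hf x hx.1)
  have := (abs_le.1 h3).1
  linarith

end Dirichlet

end Subsolution

/-! ### Exterior balls and the mass of the kernel outside the domain -/

section Geometry

variable {n : ℕ} {Ω : Set (EuclideanSpace ℝ (Fin n))}

/-- A homothety centred at the boundary point shrinks the given exterior ball to any smaller radius.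
-/
lemma ExteriorTangentSphere.exists_ball (h : ExteriorTangentSphere Ω) :
    ∃ ρ : ℝ, 0 < ρ ∧ ∀ x ∈ frontier Ω, ∀ r, 0 < r → r ≤ ρ →
      ∃ c, dist c x = r ∧ Disjoint (Metric.ball c r) Ω := by
  obtain ⟨ρ, hρ, h⟩ := h
  refine ⟨ρ, hρ, fun x hx r hr hrρ => ?_⟩
  obtain ⟨z, hz, hd⟩ := h x hx
  rw [dist_eq_norm] at hz
  refine ⟨x + (r / ρ) • (z - x), ?_, hd.mono_left fun y hy => ?_⟩
  · rw [dist_eq_norm, add_sub_cancel_left, norm_smul, hz, Real.norm_of_nonneg (by positivity)]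
    field_simp
  · rw [Metric.mem_ball] at hy
    rw [Metric.mem_closedBall]
    have h1 : dist (x + (r / ρ) • (z - x)) z = ρ - r := by
      have : x + (r / ρ) • (z - x) - z = (r / ρ - 1) • (z - x) := by
        rw [sub_smul, one_smul]; abel
      rw [dist_eq_norm, this, norm_smul, hz, Real.norm_of_nonpos
        (by rw [sub_nonpos, div_le_one hρ]; exact hrρ)]
      field_simp
      ring
    linarith [dist_triangle y (x + (r / ρ) • (z - x)) z]

lemma compl_nonempty_of_isBounded (hn : 1 ≤ n) (hb : Bornology.IsBounded Ω) : (Ωᶜ).Nonempty := by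
  have := nontrivial_euclideanSpace hn
  rw [Set.nonempty_compl]
  rintro rfl
  exact NormedSpace.unbounded_univ ℝ _ hb

lemma infDist_compl_pos (hn : 1 ≤ n) (ho : IsOpen Ω) (hb : Bornology.IsBounded Ω)
    {x : EuclideanSpace ℝ (Fin n)} (hx : x ∈ Ω) : 0 < Metric.infDist x Ωᶜ :=
  (ho.isClosed_compl.notMem_iff_infDist_pos (compl_nonempty_of_isBounded hn hb)).1
    (fun h => h hx)

lemma exists_frontier_dist_eq (hn : 1 ≤ n) (ho : IsOpen Ω) (hb : Bornology.IsBounded Ω)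
    {x : EuclideanSpace ℝ (Fin n)} (hx : x ∈ Ω) :
    ∃ y ∈ frontier Ω, dist x y = Metric.infDist x Ωᶜ := by
  obtain ⟨y, hy, hd⟩ := ho.isClosed_compl.exists_infDist_eq_dist
    (compl_nonempty_of_isBounded hn hb) x
  have hpos := infDist_compl_pos hn ho hb hx
  refine ⟨y, ⟨?_, fun h => hy (interior_subset h)⟩, hd.symm⟩
  have h1 : Metric.ball x (Metric.infDist x Ωᶜ) ⊆ Ω := by
    have := Metric.disjoint_ball_infDist (x := x) (s := Ωᶜ)
    exact Set.disjoint_compl_right_iff_subset.1 this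
  refine closure_mono h1 ?_
  rw [closure_ball _ hpos.ne', Metric.mem_closedBall, dist_comm, hd]

lemma exists_diam_bound (hb : Bornology.IsBounded Ω) :
    ∃ D : ℝ, 0 < D ∧ ∀ x ∈ Ω, ∀ y ∈ Ω, ‖x - y‖ ≤ D := by
  obtain ⟨C, hC⟩ := Metric.isBounded_iff.1 hb
  refine ⟨max C 1, by positivity, fun x hx y hy => ?_⟩
  rw [← dist_eq_norm]
  exact (hC hx hy).trans (le_max_left _ _)

lemma volume_ball_eq (c : EuclideanSpace ℝ (Fin n)) {r : ℝ} (hr : 0 < r) :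
    volume (Metric.ball c r) =
      ENNReal.ofReal (r ^ n * volume.real (Metric.ball (0 : EuclideanSpace ℝ (Fin n)) 1)) := by
  rw [Measure.addHaar_ball_of_pos _ _ hr, ENNReal.ofReal_mul (by positivity)]
  simp [Measure.real, ENNReal.ofReal_toReal measure_ball_lt_top.ne]

/-- Mass of the kernel outside a bounded domain with the exterior sphere condition. -/
lemma exists_exterior_mass (hn : 1 ≤ n) {s p : ℝ} (hps : 0 < p * s) (ho : IsOpen Ω)
    (hb : Bornology.IsBounded Ω) (hs : ExteriorTangentSphere Ω) :
    ∃ c : ℝ, 0 < c ∧ ∀ x ∈ Ω, ENNReal.ofReal (c * Metric.infDist x Ωᶜ ^ (-(p * s))) ≤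
      ∫⁻ y in Ωᶜ, ENNReal.ofReal (1 / ‖x - y‖ ^ ((n : ℝ) + s * p)) := by
  obtain ⟨ρ, hρ, hball⟩ := hs.exists_ball
  have hne := compl_nonempty_of_isBounded hn hb
  obtain ⟨z, hz⟩ := hne
  obtain ⟨D, hD⟩ := (hb.subset_closedBall z)
  set D' := max D 1
  have hD' : 0 < D' := by positivity
  -- `D'` bounds the distance `d` to the complement, so the radius `τ * d` is at most both `ρ` and
  -- `d`. An exterior ball of that radius at a nearest boundary point lies within `3 * d` of `x`.
  set τ := min 1 (ρ / D') with hτ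
  have hτ0 : 0 < τ := by positivity
  set ω := volume.real (Metric.ball (0 : EuclideanSpace ℝ (Fin n)) 1)
  have hω : 0 < ω := volume_unit_ball_pos
  refine ⟨τ ^ n * ω * (3 : ℝ) ^ (-((n : ℝ) + s * p)), by positivity, fun x hx => ?_⟩
  obtain ⟨y₀, hy₀, hd⟩ := exists_frontier_dist_eq hn ho hb hx
  have hpos := infDist_compl_pos hn ho hb hx
  set d := Metric.infDist x Ωᶜ
  have hdD : d ≤ D' := by
    have h1 : d ≤ dist x z := Metric.infDist_le_dist_of_mem hz
    have h2 : dist x z ≤ D := hD hx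
    exact h1.trans (h2.trans (le_max_left _ _))
  have hr : 0 < τ * d := by positivity
  have hrρ : τ * d ≤ ρ := by
    calc τ * d ≤ ρ / D' * D' := by gcongr; exact min_le_right _ _
      _ = ρ := by field_simp
  have hrd : τ * d ≤ d := by
    have : τ ≤ 1 := min_le_left _ _
    nlinarith
  obtain ⟨c, hc, hdis⟩ := hball y₀ hy₀ _ hr hrρ
  have hsub : Metric.ball c (τ * d) ⊆ Ωᶜ := Set.subset_compl_iff_disjoint_right.2 hdis
  have hbound : ∀ y ∈ Metric.ball c (τ * d),
      ENNReal.ofReal ((3 * d) ^ (-((n : ℝ) + s * p))) ≤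
        ENNReal.ofReal (1 / ‖x - y‖ ^ ((n : ℝ) + s * p)) := by
    intro y hy
    refine ENNReal.ofReal_le_ofReal ?_
    have h1 : ‖x - y‖ ≤ 3 * d := by
      rw [← dist_eq_norm]
      have := dist_triangle4 x y₀ c y
      rw [Metric.mem_ball, dist_comm] at hy
      rw [dist_comm c] at hc
      linarith
    have h2 : 0 < ‖x - y‖ := by
      rw [norm_pos_iff, sub_ne_zero]
      rintro rfl
      exact hsub hy hx
    rw [Real.rpow_neg (by positivity), one_div]
    have : 0 ≤ (n : ℝ) + s * p := by rw [mul_comm]; positivity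
    gcongr
  calc ENNReal.ofReal (τ ^ n * ω * 3 ^ (-((n : ℝ) + s * p)) * d ^ (-(p * s)))
      = ENNReal.ofReal ((3 * d) ^ (-((n : ℝ) + s * p))) * volume (Metric.ball c (τ * d)) := by
        rw [volume_ball_eq _ hr, ← ENNReal.ofReal_mul (by positivity)]
        congr 1
        rw [Real.mul_rpow (by norm_num) hpos.le, mul_pow, neg_add, Real.rpow_add hpos,
          Real.rpow_neg hpos.le n, Real.rpow_natCast, mul_comm s p]
        field_simp
        rfl
    _ ≤ ∫⁻ y in Metric.ball c (τ * d), ENNReal.ofReal (1 / ‖x - y‖ ^ ((n : ℝ) + s * p)) := by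
        rw [← setLIntegral_const]
        exact setLIntegral_mono' Metric.isOpen_ball.measurableSet hbound
    _ ≤ _ := lintegral_mono_set hsub

end Geometry

/-! ### The kernel of a bounded Lipschitz increment -/

section TruncatedKernel

variable {n : ℕ}

/-- The Lipschitz kernel `min(1, |h|/R)^p / |h|^(n+sp)`. -/
noncomputable def lipKernel (s p R : ℝ) (h : EuclideanSpace ℝ (Fin n)) : ℝ :=
  (min 1 (‖h‖ / R)) ^ p / ‖h‖ ^ ((n : ℝ) + s * p)

lemma lipKernel_nonneg {s p R : ℝ} (hR : 0 ≤ R) (h : EuclideanSpace ℝ (Fin n)) :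
    0 ≤ lipKernel s p R h := by
  unfold lipKernel
  have : 0 ≤ min 1 (‖h‖ / R) := le_min zero_le_one (by positivity)
  positivity

lemma measurable_lipKernel (s p R : ℝ) :
    Measurable (lipKernel s p R : EuclideanSpace ℝ (Fin n) → ℝ) :=
  ((measurable_const.min (measurable_norm.div_const R)).pow_const _).div
    (measurable_norm.pow_const _)

/-- The kernel is integrable at the origin since `p - p * s > 0` and at infinity since `p * s > 0`.
Scaling gives the power of `R`; with `R` comparable to the boundary distance this is the Hardy
weight. -/
lemma lintegral_lipKernel_le (hn : 1 ≤ n) {s p R : ℝ} (hp : 0 < p) (hs0 : 0 < s) (hs1 : s < 1)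
    (hR : 0 < R) (x : EuclideanSpace ℝ (Fin n)) :
    ∫⁻ y, ENNReal.ofReal (lipKernel s p R (x - y)) ≤
      ENNReal.ofReal (sphereMass n * (1 / (p - p * s) + 1 / (p * s)) * R ^ (-(p * s))) := by
  have hps : 0 < p * s := by positivity
  have hps1 : 0 < p - p * s := by nlinarith
  rw [lintegral_sub_left_eq_self (fun h => ENNReal.ofReal (lipKernel s p R h)) x,
    ← lintegral_add_compl _ (Metric.isOpen_ball (x := (0 : EuclideanSpace ℝ (Fin n))) (ε := R)).measurableSet]
  have hb := radial_ball hn hps1 hR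
  have hc := radial_compl_ball hn hps hR
  have h1 : ∫⁻ h in Metric.ball (0 : EuclideanSpace ℝ (Fin n)) R, ENNReal.ofReal (lipKernel s p R h) ≤
      ENNReal.ofReal (R ^ (-p) * (sphereMass n * (R ^ (p - p * s) / (p - p * s)))) := by
    rw [← hb.2, ← integral_const_mul, ofReal_integral_eq_lintegral_ofReal (hb.1.const_mul _)
      (ae_of_all _ fun h => by positivity)]
    refine setLIntegral_mono' Metric.isOpen_ball.measurableSet fun h hh =>
      ENNReal.ofReal_le_ofReal ?_
    rcases (norm_nonneg h).eq_or_lt with h0 | h0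
    · unfold lipKernel
      rw [← h0]
      simp only [zero_div, min_eq_right zero_le_one, Real.zero_rpow hp.ne']
      positivity
    have hle : ‖h‖ / R ≤ 1 := by
      rw [div_le_one hR]; simpa using (mem_ball_zero_iff.1 hh).le
    unfold lipKernel
    rw [min_eq_right hle, Real.div_rpow h0.le hR.le, Real.rpow_neg hR.le,
      show p - p * s - n = p - (n + s * p) by ring, Real.rpow_sub h0]
    apply le_of_eq
    field_simp
  have h2 : ∫⁻ h in (Metric.ball (0 : EuclideanSpace ℝ (Fin n)) R)ᶜ, ENNReal.ofReal (lipKernel s p R h) ≤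
      ENNReal.ofReal (sphereMass n * (R ^ (-(p * s)) / (p * s))) := by
    rw [← hc.2, ofReal_integral_eq_lintegral_ofReal hc.1
      (ae_of_all _ fun h => by positivity)]
    refine setLIntegral_mono' Metric.isOpen_ball.measurableSet.compl fun h hh =>
      ENNReal.ofReal_le_ofReal ?_
    have hh' : R ≤ ‖h‖ := by simpa using hh
    have h0 : 0 < ‖h‖ := hR.trans_le hh'
    unfold lipKernel
    rw [min_eq_left (by rwa [one_le_div hR]), Real.one_rpow,
      show -(p * s) - (n : ℝ) = -(n + s * p) by ring, Real.rpow_neg h0.le, one_div]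
  refine (add_le_add h1 h2).trans ?_
  have hm := sphereMass_pos hn
  rw [← ENNReal.ofReal_add (by positivity) (by positivity)]
  refine ENNReal.ofReal_le_ofReal (le_of_eq ?_)
  rw [Real.rpow_sub hR, Real.rpow_neg hR.le, Real.rpow_neg hR.le]
  field_simp

lemma integrable_prod_of_lintegral {F : EuclideanSpace ℝ (Fin n) × EuclideanSpace ℝ (Fin n) → ℝ}
    (hF : Measurable F) (h0 : ∀ z, 0 ≤ F z)
    (h : ∫⁻ x, ∫⁻ y, ENNReal.ofReal (F (x, y)) < ⊤) :
    Integrable F (volume.prod volume) := by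
  refine ⟨hF.aestronglyMeasurable, ?_⟩
  rw [hasFiniteIntegral_iff_ofReal (ae_of_all _ h0),
    lintegral_prod _ hF.ennreal_ofReal.aemeasurable]
  exact h

end TruncatedKernel

/-! ### Fractional Hardy inequality and cut-off functions -/

section Hardy

variable {n : ℕ} {Ω : Set (EuclideanSpace ℝ (Fin n))}

/-- Fractional Hardy inequality in a domain with the exterior sphere condition. -/
lemma lintegral_hardy_lt_top (hn : 1 ≤ n) {s p : ℝ} (hp : 0 < p) (hs0 : 0 < s) (ho : IsOpen Ω)
    (hb : Bornology.IsBounded Ω) (hs : ExteriorTangentSphere Ω)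
    {w : EuclideanSpace ℝ (Fin n) → ℝ} (hw0 : ∀ x, 0 ≤ w x) (hwΩ : ∀ x, x ∉ Ω → w x = 0)
    (hw : FiniteGagliardo s p w) :
    ∫⁻ x, ENNReal.ofReal (w x ^ p * Metric.infDist x Ωᶜ ^ (-(p * s))) < ⊤ := by
  obtain ⟨c, hc, hmass⟩ := exists_exterior_mass hn (s := s) (p := p) (by positivity) ho hb hs
  -- For `x ∈ Ω` it suffices to keep the points `y ∉ Ω` of the inner Gagliardo integral: there `w y
  -- = 0`, and the exterior mass provides the weight.
  have key : ∀ x, ENNReal.ofReal c *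
      ENNReal.ofReal (w x ^ p * Metric.infDist x Ωᶜ ^ (-(p * s))) ≤
      ∫⁻ y, ENNReal.ofReal (|w x - w y| ^ p / ‖x - y‖ ^ ((n : ℝ) + s * p)) := by
    intro x
    by_cases hx : x ∈ Ω
    · have h0 := Real.rpow_nonneg (hw0 x) p
      rw [← ENNReal.ofReal_mul hc.le,
        show c * (w x ^ p * Metric.infDist x Ωᶜ ^ (-(p * s))) =
          w x ^ p * (c * Metric.infDist x Ωᶜ ^ (-(p * s))) by ring, ENNReal.ofReal_mul h0]
      refine (mul_le_mul_right (hmass x hx) _).trans ?_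
      rw [← lintegral_const_mul' _ _ ENNReal.ofReal_ne_top]
      refine le_trans ?_ (setLIntegral_le_lintegral Ωᶜ _)
      refine le_of_eq (setLIntegral_congr_fun ho.measurableSet.compl fun y hy => ?_)
      rw [hwΩ y hy, sub_zero, abs_of_nonneg (hw0 x), ← ENNReal.ofReal_mul h0, mul_one_div]
    · rw [hwΩ x hx, Real.zero_rpow hp.ne', zero_mul, ENNReal.ofReal_zero, mul_zero]
      exact zero_le
  have h1 := (lintegral_mono key).trans_lt hw
  rw [lintegral_const_mul' _ _ ENNReal.ofReal_ne_top] at h1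
  by_contra h2
  rw [not_lt, top_le_iff] at h2
  rw [h2, ENNReal.mul_top (by simpa using hc)] at h1
  exact lt_irrefl _ h1

/-- Lipschitz cut-off functions exhausting `Ω`. -/
noncomputable def cutoff (Ω : Set (EuclideanSpace ℝ (Fin n))) (j : ℕ)
    (x : EuclideanSpace ℝ (Fin n)) : ℝ :=
  max 0 (min 1 (j * Metric.infDist x Ωᶜ - 1))

lemma cutoff_nonneg (j : ℕ) (x : EuclideanSpace ℝ (Fin n)) : 0 ≤ cutoff Ω j x := le_max_left _ _

lemma cutoff_le_one (j : ℕ) (x : EuclideanSpace ℝ (Fin n)) : cutoff Ω j x ≤ 1 :=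
  max_le zero_le_one (min_le_left _ _)

lemma continuous_cutoff (j : ℕ) : Continuous (cutoff Ω j) := by
  have := Metric.continuous_infDist_pt Ωᶜ
  unfold cutoff
  fun_prop

lemma cutoff_mono {i j : ℕ} (hij : i ≤ j) (x : EuclideanSpace ℝ (Fin n)) :
    cutoff Ω i x ≤ cutoff Ω j x := by
  have h : (i : ℝ) ≤ j := by exact_mod_cast hij
  have := Metric.infDist_nonneg (x := x) (s := Ωᶜ)
  unfold cutoff
  gcongr

lemma eventually_cutoff_eq_one {x : EuclideanSpace ℝ (Fin n)} (hx : 0 < Metric.infDist x Ωᶜ) :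
    ∀ᶠ j in atTop, cutoff Ω j x = 1 := by
  have h1 : Tendsto (fun j : ℕ => (j : ℝ) * Metric.infDist x Ωᶜ) atTop atTop :=
    tendsto_natCast_atTop_atTop.atTop_mul_const hx
  filter_upwards [h1.eventually_ge_atTop 2] with j hj
  unfold cutoff
  rw [min_eq_left (by linarith), max_eq_right zero_le_one]

/-- The slope of the cut-off is `j`, but it varies only where the boundary distance is between `1 /
j` and `2 / j`. Hence the increment from `x` is controlled by the boundary distance of `x`,
uniformly in `j`. -/
lemma abs_cutoff_sub_le (j : ℕ) {x : EuclideanSpace ℝ (Fin n)} (hx : 0 < Metric.infDist x Ωᶜ)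
    (y : EuclideanSpace ℝ (Fin n)) :
    |cutoff Ω j x - cutoff Ω j y| ≤ min 1 (‖x - y‖ / (Metric.infDist x Ωᶜ / 4)) := by
  have hx0 := cutoff_nonneg (Ω := Ω) j x
  have hx1 := cutoff_le_one (Ω := Ω) j x
  have hy0 := cutoff_nonneg (Ω := Ω) j y
  have hy1 := cutoff_le_one (Ω := Ω) j y
  refine le_min (abs_le.2 ⟨by linarith, by linarith⟩) ?_
  rw [le_div_iff₀ (by positivity)]
  set a := Metric.infDist x Ωᶜ
  set b := Metric.infDist y Ωᶜ with hb
  have hb0 : 0 ≤ b := Metric.infDist_nonneg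
  have hab : |a - b| ≤ ‖x - y‖ := by
    have h1 := Metric.infDist_le_infDist_add_dist (s := Ωᶜ) (x := x) (y := y)
    have h2 := Metric.infDist_le_infDist_add_dist (s := Ωᶜ) (x := y) (y := x)
    rw [dist_comm] at h2
    rw [← dist_eq_norm]
    exact abs_le.2 ⟨by linarith, by linarith⟩
  have hj : (0 : ℝ) ≤ j := Nat.cast_nonneg j
  rcases le_total ((j : ℝ) * a) 4 with h4 | h4
  · have hlip : |cutoff Ω j x - cutoff Ω j y| ≤ j * |a - b| := by
      unfold cutoff
      refine (abs_max_sub_max_le_max 0 _ 0 _).trans ?_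
      rw [sub_self, abs_zero, max_eq_right (abs_nonneg _)]
      refine (abs_min_sub_min_le_max 1 _ 1 _).trans ?_
      rw [sub_self, abs_zero, max_eq_right (abs_nonneg _)]
      rw [show (j : ℝ) * a - 1 - (j * b - 1) = j * (a - b) by ring, abs_mul, abs_of_nonneg hj]
    calc |cutoff Ω j x - cutoff Ω j y| * (a / 4) ≤ j * |a - b| * (a / 4) := by gcongr
      _ = (j * a / 4) * |a - b| := by ring
      _ ≤ 1 * |a - b| := by gcongr; linarith
      _ ≤ ‖x - y‖ := by rw [one_mul]; exact hab
  · rcases le_total 2 ((j : ℝ) * b) with h2 | h2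
    · have e1 : cutoff Ω j x = 1 := by
        unfold cutoff; rw [min_eq_left (by linarith), max_eq_right zero_le_one]
      have e2 : cutoff Ω j y = 1 := by
        unfold cutoff; rw [min_eq_left (by linarith), max_eq_right zero_le_one]
      simp [e1, e2]
    · have hjpos : 0 < (j : ℝ) := by
        rcases hj.eq_or_lt with h | h
        · rw [← h] at h4; linarith
        · exact h
      -- Here the cut-off is one at `x` but possibly not at `y`, so `y` is at most half as far from
      -- the boundary and `‖x - y‖` is at least `a / 2`.
      have h3 : 2 * b ≤ a := by
        have : (j : ℝ) * (2 * b) ≤ j * a := by linarith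
        exact le_of_mul_le_mul_left this hjpos
      have h5 : |cutoff Ω j x - cutoff Ω j y| ≤ 1 := abs_le.2 ⟨by linarith, by linarith⟩
      have h6 := (le_abs_self _).trans hab
      nlinarith

lemma isCompact_le_infDist (hb : Bornology.IsBounded Ω) {c : ℝ} (hc : 0 < c) :
    IsCompact {x | c ≤ Metric.infDist x Ωᶜ} ∧ {x | c ≤ Metric.infDist x Ωᶜ} ⊆ Ω := by
  have hsub : {x | c ≤ Metric.infDist x Ωᶜ} ⊆ Ω := by
    intro x hx
    by_contra h
    have h0 : Metric.infDist x Ωᶜ = 0 := Metric.infDist_zero_of_mem h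
    have h1 : c ≤ Metric.infDist x Ωᶜ := hx
    linarith
  exact ⟨Metric.isCompact_of_isClosed_isBounded
    (isClosed_le continuous_const (Metric.continuous_infDist_pt _)) (hb.subset hsub), hsub⟩

end Hardy

/-! ### Weak comparison by testing with cut-off truncations -/

section Energy

variable {n : ℕ} {Ω : Set (EuclideanSpace ℝ (Fin n))}

/-- Difference of the nonlinear increments of `u` and `v`. -/
noncomputable def incrementGap (p : ℝ) (u v : EuclideanSpace ℝ (Fin n) → ℝ)
    (z : EuclideanSpace ℝ (Fin n) × EuclideanSpace ℝ (Fin n)) : ℝ :=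
  signedPow p (u z.1 - u z.2) - signedPow p (v z.1 - v z.2)

lemma incrementGap_swap (p : ℝ) (u v : EuclideanSpace ℝ (Fin n) → ℝ)
    (z : EuclideanSpace ℝ (Fin n) × EuclideanSpace ℝ (Fin n)) :
    incrementGap p u v z.swap = -incrementGap p u v z := by
  simp only [incrementGap, Prod.fst_swap, Prod.snd_swap]
  rw [← neg_sub (u z.1), ← neg_sub (v z.1), signedPow_neg, signedPow_neg]
  ring

lemma measurable_incrementGap {p : ℝ} (hp : 2 < p) {u v : EuclideanSpace ℝ (Fin n) → ℝ}
    (hu : Measurable u) (hv : Measurable v) : Measurable (incrementGap p u v) := by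
  have hc := (continuous_signedPow hp).measurable
  exact (hc.comp ((hu.comp measurable_fst).sub (hu.comp measurable_snd))).sub
    (hc.comp ((hv.comp measurable_fst).sub (hv.comp measurable_snd)))

/-- The error produced by the cut-off `η` when the gap between `u` and `v = u - w` is tested with
`w η`. -/
noncomputable def cutoffError (s p : ℝ) (u w η : EuclideanSpace ℝ (Fin n) → ℝ)
    (z : EuclideanSpace ℝ (Fin n) × EuclideanSpace ℝ (Fin n)) : ℝ :=
  {z : EuclideanSpace ℝ (Fin n) × EuclideanSpace ℝ (Fin n) | 0 < w z.1 ∧ 0 < w z.2}.indicator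
    (fun z => |incrementGap p u (fun y => u y - w y) z| * (w z.1 * |η z.1 - η z.2|) /
      ‖z.1 - z.2‖ ^ ((n : ℝ) + p * s)) z

lemma cutoffError_nonneg {s p : ℝ} {u w η : EuclideanSpace ℝ (Fin n) → ℝ} (z) :
    0 ≤ cutoffError s p u w η z := by
  refine Set.indicator_nonneg (fun z hz => ?_) z
  have : 0 < w z.1 := hz.1
  positivity

/-- Since `w` is the difference of the two functions, monotonicity of the odd power gives the gap
the sign of `w z.1 - w z.2`. The integrand would be nonnegative without the cut-off; the variation
of `η` costs something only where `w` is positive at both points. -/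
lemma neg_cutoffError_le {s p : ℝ} (hp : 2 < p) {u w η : EuclideanSpace ℝ (Fin n) → ℝ}
    (hw : ∀ x, 0 ≤ w x) (hη : ∀ x, 0 ≤ η x) (z) :
    -cutoffError s p u w η z ≤ (w z.1 * η z.1 - w z.2 * η z.2) *
      incrementGap p u (fun y => u y - w y) z / ‖z.1 - z.2‖ ^ ((n : ℝ) + p * s) := by
  set H := incrementGap p u (fun y => u y - w y) z with hH
  have hmono := signedPow_mono (p := p) (by linarith)
  have hpos : w z.2 ≤ w z.1 → 0 ≤ H := fun h => by
    rw [hH]; unfold incrementGap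
    exact sub_nonneg.2 (hmono (by linarith))
  have hneg : w z.1 ≤ w z.2 → H ≤ 0 := fun h => by
    rw [hH]; unfold incrementGap
    exact sub_nonpos.2 (hmono (by linarith))
  have hk : 0 ≤ ‖z.1 - z.2‖ ^ ((n : ℝ) + p * s) := by positivity
  by_cases hz : 0 < w z.1 ∧ 0 < w z.2
  · have e : cutoffError s p u w η z =
        |H| * (w z.1 * |η z.1 - η z.2|) / ‖z.1 - z.2‖ ^ ((n : ℝ) + p * s) :=
      Set.indicator_of_mem (by exact hz) _
    rw [e, ← neg_div]
    refine div_le_div_of_nonneg_right ?_ hk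
    rcases le_total (w z.2) (w z.1) with h | h
    · have h1 := hpos h
      rw [abs_of_nonneg h1, neg_le_iff_add_nonneg]
      have h2 : 0 ≤ w z.1 * |η z.1 - η z.2| + (w z.1 * η z.1 - w z.2 * η z.2) := by
        rcases le_total (η z.2) (η z.1) with h3 | h3
        · have := mul_le_mul h h3 (hη _) (hw _)
          have := mul_nonneg (hw z.1) (abs_nonneg (η z.1 - η z.2))
          linarith
        · rw [abs_of_nonpos (by linarith)]
          have := mul_le_mul_of_nonneg_right h (hη z.2)
          linarith
      have := mul_nonneg h1 h2
      linarith
    · have h1 := hneg h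
      rw [abs_of_nonpos h1, neg_le_iff_add_nonneg]
      have h2 : 0 ≤ w z.1 * |η z.1 - η z.2| - (w z.1 * η z.1 - w z.2 * η z.2) := by
        have h4 := mul_le_mul_of_nonneg_right h (hη z.2)
        have h5 := mul_le_mul_of_nonneg_left (le_abs_self (η z.1 - η z.2)) (hw z.1)
        linarith
      have := mul_nonneg (neg_nonneg.2 h1) h2
      linarith
  · have e : cutoffError s p u w η z = 0 := Set.indicator_of_notMem (by exact hz) _
    rw [e, neg_zero]
    refine div_nonneg ?_ hk
    have h0 : w z.1 = 0 ∨ w z.2 = 0 := by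
      by_contra! h
      exact hz ⟨(hw _).lt_of_ne' h.1, (hw _).lt_of_ne' h.2⟩
    rcases h0 with h0 | h0
    · have h1 := hneg (h0 ▸ hw _)
      have h2 := mul_nonneg (hw z.2) (hη z.2)
      rw [h0]
      nlinarith
    · have h1 := hpos (h0 ▸ hw _)
      have h2 := mul_nonneg (hw z.1) (hη z.1)
      rw [h0]
      nlinarith

/-- The uniform majorant of the cut-off errors. -/
noncomputable def cutoffMajorant (s p D L : ℝ) (Ω : Set (EuclideanSpace ℝ (Fin n)))
    (w : EuclideanSpace ℝ (Fin n) → ℝ)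
    (z : EuclideanSpace ℝ (Fin n) × EuclideanSpace ℝ (Fin n)) : ℝ :=
  2 * (2 ^ p * (|w z.1 - w z.2| ^ p / ‖z.1 - z.2‖ ^ ((n : ℝ) + s * p) +
    (L * D) ^ p * Ω.indicator (fun _ => 1) z.1 * lipKernel s p D (z.1 - z.2)) +
    w z.1 ^ p * lipKernel s p (Metric.infDist z.1 Ωᶜ / 4) (z.1 - z.2))

lemma FiniteGagliardo.integrable {s p : ℝ} {w : EuclideanSpace ℝ (Fin n) → ℝ}
    (hwm : Measurable w) (hw : FiniteGagliardo s p w) :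
    Integrable (fun z : EuclideanSpace ℝ (Fin n) × EuclideanSpace ℝ (Fin n) =>
      |w z.1 - w z.2| ^ p / ‖z.1 - z.2‖ ^ ((n : ℝ) + s * p)) (volume.prod volume) := by
  refine integrable_prod_of_lintegral ?_ (fun z => by positivity) hw
  exact (((hwm.comp measurable_fst).sub (hwm.comp measurable_snd)).abs.pow_const _).div
    ((measurable_fst.sub measurable_snd).norm.pow_const _)

lemma integrable_indicator_mul_lipKernel (hn : 1 ≤ n) {s p D : ℝ} (hp : 0 < p) (hs0 : 0 < s)
    (hs1 : s < 1) (ho : IsOpen Ω) (hb : Bornology.IsBounded Ω) (hD : 0 < D) :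
    Integrable (fun z : EuclideanSpace ℝ (Fin n) × EuclideanSpace ℝ (Fin n) =>
      Ω.indicator (fun _ => (1 : ℝ)) z.1 * lipKernel s p D (z.1 - z.2)) (volume.prod volume) := by
  refine integrable_prod_of_lintegral ?_ (fun z => ?_) ?_
  · exact ((measurable_const.indicator ho.measurableSet).comp measurable_fst).mul
      ((measurable_lipKernel s p D).comp (measurable_fst.sub measurable_snd))
  · exact mul_nonneg (Set.indicator_nonneg (fun _ _ => zero_le_one) _)
      (lipKernel_nonneg hD.le _)
  · have : ∀ x, ∫⁻ y, ENNReal.ofReal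
        (Ω.indicator (fun _ => (1 : ℝ)) x * lipKernel s p D (x - y)) ≤ Ω.indicator (fun _ =>
        ENNReal.ofReal (sphereMass n * (1 / (p - p * s) + 1 / (p * s)) * D ^ (-(p * s)))) x := by
      intro x
      by_cases hx : x ∈ Ω
      · simp only [Set.indicator_of_mem hx, one_mul]
        exact lintegral_lipKernel_le hn hp hs0 hs1 hD x
      · simp [Set.indicator_of_notMem hx]
    refine (lintegral_mono this).trans_lt ?_
    rw [lintegral_indicator ho.measurableSet, setLIntegral_const]
    exact ENNReal.mul_lt_top ENNReal.ofReal_lt_top hb.measure_lt_top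

/-- Finiteness of the Gagliardo seminorm is stable under bounded Lipschitz perturbations supported
in a bounded set. -/
lemma FiniteGagliardo.of_le (hn : 1 ≤ n) {s p c R : ℝ} (hp : 0 < p) (hs0 : 0 < s)
    (hs1 : s < 1) (ho : IsOpen Ω) (hb : Bornology.IsBounded Ω) (hR : 0 < R) (hc : 0 ≤ c)
    {g w : EuclideanSpace ℝ (Fin n) → ℝ} (hgm : Measurable g) (hwm : Measurable w)
    (hg : FiniteGagliardo s p g)
    (h : ∀ x y, |w x - w y| ≤ |g x - g y| + c * min 1 (‖x - y‖ / R) *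
      (Ω.indicator (fun _ => 1) x + Ω.indicator (fun _ => 1) y)) : FiniteGagliardo s p w := by
  have i1 := hg.integrable hgm
  have i2 := integrable_indicator_mul_lipKernel hn hp hs0 hs1 ho hb hR
  have i3 := (i1.add ((i2.add i2.swap).const_mul (c ^ p * 2 ^ p))).const_mul ((2 : ℝ) ^ p)
  have hm : Measurable fun z : EuclideanSpace ℝ (Fin n) × EuclideanSpace ℝ (Fin n) =>
      |w z.1 - w z.2| ^ p / ‖z.1 - z.2‖ ^ ((n : ℝ) + s * p) :=
    (((hwm.comp measurable_fst).sub (hwm.comp measurable_snd)).abs.pow_const _).div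
      ((measurable_fst.sub measurable_snd).norm.pow_const _)
  have hi := i3.mono' hm.aestronglyMeasurable (ae_of_all _ fun z => ?_)
  · have := hi.2
    rw [hasFiniteIntegral_iff_ofReal (ae_of_all _ fun z => by positivity),
      lintegral_prod _ hm.ennreal_ofReal.aemeasurable] at this
    exact this
  · rw [Real.norm_of_nonneg (by positivity)]
    have ind : ∀ x, 0 ≤ Ω.indicator (fun _ => (1 : ℝ)) x := fun x =>
      Set.indicator_nonneg (fun _ _ => zero_le_one) _
    -- Indicators equal their own `p`-th powers, so the perturbation stays linear in them.
    have indp : ∀ x, Ω.indicator (fun _ => (1 : ℝ)) x ^ p = Ω.indicator (fun _ => (1 : ℝ)) x := by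
      intro x
      by_cases hx : x ∈ Ω <;> simp [hx, Real.zero_rpow hp.ne']
    have hm0 : 0 ≤ min 1 (‖z.1 - z.2‖ / R) := le_min zero_le_one (by positivity)
    have h1 := ind z.1
    have h2 := ind z.2
    have num : |w z.1 - w z.2| ^ p ≤ 2 ^ p * (|g z.1 - g z.2| ^ p + c ^ p * 2 ^ p *
        (min 1 (‖z.1 - z.2‖ / R) ^ p * (Ω.indicator (fun _ => (1 : ℝ)) z.1 +
          Ω.indicator (fun _ => (1 : ℝ)) z.2))) := by
      refine (Real.rpow_le_rpow (abs_nonneg _) (h z.1 z.2) hp.le).trans ?_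
      refine (add_rpow_le_two_rpow hp.le (abs_nonneg _) (by positivity)).trans ?_
      gcongr
      rw [Real.mul_rpow (by positivity) (by positivity), Real.mul_rpow hc hm0]
      have := add_rpow_le_two_rpow hp.le h1 h2
      rw [indp, indp] at this
      calc _ ≤ c ^ p * min 1 (‖z.1 - z.2‖ / R) ^ p * (2 ^ p * (Ω.indicator (fun _ => (1 : ℝ)) z.1 +
          Ω.indicator (fun _ => (1 : ℝ)) z.2)) := by gcongr
        _ = _ := by ring
    refine (div_le_div_of_nonneg_right num (by positivity)).trans (le_of_eq ?_)
    simp only [Pi.add_apply, Function.comp_apply, Prod.fst_swap, Prod.snd_swap, lipKernel]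
    rw [norm_sub_rev z.2]
    ring

/-- The three terms are finite for different reasons: the first by the seminorm of `w`, the second
by boundedness of `Ω`, the third because its inner integral is a multiple of the Hardy weight. -/
lemma integrable_cutoffMajorant (hn : 1 ≤ n) {s p D L : ℝ} (hp : 2 < p) (hs0 : 0 < s) (hs1 : s < 1)
    (ho : IsOpen Ω) (hb : Bornology.IsBounded Ω) (hs : ExteriorTangentSphere Ω) (hD : 0 < D)
    {w : EuclideanSpace ℝ (Fin n) → ℝ} (hwm : Measurable w) (hw0 : ∀ x, 0 ≤ w x)
    (hwΩ : ∀ x, x ∉ Ω → w x = 0) (hw : FiniteGagliardo s p w) :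
    Integrable (cutoffMajorant s p D L Ω w) (volume.prod volume) := by
  have hp0 : 0 < p := by linarith
  have hsub : Measurable fun z : EuclideanSpace ℝ (Fin n) × EuclideanSpace ℝ (Fin n) =>
    z.1 - z.2 := measurable_fst.sub measurable_snd
  have i1 := hw.integrable hwm
  have i2 := integrable_indicator_mul_lipKernel hn hp0 hs0 hs1 ho hb hD
  have i3 : Integrable (fun z : EuclideanSpace ℝ (Fin n) × EuclideanSpace ℝ (Fin n) =>
      w z.1 ^ p * lipKernel s p (Metric.infDist z.1 Ωᶜ / 4) (z.1 - z.2)) (volume.prod volume) := by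
    refine integrable_prod_of_lintegral ?_ (fun z => ?_) ?_
    · refine ((hwm.comp measurable_fst).pow_const _).mul (Measurable.div ?_ (hsub.norm.pow_const _))
      refine (measurable_const.min (hsub.norm.div ?_)).pow_const _
      exact ((Metric.continuous_infDist_pt Ωᶜ).measurable.comp measurable_fst).div_const _
    · exact mul_nonneg (Real.rpow_nonneg (hw0 _) _)
        (lipKernel_nonneg (by have := Metric.infDist_nonneg (x := z.1) (s := Ωᶜ); positivity) _)
    · set C := sphereMass n * (1 / (p - p * s) + 1 / (p * s))
      have hps1 : 0 < p - p * s := by nlinarith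
      have hC : 0 ≤ C := by
        have := sphereMass_pos hn
        positivity
      have : ∀ x, ∫⁻ y, ENNReal.ofReal
          (w x ^ p * lipKernel s p (Metric.infDist x Ωᶜ / 4) (x - y)) ≤
          ENNReal.ofReal (C * (1 / 4 : ℝ) ^ (-(p * s))) *
          ENNReal.ofReal (w x ^ p * Metric.infDist x Ωᶜ ^ (-(p * s))) := by
        intro x
        have h0 := Real.rpow_nonneg (hw0 x) p
        by_cases hx : x ∈ Ω
        · have hd := infDist_compl_pos hn ho hb hx
          simp_rw [ENNReal.ofReal_mul h0]
          rw [lintegral_const_mul' _ _ ENNReal.ofReal_ne_top, mul_left_comm]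
          refine mul_le_mul_right ((lintegral_lipKernel_le hn hp0 hs0 hs1
            (by positivity) x).trans (le_of_eq ?_)) _
          rw [← ENNReal.ofReal_mul (by positivity), div_eq_mul_one_div _ (4 : ℝ),
            Real.mul_rpow hd.le (by positivity)]
          congr 1
          ring
        · simp [hwΩ x hx, Real.zero_rpow hp0.ne']
      refine (lintegral_mono this).trans_lt ?_
      rw [lintegral_const_mul' _ _ ENNReal.ofReal_ne_top]
      exact ENNReal.mul_lt_top ENNReal.ofReal_lt_top
        (lintegral_hardy_lt_top hn hp0 hs0 ho hb hs hw0 hwΩ hw)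
  have := (((i1.add (i2.const_mul ((L * D) ^ p))).const_mul ((2 : ℝ) ^ p)).add i3).const_mul 2
  refine this.congr (ae_of_all _ fun z => ?_)
  simp only [cutoffMajorant, Pi.add_apply]
  ring

/-- On `{w > 0}` the function `u - w` is Lipschitz, so the gap is at most `2 * a ^ (p - 1)`, where
`a` adds the increment of `w` to a Lipschitz one. Young's inequality separates this from `w z.1`
times the increment of the cut-off, and the bound no longer involves `j`. -/
lemma cutoffError_le (hn : 1 ≤ n) {s p D L : ℝ} (hp : 2 < p)
    (ho : IsOpen Ω) (hb : Bornology.IsBounded Ω) (hD : 0 < D) (hL : 0 ≤ L)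
    (hdiam : ∀ x ∈ Ω, ∀ y ∈ Ω, ‖x - y‖ ≤ D)
    {u w : EuclideanSpace ℝ (Fin n) → ℝ} (hw0 : ∀ x, 0 ≤ w x)
    (hwΩ : ∀ x, x ∉ Ω → w x = 0)
    (hLip : ∀ x y, 0 < w x → 0 < w y → |(u x - w x) - (u y - w y)| ≤ L * ‖x - y‖) (j : ℕ) (z) :
    cutoffError s p u w (cutoff Ω j) z ≤ cutoffMajorant s p D L Ω w z := by
  have hlk := lipKernel_nonneg (s := s) (p := p) hD.le (z.1 - z.2)
  have hlk2 := lipKernel_nonneg (s := s) (p := p) (R := Metric.infDist z.1 Ωᶜ / 4)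
    (by have := Metric.infDist_nonneg (x := z.1) (s := Ωᶜ); positivity) (z.1 - z.2)
  have hind : 0 ≤ Ω.indicator (fun _ => (1 : ℝ)) z.1 :=
    Set.indicator_nonneg (fun _ _ => zero_le_one) _
  by_cases hz : 0 < w z.1 ∧ 0 < w z.2
  swap
  · have e : cutoffError s p u w (cutoff Ω j) z = 0 := Set.indicator_of_notMem (by exact hz) _
    rw [e]
    have := Real.rpow_nonneg (hw0 z.1) p
    unfold cutoffMajorant
    positivity
  have hz1 : z.1 ∈ Ω := by by_contra h; exact hz.1.ne' (hwΩ _ h)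
  have hz2 : z.2 ∈ Ω := by by_contra h; exact hz.2.ne' (hwΩ _ h)
  set H := incrementGap p u (fun y => u y - w y) z with hH
  have e : cutoffError s p u w (cutoff Ω j) z = |H| * (w z.1 * |cutoff Ω j z.1 - cutoff Ω j z.2|) /
      ‖z.1 - z.2‖ ^ ((n : ℝ) + p * s) := Set.indicator_of_mem (by exact hz) _
  have hd := infDist_compl_pos hn ho hb hz1
  set m := min 1 (‖z.1 - z.2‖ / (Metric.infDist z.1 Ωᶜ / 4)) with hm
  have hm0 : 0 ≤ m := le_min zero_le_one (by positivity)
  have hη := abs_cutoff_sub_le j hd z.2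
  set a := |w z.1 - w z.2| + L * ‖z.1 - z.2‖ with ha
  have ha0 : 0 ≤ a := by positivity
  have hv := hLip z.1 z.2 hz.1 hz.2
  have hH1 : |H| ≤ 2 * a ^ (p - 1) := by
    have h1 : |u z.1 - u z.2| ≤ a := by
      have := abs_add_le (w z.1 - w z.2) ((u z.1 - w z.1) - (u z.2 - w z.2))
      rw [show w z.1 - w z.2 + ((u z.1 - w z.1) - (u z.2 - w z.2)) = u z.1 - u z.2 by ring] at this
      linarith
    have h2 : |(u z.1 - w z.1) - (u z.2 - w z.2)| ≤ a := by
      have := abs_nonneg (w z.1 - w z.2)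
      linarith
    have h3 := abs_sub (signedPow p (u z.1 - u z.2)) (signedPow p ((u z.1 - w z.1) - (u z.2 - w z.2)))
    rw [abs_signedPow (by linarith), abs_signedPow (by linarith)] at h3
    have h4 := Real.rpow_le_rpow (abs_nonneg _) h1 (by linarith : 0 ≤ p - 1)
    have h5 := Real.rpow_le_rpow (abs_nonneg _) h2 (by linarith : 0 ≤ p - 1)
    rw [hH]; unfold incrementGap
    linarith
  have hyoung := rpow_sub_one_mul_le (p := p) (by linarith) ha0 (mul_nonneg (hw0 z.1) hm0)
  have hsum := add_rpow_le_two_rpow (r := p) (by linarith) (abs_nonneg (w z.1 - w z.2))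
    (by positivity : 0 ≤ L * ‖z.1 - z.2‖)
  have hlp : (L * ‖z.1 - z.2‖) ^ p = (L * D) ^ p * (min 1 (‖z.1 - z.2‖ / D)) ^ p := by
    rw [min_eq_right (by rw [div_le_one hD]; exact hdiam _ hz1 _ hz2),
      ← Real.mul_rpow (by positivity) (by positivity)]
    congr 1
    field_simp
  have hnum : |H| * (w z.1 * |cutoff Ω j z.1 - cutoff Ω j z.2|) ≤
      2 * (2 ^ p * (|w z.1 - w z.2| ^ p + (L * D) ^ p * (min 1 (‖z.1 - z.2‖ / D)) ^ p) +
        w z.1 ^ p * m ^ p) := by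
    calc |H| * (w z.1 * |cutoff Ω j z.1 - cutoff Ω j z.2|)
        ≤ 2 * a ^ (p - 1) * (w z.1 * m) := by
          have := hw0 z.1
          gcongr
      _ ≤ 2 * (a ^ p + (w z.1 * m) ^ p) := by rw [mul_assoc]; gcongr
      _ ≤ _ := by
          rw [Real.mul_rpow (hw0 _) hm0, ← hlp]
          gcongr
  rw [e]
  refine (div_le_div_of_nonneg_right hnum (by positivity)).trans (le_of_eq ?_)
  unfold cutoffMajorant lipKernel
  rw [Set.indicator_of_mem hz1, mul_comm s p, ← hm]
  ring

lemma measurable_cutoffError {s p : ℝ} (hp : 2 < p) {u w η : EuclideanSpace ℝ (Fin n) → ℝ}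
    (hu : Measurable u) (hw : Measurable w) (hη : Measurable η) :
    Measurable (cutoffError s p u w η) := by
  refine Measurable.indicator ?_ ?_
  · exact ((measurable_incrementGap hp hu (hu.sub hw)).abs.mul ((hw.comp measurable_fst).mul
      ((hη.comp measurable_fst).sub (hη.comp measurable_snd)).abs)).div
      ((measurable_fst.sub measurable_snd).norm.pow_const _)
  · exact (measurableSet_lt measurable_const (hw.comp measurable_fst)).inter
      (measurableSet_lt measurable_const (hw.comp measurable_snd))

/-- Dominated convergence: at each pair of points in `Ω` the cut-off is eventually one at both, so
the error is eventually zero. -/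
lemma tendsto_integral_cutoffError (hn : 1 ≤ n) {s p L : ℝ} (hp : 2 < p) (hs0 : 0 < s)
    (hs1 : s < 1) (ho : IsOpen Ω) (hb : Bornology.IsBounded Ω) (hs : ExteriorTangentSphere Ω)
    (hL : 0 ≤ L) {u w : EuclideanSpace ℝ (Fin n) → ℝ} (hum : Measurable u) (hwm : Measurable w)
    (hw0 : ∀ x, 0 ≤ w x) (hwΩ : ∀ x, x ∉ Ω → w x = 0) (hw : FiniteGagliardo s p w)
    (hLip : ∀ x y, 0 < w x → 0 < w y → |(u x - w x) - (u y - w y)| ≤ L * ‖x - y‖) :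
    (∀ j, Integrable (cutoffError s p u w (cutoff Ω j)) (volume.prod volume)) ∧
    Tendsto (fun j => ∫ z, cutoffError s p u w (cutoff Ω j) z ∂(volume.prod volume)) atTop (𝓝 0) := by
  obtain ⟨D, hD, hdiam⟩ := exists_diam_bound hb
  have hmaj := integrable_cutoffMajorant hn hp hs0 hs1 ho hb hs hD (L := L) hwm hw0 hwΩ hw
  have hmeas : ∀ j, AEStronglyMeasurable (cutoffError s p u w (cutoff Ω j)) (volume.prod volume) :=
    fun j => (measurable_cutoffError hp hum hwm (continuous_cutoff j).measurable).aestronglyMeasurable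
  have hbd : ∀ j, ∀ᵐ z ∂((volume : Measure (EuclideanSpace ℝ (Fin n))).prod volume),
      ‖cutoffError s p u w (cutoff Ω j) z‖ ≤ cutoffMajorant s p D L Ω w z := fun j =>
    ae_of_all _ fun z => by
      rw [Real.norm_of_nonneg (cutoffError_nonneg z)]
      exact cutoffError_le hn hp ho hb hD hL hdiam hw0 hwΩ hLip j z
  refine ⟨fun j => hmaj.mono' (hmeas j) (hbd j), ?_⟩
  rw [← integral_zero (EuclideanSpace ℝ (Fin n) × EuclideanSpace ℝ (Fin n)) ℝ
    (μ := volume.prod volume)]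
  refine tendsto_integral_of_dominated_convergence _ hmeas hmaj hbd (ae_of_all _ fun z => ?_)
  refine tendsto_const_nhds.congr' ?_
  by_cases hz : 0 < w z.1 ∧ 0 < w z.2
  · have hz1 : z.1 ∈ Ω := by by_contra h; exact hz.1.ne' (hwΩ _ h)
    have hz2 : z.2 ∈ Ω := by by_contra h; exact hz.2.ne' (hwΩ _ h)
    filter_upwards [eventually_cutoff_eq_one (infDist_compl_pos hn ho hb hz1),
      eventually_cutoff_eq_one (infDist_compl_pos hn ho hb hz2)] with j h1 h2
    simp [cutoffError, Set.indicator, h1, h2]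
  · refine Eventually.of_forall fun j => ?_
    exact (Set.indicator_of_notMem (by exact hz) _).symm

/-- Testing the gap between `u` and `v` with a compactly supported function. -/
lemma two_mul_integral_test_eq {s p R ε M a : ℝ} (hp : 2 < p) (hps : 0 < p * s)
    {u v ψ : EuclideanSpace ℝ (Fin n) → ℝ} (hu : TailIntegrable s p u) (hv : TailIntegrable s p v)
    (hψ : Measurable ψ) {S : Set (EuclideanSpace ℝ (Fin n))} (hS : IsCompact S)
    (hSR : ∀ x ∈ S, ‖x‖ ≤ R) (hψS : ∀ x, x ∉ S → ψ x = 0) (hψM : ∀ x ∈ S, |ψ x| ≤ M)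
    (hua : ∀ x ∈ S, |u x| ≤ a) (hva : ∀ x ∈ S, |v x| ≤ a) (hε : 0 < ε) :
    Integrable (fun x => ψ x * (truncFracPLap s p u x ε - truncFracPLap s p v x ε)) ∧
    Integrable (fun z : EuclideanSpace ℝ (Fin n) × EuclideanSpace ℝ (Fin n) =>
      {z : EuclideanSpace ℝ (Fin n) × EuclideanSpace ℝ (Fin n) | ε ≤ dist z.1 z.2}.indicator
        (fun z => (ψ z.1 - ψ z.2) * incrementGap p u v z / ‖z.1 - z.2‖ ^ ((n : ℝ) + p * s)) z)
      (volume.prod volume) ∧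
    2 * ∫ x, ψ x * (truncFracPLap s p u x ε - truncFracPLap s p v x ε) =
      ∫ z : EuclideanSpace ℝ (Fin n) × EuclideanSpace ℝ (Fin n),
      {z : EuclideanSpace ℝ (Fin n) × EuclideanSpace ℝ (Fin n) | ε ≤ dist z.1 z.2}.indicator
        (fun z => (ψ z.1 - ψ z.2) * incrementGap p u v z / ‖z.1 - z.2‖ ^ ((n : ℝ) + p * s)) z
      ∂(volume.prod volume) := by
  set q := (n : ℝ) + p * s with hq
  let T : Set (EuclideanSpace ℝ (Fin n) × EuclideanSpace ℝ (Fin n)) := {z | ε ≤ dist z.1 z.2}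
  have hT : MeasurableSet T := measurableSet_le measurable_const (measurable_fst.dist measurable_snd)
  let P : EuclideanSpace ℝ (Fin n) × EuclideanSpace ℝ (Fin n) → ℝ := T.indicator fun z => ψ z.1 * incrementGap p u v z / ‖z.1 - z.2‖ ^ q
  have hPm : Measurable P :=
    (((hψ.comp measurable_fst).mul (measurable_incrementGap hp hu.1 hv.1)).div
      ((measurable_fst.sub measurable_snd).norm.pow_const _)).indicator hT
  have hPi : Integrable P (volume.prod volume) := by
    set C := 2 ^ (p - 1) * ((1 + R) / ε + 1) ^ q
    have h1 : Integrable (fun x : EuclideanSpace ℝ (Fin n) => S.indicator (fun _ => M) x) :=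
      (integrable_indicator_iff hS.measurableSet).2 (integrableOn_const hS.measure_lt_top.ne)
    have h2 := (hu.dominating hps C (a ^ (p - 1))).add (hv.dominating hps C (a ^ (p - 1)))
    -- Away from the diagonal the integrand is dominated by a product: the indicator of `S` in `x`
    -- times a tail weight in `y`.
    refine (h1.mul_prod h2).mono' hPm.aestronglyMeasurable (ae_of_all _ fun z => ?_)
    by_cases hzS : z.1 ∈ S
    swap
    · have : P z = 0 := by simp [P, Set.indicator, hψS _ hzS]
      rw [this, Set.indicator_of_notMem hzS]; simp
    have hM : 0 ≤ M := (abs_nonneg _).trans (hψM _ hzS)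
    have ha : 0 ≤ a := (abs_nonneg _).trans (hua _ hzS)
    have hR : 0 ≤ R := (norm_nonneg _).trans (hSR _ hzS)
    rw [Set.indicator_of_mem hzS]
    by_cases hzT : z ∈ T
    swap
    · have : P z = 0 := Set.indicator_of_notMem hzT _
      rw [this, norm_zero]
      simp only [Pi.add_apply, C]
      positivity
    have : P z = ψ z.1 * (signedPow p (u z.1 - u z.2) / ‖z.1 - z.2‖ ^ q -
        signedPow p (v z.1 - v z.2) / ‖z.1 - z.2‖ ^ q) := by
      have : P z = ψ z.1 * incrementGap p u v z / ‖z.1 - z.2‖ ^ q := Set.indicator_of_mem hzT _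
      rw [this]; unfold incrementGap; ring
    have hzT' : ε ≤ ‖z.1 - z.2‖ := by rw [← dist_eq_norm]; exact hzT
    rw [this, Real.norm_eq_abs, abs_mul]
    refine mul_le_mul (hψM _ hzS) ?_ (abs_nonneg _) hM
    refine (abs_sub _ _).trans (add_le_add ?_ ?_)
    · have h3 := Real.rpow_le_rpow (abs_nonneg _) (hua _ hzS) (by linarith : 0 ≤ p - 1)
      exact (abs_kernel_le (by linarith) hps hε (hSR _ hzS) hzT' _ _).trans
        (mul_le_mul_of_nonneg_left (add_le_add
          (mul_le_mul_of_nonneg_right h3 (by positivity)) le_rfl) (by positivity))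
    · have h3 := Real.rpow_le_rpow (abs_nonneg _) (hva _ hzS) (by linarith : 0 ≤ p - 1)
      exact (abs_kernel_le (by linarith) hps hε (hSR _ hzS) hzT' _ _).trans
        (mul_le_mul_of_nonneg_left (add_le_add
          (mul_le_mul_of_nonneg_right h3 (by positivity)) le_rfl) (by positivity))
  have hPint : ∀ x, ∫ y, P (x, y) =
      ψ x * (truncFracPLap s p u x ε - truncFracPLap s p v x ε) := by
    intro x
    rw [truncFracPLap_eq, truncFracPLap_eq, ← integral_sub (hu.integrableOn hp hps x _ hε)
      (hv.integrableOn hp hps x _ hε), ← integral_const_mul,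
      ← integral_indicator Metric.isOpen_ball.measurableSet.compl]
    congr 1
    ext y
    by_cases hy : ε ≤ dist x y
    · have h1 : (x, y) ∈ T := hy
      have h2 : y ∈ (Metric.ball x ε)ᶜ := by simpa [dist_comm] using hy
      rw [Set.indicator_of_mem h2]
      refine (Set.indicator_of_mem h1 _).trans ?_
      simp only [incrementGap, hq]
      ring
    · have h1 : (x, y) ∉ T := hy
      have h2 : y ∉ (Metric.ball x ε)ᶜ := by simpa [dist_comm] using hy
      rw [Set.indicator_of_notMem h2]
      exact Set.indicator_of_notMem h1 _
  -- The gap is antisymmetric and the region `T` symmetric under exchange of the variables, so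
  -- adding the swapped integrand turns `ψ z.1` into `ψ z.1 - ψ z.2`.
  have hQ : (fun z : EuclideanSpace ℝ (Fin n) × EuclideanSpace ℝ (Fin n) => T.indicator (fun z => (ψ z.1 - ψ z.2) * incrementGap p u v z /
      ‖z.1 - z.2‖ ^ q) z) = fun z => P z + P z.swap := by
    ext z
    have hsw : z.swap ∈ T ↔ z ∈ T := by
      show ε ≤ dist z.2 z.1 ↔ ε ≤ dist z.1 z.2
      rw [dist_comm]
    by_cases hz : z ∈ T
    · have h1 : P z = ψ z.1 * incrementGap p u v z / ‖z.1 - z.2‖ ^ q := Set.indicator_of_mem hz _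
      have h2 : P z.swap = ψ z.2 * incrementGap p u v z.swap / ‖z.2 - z.1‖ ^ q :=
        Set.indicator_of_mem (hsw.2 hz) _
      rw [Set.indicator_of_mem hz, h1, h2, incrementGap_swap, norm_sub_rev z.2]
      ring
    · have h1 : P z = 0 := Set.indicator_of_notMem hz _
      have h2 : P z.swap = 0 := Set.indicator_of_notMem (fun h => hz (hsw.1 h)) _
      rw [Set.indicator_of_notMem hz, h1, h2, add_zero]
  refine ⟨?_, ?_, ?_⟩
  · have := hPi.integral_prod_left
    simpa only [hPint] using this
  · rw [hQ]
    exact hPi.add hPi.swap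
  · have h := integral_add hPi hPi.swap
    simp only [Function.comp_apply] at h
    rw [hQ, h, integral_prod_swap]
    rw [integral_prod _ hPi]
    simp only [hPint]
    ring

/-- Weak comparison: a truncation `w` of a subsolution `u` vanishes if `u - w` is a strict
supersolution on `{w > 0}`. -/
theorem IsSubsolution.ae_eq_zero (hn : 1 ≤ n) {s p B B' L : ℝ} (hp : 2 < p) (hs0 : 0 < s)
    (hs1 : s < 1) (ho : IsOpen Ω) (hb : Bornology.IsBounded Ω) (hs : ExteriorTangentSphere Ω)
    {u w : EuclideanSpace ℝ (Fin n) → ℝ} (hu : IsSubsolution s p B Ω u) (hwm : Measurable w)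
    (hw0 : ∀ x, 0 ≤ w x) (hwu : ∀ x, w x ≤ |u x|) (hw : FiniteGagliardo s p w) (hL : 0 ≤ L)
    (hLip : ∀ x y, 0 < w x → 0 < w y → |(u x - w x) - (u y - w y)| ≤ L * ‖x - y‖)
    (hB : B < B') (hH : ∀ᶠ ε in 𝓝[>] (0 : ℝ), ∀ x, 0 < w x →
      B' ≤ truncFracPLap s p (fun y => u y - w y) x ε) : ∀ᵐ x, w x = 0 := by
  have hps : 0 < p * s := by positivity
  have hwΩ : ∀ x, x ∉ Ω → w x = 0 := fun x hx =>
    le_antisymm (by simpa [hu.zero_outside x hx] using hwu x) (hw0 x)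
  obtain ⟨hNi, hN⟩ := tendsto_integral_cutoffError hn hp hs0 hs1 ho hb hs hL hu.tail.1 hwm hw0 hwΩ
    hw hLip
  have hv2 : ∀ y, |u y - w y| ≤ 2 * |u y| := fun y => by
    have := abs_sub (u y) (w y)
    rw [abs_of_nonneg (hw0 y)] at this
    linarith [hwu y]
  have hv : TailIntegrable s p (fun y => u y - w y) :=
    hu.tail.mono (by linarith) zero_le_two (hu.tail.1.sub hwm) hv2
  have main : ∀ j, Integrable (fun x => w x * cutoff Ω j x) ∧
      (B' - B) * ∫ x, w x * cutoff Ω j x ≤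
        ∫ z, cutoffError s p u w (cutoff Ω j) z ∂(volume.prod volume) := by
    intro j
    obtain ⟨S, hS, hSΩ, hSj⟩ : ∃ S, IsCompact S ∧ S ⊆ Ω ∧ ∀ x, x ∉ S → cutoff Ω j x = 0 := by
      -- The shift to `j + 1` covers `j = 0`; below this distance the cut-off already vanishes.
      have hc : (0 : ℝ) < 1 / (j + 1) := by positivity
      obtain ⟨h1, h2⟩ := isCompact_le_infDist hb hc
      refine ⟨_, h1, h2, fun x hx => ?_⟩
      have hx' : Metric.infDist x Ωᶜ < 1 / (j + 1) := not_le.1 hx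
      rw [lt_div_iff₀ (by positivity)] at hx'
      have := Metric.infDist_nonneg (x := x) (s := Ωᶜ)
      unfold cutoff
      rw [max_eq_left]
      exact (min_le_right _ _).trans (by linarith)
    obtain ⟨R, hR⟩ := hS.isBounded.subset_closedBall 0
    obtain ⟨a, ha⟩ := hS.exists_bound_of_continuousOn (hu.cont.mono hSΩ)
    set ψ : EuclideanSpace ℝ (Fin n) → ℝ := fun x => w x * cutoff Ω j x with hψ
    have hψ0 : ∀ x, 0 ≤ ψ x := fun x => mul_nonneg (hw0 x) (cutoff_nonneg j x)
    have hψS : ∀ x, x ∉ S → ψ x = 0 := fun x hx => by simp [hψ, hSj x hx]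
    have hψm : Measurable ψ := hwm.mul (continuous_cutoff j).measurable
    have hψa : ∀ x ∈ S, |ψ x| ≤ a := fun x hx => by
      rw [abs_of_nonneg (hψ0 x)]
      calc w x * cutoff Ω j x ≤ |u x| * 1 :=
            mul_le_mul (hwu x) (cutoff_le_one j x) (cutoff_nonneg j x) (abs_nonneg _)
        _ ≤ a := by rw [mul_one]; exact ha x hx
    have hψi : Integrable ψ := by
      have h1 : IntegrableOn ψ S := Measure.integrableOn_of_bounded hS.measure_lt_top.ne
        hψm.aestronglyMeasurable ((ae_restrict_iff' hS.measurableSet).2 (ae_of_all _ hψa))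
      rwa [integrableOn_iff_integrable_of_support_subset] at h1
      exact fun x hx => by_contra fun h => hx (hψS x h)
    refine ⟨hψi, ?_⟩
    -- For fixed `j` the test function lives on the compact set `S`, so a single `ε` serves both
    -- operator bounds. The cut-off error does not depend on `ε`. Half of `B' - B` is spent as
    -- slack, and the factor two from symmetrization restores it.
    obtain ⟨ε, hε, h1, h2⟩ := ((eventually_mem_nhdsWithin (a := (0 : ℝ)) (s := Set.Ioi 0)).and ((hu.upper S hSΩ hS ((B' - B) / 2)
      (by linarith)).and hH)).exists
    have hε' : 0 < ε := hε
    obtain ⟨t1, t2, t3⟩ := two_mul_integral_test_eq (a := 2 * a) (R := R) hp hps hu.tail hv hψm hS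
      (fun x hx => mem_closedBall_zero_iff.1 (hR hx)) hψS hψa
      (fun x hx => (by
        have h3 : |u x| ≤ a := ha x hx
        have := abs_nonneg (u x)
        linarith))
      (fun x hx => (hv2 x).trans (by
        have h3 : |u x| ≤ a := ha x hx
        linarith)) hε'
    have lower : -∫ z, cutoffError s p u w (cutoff Ω j) z ∂(volume.prod volume) ≤
        2 * ∫ x, ψ x * (truncFracPLap s p u x ε - truncFracPLap s p (fun y => u y - w y) x ε) := by
      rw [t3, ← integral_neg]
      refine integral_mono (hNi j).neg t2 fun z => ?_
      by_cases hz : ε ≤ dist z.1 z.2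
      · have hz' : z ∈ {z : EuclideanSpace ℝ (Fin n) × EuclideanSpace ℝ (Fin n) |
          ε ≤ dist z.1 z.2} := hz
        simp only [Set.indicator_of_mem hz']
        exact neg_cutoffError_le hp hw0 (cutoff_nonneg j) z
      · have hz' : z ∉ {z : EuclideanSpace ℝ (Fin n) × EuclideanSpace ℝ (Fin n) |
          ε ≤ dist z.1 z.2} := hz
        simp only [Set.indicator_of_notMem hz']
        exact neg_nonpos.2 (cutoffError_nonneg z)
    have upper : ∫ x, ψ x * (truncFracPLap s p u x ε - truncFracPLap s p (fun y => u y - w y) x ε) ≤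
        ∫ x, -((B' - B) / 2) * ψ x := by
      refine integral_mono t1 (hψi.const_mul _) fun x => ?_
      rcases (hψ0 x).eq_or_lt with h | h
      · simp [← h]
      · have hx : x ∈ S := by
          by_contra h'
          exact h.ne' (hψS x h')
        have hwx : 0 < w x := (hw0 x).lt_of_ne' fun h' => h.ne' (by simp [hψ, h'])
        have h3 := h1 x hx
        have h4 := h2 x hwx
        simp only
        nlinarith
    rw [integral_const_mul] at upper
    linarith
  have zero : ∀ i, ∀ᵐ x, w x * cutoff Ω i x = 0 := by
    intro i
    have h0 : ∀ x, 0 ≤ w x * cutoff Ω i x := fun x => mul_nonneg (hw0 x) (cutoff_nonneg i x)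
    -- The cut-offs increase with the index, so the integral for `i` is bounded by the error for
    -- every `j ≥ i`, which tends to zero.
    have h1 : (B' - B) * ∫ x, w x * cutoff Ω i x ≤ 0 := by
      refine ge_of_tendsto hN ?_
      filter_upwards [eventually_ge_atTop i] with j hj
      refine le_trans ?_ (main j).2
      refine mul_le_mul_of_nonneg_left ?_ (by linarith)
      exact integral_mono (main i).1 (main j).1 fun x =>
        mul_le_mul_of_nonneg_left (cutoff_mono hj x) (hw0 x)
    have h2 : ∫ x, w x * cutoff Ω i x = 0 := by
      have := integral_nonneg (μ := volume) (f := fun x => w x * cutoff Ω i x) h0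
      nlinarith
    have h3 := (integral_eq_zero_iff_of_nonneg h0 (main i).1).1 h2
    filter_upwards [h3] with x hx using hx
  filter_upwards [ae_all_iff.2 zero] with x hx
  by_cases hxΩ : x ∈ Ω
  · obtain ⟨j, hj⟩ := (eventually_cutoff_eq_one (infDist_compl_pos hn ho hb hxΩ)).exists
    simpa [hj] using hx j
  · exact hwΩ x hxΩ

end Energy

/-! ### The quadratic barrier and its fractional p-Laplacian -/

section Barrier

variable {n : ℕ}

/-- The quadratic barrier. -/
noncomputable def quadBarrier (x₀ : EuclideanSpace ℝ (Fin n)) (r m M θ : ℝ)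
    (y : EuclideanSpace ℝ (Fin n)) : ℝ :=
  m + M * (1 - 2 * θ) + 4 * θ * M / r ^ 2 * ‖y - x₀‖ ^ 2

variable {x₀ : EuclideanSpace ℝ (Fin n)} {r m M θ : ℝ}

lemma continuous_quadBarrier : Continuous (quadBarrier x₀ r m M θ) := by
  unfold quadBarrier; fun_prop

lemma le_quadBarrier (hM : 0 ≤ M) (hθ : 0 ≤ θ) (y : EuclideanSpace ℝ (Fin n)) :
    m + M * (1 - 2 * θ) ≤ quadBarrier x₀ r m M θ y := by
  unfold quadBarrier
  have : 0 ≤ 4 * θ * M / r ^ 2 * ‖y - x₀‖ ^ 2 := by positivity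
  linarith

lemma quadBarrier_le (hr : 0 < r) (hM : 0 ≤ M) (hθ : 0 ≤ θ) {t : ℝ} {y : EuclideanSpace ℝ (Fin n)}
    (hy : ‖y - x₀‖ ≤ t * r) :
    quadBarrier x₀ r m M θ y ≤ m + M * (1 - 2 * θ) + 4 * θ * M * t ^ 2 := by
  unfold quadBarrier
  have h : ‖y - x₀‖ ^ 2 ≤ (t * r) ^ 2 := by gcongr
  have : 4 * θ * M / r ^ 2 * ‖y - x₀‖ ^ 2 ≤ 4 * θ * M / r ^ 2 * (t * r) ^ 2 := by gcongr
  rw [show 4 * θ * M / r ^ 2 * (t * r) ^ 2 = 4 * θ * M * t ^ 2 by field_simp] at this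
  linarith

lemma quadBarrier_second_difference (x h : EuclideanSpace ℝ (Fin n)) :
    quadBarrier x₀ r m M θ (x + h) + quadBarrier x₀ r m M θ (x - h) - 2 * quadBarrier x₀ r m M θ x =
      2 * (4 * θ * M / r ^ 2) * ‖h‖ ^ 2 := by
  have := parallelogram_law_with_norm ℝ (x - x₀) h
  unfold quadBarrier
  rw [show x + h - x₀ = x - x₀ + h by abel, show x - h - x₀ = x - x₀ - h by abel]
  linear_combination (4 * θ * M / r ^ 2) * this

lemma abs_quadBarrier_sub_le (hr : 0 < r) (hM : 0 ≤ M) (hθ : 0 ≤ θ)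
    {x y : EuclideanSpace ℝ (Fin n)} (hx : ‖x - x₀‖ ≤ r) (hy : ‖y - x₀‖ ≤ r) :
    |quadBarrier x₀ r m M θ x - quadBarrier x₀ r m M θ y| ≤ 8 * θ * M / r * ‖x - y‖ := by
  have h1 : |‖x - x₀‖ - ‖y - x₀‖| ≤ ‖x - y‖ := by
    have := abs_norm_sub_norm_le (x - x₀) (y - x₀)
    rwa [sub_sub_sub_cancel_right] at this
  have e : quadBarrier x₀ r m M θ x - quadBarrier x₀ r m M θ y =
      4 * θ * M / r ^ 2 * ((‖x - x₀‖ - ‖y - x₀‖) * (‖x - x₀‖ + ‖y - x₀‖)) := by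
    unfold quadBarrier; ring
  rw [e, abs_mul, abs_mul, abs_of_nonneg (by positivity : 0 ≤ 4 * θ * M / r ^ 2),
    abs_of_nonneg (by positivity : 0 ≤ ‖x - x₀‖ + ‖y - x₀‖)]
  calc 4 * θ * M / r ^ 2 * (|‖x - x₀‖ - ‖y - x₀‖| * (‖x - x₀‖ + ‖y - x₀‖))
      ≤ 4 * θ * M / r ^ 2 * (‖x - y‖ * (r + r)) := by gcongr
    _ = 8 * θ * M / r * ‖x - y‖ := by field_simp; ring

/-- The fraction of a ball that is guaranteed to lie in the low level set. -/
noncomputable def massConstant (n : ℕ) (s p : ℝ) : ℝ :=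
  (1 / 4) ^ (p - 1) * 2 ^ (-((n : ℝ) + p * s)) *
    (volume.real (Metric.ball (0 : EuclideanSpace ℝ (Fin n)) 1) * (1 / 2) ^ n / 2)

/-- The constant in front of the error terms of the barrier estimate. -/
noncomputable def errorConstant (n : ℕ) (s p : ℝ) : ℝ :=
  sphereMass n * ((p - 1) * 12 ^ (p - 1) * (1 / 4) ^ (p - p * s) / (p - p * s) +
    4 ^ (p - 1) * 4 ^ (p * s) / (p * s / 2))

/-- The ball of radius `r / 4` about `x` stays inside the ball of radius `r` about `x₀`. There the
barrier has slope of order `θ * M / r` and second differences of order `θ * M / r ^ 2`, and the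
cancellation estimate turns these into the scale `θ ^ (p - 1) * M ^ (p - 1) * r ^ (-(p * s))`. The
constant 12 leaves room over the actual slope constant 8. -/
lemma barrier_core (hn : 1 ≤ n) {s p : ℝ} (hp : 2 < p) (hs0 : 0 < s) (hs1 : s < 1)
    (hr : 0 < r) (hM : 0 < M) (hθ : 0 < θ) {x : EuclideanSpace ℝ (Fin n)}
    (hx : ‖x - x₀‖ ≤ 3 / 4 * r) {ε : ℝ} (hε : 0 < ε) :
    -((p - 1) * 12 ^ (p - 1) * (1 / 4) ^ (p - p * s) / (p - p * s) * sphereMass n *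
      (θ ^ (p - 1) * M ^ (p - 1) * r ^ (-(p * s)))) ≤
    ∫ y in annulus x ε (r / 4), signedPow p (quadBarrier x₀ r m M θ x - quadBarrier x₀ r m M θ y) /
      ‖x - y‖ ^ ((n : ℝ) + p * s) := by
  have hps1 : 0 < p - p * s := by nlinarith
  have hsm := sphereMass_pos hn
  have h := abs_setIntegral_annulus_le hn hp hs1 hs0
    (continuous_quadBarrier (x₀ := x₀) (r := r) (m := m) (M := M) (θ := θ)).measurable
    (x := x) (ε := ε) (R := r / 4) (N := 12 * (θ * M) / r) (Λ := 4 * θ * M / r ^ 2) hε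
    (by positivity) (by positivity) (by positivity) (fun h hh => ?_) (fun h hh => ?_)
  · refine le_trans (neg_le_neg ?_) (abs_le.1 h).1
    have e1 : (12 * (θ * M) / r) ^ (p - 2) * (4 * θ * M / r ^ 2) ≤
        12 ^ (p - 1) * (θ ^ (p - 1) * M ^ (p - 1)) * r ^ (-p) := by
      calc (12 * (θ * M) / r) ^ (p - 2) * (4 * θ * M / r ^ 2)
          ≤ (12 * (θ * M) / r) ^ (p - 2) * ((12 * (θ * M) / r) * r⁻¹) := by
            gcongr
            rw [← div_eq_mul_inv, div_div, ← pow_two]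
            refine div_le_div_of_nonneg_right ?_ (by positivity)
            nlinarith [mul_pos hθ hM]
        _ = (12 * (θ * M) / r) ^ (p - 1) * r⁻¹ := by
            rw [← mul_assoc]
            congr 1
            nth_rewrite 2 [← Real.rpow_one (12 * (θ * M) / r)]
            rw [← Real.rpow_add (by positivity)]
            congr 1; ring
        _ = _ := by
            rw [Real.div_rpow (by positivity) hr.le, Real.mul_rpow (by positivity) (by positivity),
              Real.mul_rpow hθ.le hM.le, div_eq_mul_inv, ← Real.rpow_neg hr.le, mul_assoc,
              ← Real.rpow_neg_one r, ← Real.rpow_add hr]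
            congr 2; ring
    have e2 : (r / 4) ^ (p - p * s) = (1 / 4) ^ (p - p * s) * (r ^ p * r ^ (-(p * s))) := by
      rw [← Real.rpow_add hr, ← sub_eq_add_neg, show r / 4 = 1 / 4 * r by ring,
        Real.mul_rpow (by norm_num) hr.le]
    rw [e2, mul_assoc (p - 1)]
    have hp1 : 0 ≤ p - 1 := by linarith
    calc (p - 1) * ((12 * (θ * M) / r) ^ (p - 2) * (4 * θ * M / r ^ 2)) * (sphereMass n *
          ((1 / 4) ^ (p - p * s) * (r ^ p * r ^ (-(p * s))) / (p - p * s)))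
        ≤ (p - 1) * (12 ^ (p - 1) * (θ ^ (p - 1) * M ^ (p - 1)) * r ^ (-p)) * (sphereMass n *
          ((1 / 4) ^ (p - p * s) * (r ^ p * r ^ (-(p * s))) / (p - p * s))) := by
          gcongr
      _ = _ := by
          rw [Real.rpow_neg hr.le p]
          field_simp
  · have a1 : ‖x + h - x₀‖ ≤ r := by
      have := norm_add_le (x - x₀) h
      rw [show x + h - x₀ = x - x₀ + h by abel]
      linarith
    have := abs_quadBarrier_sub_le (m := m) hr hM.le hθ.le a1 (by linarith : ‖x - x₀‖ ≤ r)
    rw [add_sub_cancel_left] at this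
    refine this.trans ?_
    have h8 : 8 * θ * M ≤ 12 * (θ * M) := by nlinarith [mul_pos hθ hM]
    gcongr
  · rw [quadBarrier_second_difference, abs_of_nonneg (by positivity)]

-- At a contact point `v` lies about `M` above its values on the low level set, a gain independent
-- of `θ`. Inside the ball `v ≤ b`, so replacing `v` by `b` only lowers the integrand; that loss and
-- the loss from the tail both carry the factor `θ ^ (p - 1)`.
set_option maxHeartbeats 1000000 in
lemma barrier_lower_bound (hn : 1 ≤ n) {s p : ℝ} (hp : 2 < p) (hs0 : 0 < s) (hs1 : s < 1)
    (hr : 0 < r) (hM : 0 < M) (hθ : 0 < θ) (hθ1 : θ ≤ 1 / 16)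
    {v : EuclideanSpace ℝ (Fin n) → ℝ} (hv : TailIntegrable s p v)
    (hvb : ∀ y ∈ Metric.ball x₀ r, v y ≤ quadBarrier x₀ r m M θ y)
    (hvt : ∀ y ∉ Metric.ball x₀ r,
      v y ≤ m + M * (1 + θ * (‖y - x₀‖ / r) ^ (p * s / (2 * (p - 1)))))
    (hvD : ENNReal.ofReal ((1 / 2) ^ n) * volume (Metric.ball x₀ r) ≤
      volume {y ∈ Metric.ball x₀ r | v y ≤ m})
    {x : EuclideanSpace ℝ (Fin n)} (hx : ‖x - x₀‖ ≤ 3 / 4 * r)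
    (hvx : v x = quadBarrier x₀ r m M θ x) {ε : ℝ} (hε : 0 < ε) (hεr : ε < r * (1 / 2) ^ n / 4) :
    (massConstant n s p - errorConstant n s p * θ ^ (p - 1)) * (M ^ (p - 1) * r ^ (-(p * s))) ≤
      truncFracPLap s p v x ε := by
  set q := (n : ℝ) + p * s with hq
  have hps : 0 < p * s := by positivity
  have hq0 : 0 < q := by positivity
  have hp1 : 0 < p - 1 := by linarith
  set b := quadBarrier x₀ r m M θ with hb
  have hhalf : ((1 : ℝ) / 2) ^ n ≤ 1 := pow_le_one₀ (by norm_num) (by norm_num)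
  have hεr4 : ε < r / 4 := by nlinarith
  have mb : MeasurableSet (Metric.ball x ε)ᶜ := Metric.isOpen_ball.measurableSet.compl
  set A := annulus x ε (r / 4)
  set O := (Metric.ball x (r / 4))ᶜ
  have mA : MeasurableSet A := measurableSet_annulus _ _ _
  have mO : MeasurableSet O := Metric.isOpen_ball.measurableSet.compl
  have hAball : ∀ y ∈ A, y ∈ Metric.ball x₀ r := by
    intro y hy
    have h1 : dist y x < r / 4 := hy.2
    rw [← dist_eq_norm] at hx
    rw [Metric.mem_ball]
    linarith [dist_triangle y x x₀]
  set D := {y ∈ Metric.ball x₀ r | v y ≤ m} ∩ (Metric.ball x ε)ᶜ with hD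
  have mD0 : MeasurableSet {y ∈ Metric.ball x₀ r | v y ≤ m} :=
    Metric.isOpen_ball.measurableSet.inter (measurableSet_le hv.1 measurable_const)
  have mD : MeasurableSet D := mD0.inter mb
  -- A lower bound for the gain on the low level set: the difference there is at least `M / 2`, of
  -- which `M / 4` is kept, and the distance to `x` is at most `2 * r`.
  set k := (M / 4) ^ (p - 1) * (2 * r) ^ (-q) with hk
  have hk0 : 0 ≤ k := by positivity
  set I : EuclideanSpace ℝ (Fin n) → ℝ := D.indicator fun _ => k with hI
  have hDfin : volume D < ⊤ :=
    (measure_mono fun y hy => hy.1.1).trans_lt (measure_ball_lt_top (x := x₀) (r := r))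
  have Ii : Integrable I := (integrable_indicator_iff mD).2 (integrableOn_const hDfin.ne)
  set F : EuclideanSpace ℝ (Fin n) → ℝ := fun y => signedPow p (v x - v y) / ‖x - y‖ ^ q with hF
  have Fi : IntegrableOn F (Metric.ball x ε)ᶜ := hv.integrableOn hp hps x (v x) hε
  have hbx : m + M * (1 - 2 * θ) ≤ b x := le_quadBarrier hM.le hθ.le x
  -- the kernel on the low level set
  have low : ∀ y ∈ D, M / 2 ≤ v x - v y ∧ 0 < ‖x - y‖ ∧ (2 * r) ^ (-q) ≤ (‖x - y‖ ^ q)⁻¹ := by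
    intro y hy
    have h1 : v y ≤ m := hy.1.2
    have h2 : dist y x₀ < r := hy.1.1
    have h3 : ¬ dist y x < ε := hy.2
    have h4 : dist x x₀ ≤ 3 / 4 * r := by rw [dist_eq_norm]; exact hx
    have h5 : ‖x - y‖ ≤ 2 * r := by
      rw [← dist_eq_norm]
      linarith [dist_triangle_right x y x₀]
    have h6 : 0 < ‖x - y‖ := by
      rw [← dist_eq_norm, dist_comm]; linarith
    refine ⟨?_, h6, ?_⟩
    · rw [hvx]; nlinarith
    · rw [Real.rpow_neg (by positivity)]
      gcongr
  -- the annulus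
  have boundA : ∀ y ∈ A, signedPow p (b x - b y) / ‖x - y‖ ^ q + I y ≤ F y := by
    intro y hy
    have hyb := hAball y hy
    by_cases hyD : y ∈ D
    · obtain ⟨l1, l2, l3⟩ := low y hyD
      have h1 : b y ≥ m + M * (1 - 2 * θ) := le_quadBarrier hM.le hθ.le y
      have h2 : b x ≤ m + M * (1 - 2 * θ) + 4 * θ * M * 1 ^ 2 :=
        quadBarrier_le hr hM.le hθ.le (by linarith)
      have h3 : signedPow p (b x - b y) ≤ (M / 4) ^ (p - 1) := by
        have := signedPow_mono (p := p) (by linarith)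
          (show b x - b y ≤ M / 4 by nlinarith)
        rwa [signedPow_of_nonneg (t := M / 4) (by linarith) (by positivity)] at this
      have h4 : (M / 2) ^ (p - 1) ≤ signedPow p (v x - v y) :=
        rpow_le_signedPow (by linarith) (by positivity) l1
      -- As `p - 1 ≥ 1`, the power of `M / 2` pays twice: once for the barrier increment, which is
      -- at most `4 * θ * M ≤ M / 4`, and once for the gain `I`.
      have h5 : 2 * (M / 4) ^ (p - 1) ≤ (M / 2) ^ (p - 1) := by
        rw [show M / 2 = 2 * (M / 4) by ring, Real.mul_rpow zero_le_two (by positivity)]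
        gcongr
        have := Real.rpow_le_rpow_of_exponent_le (one_le_two (α := ℝ)) (by linarith : 1 ≤ p - 1)
        rwa [Real.rpow_one] at this
      have h6 : I y ≤ (M / 4) ^ (p - 1) * (‖x - y‖ ^ q)⁻¹ := by
        rw [hI, Set.indicator_of_mem hyD, hk]
        gcongr
      have h7 : 0 ≤ (‖x - y‖ ^ q)⁻¹ := by positivity
      simp only [hF, div_eq_mul_inv]
      have h8 := mul_le_mul_of_nonneg_right
        (show signedPow p (b x - b y) + (M / 4) ^ (p - 1) ≤ signedPow p (v x - v y) by linarith) h7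
      linarith
    · rw [hI, Set.indicator_of_notMem hyD, add_zero]
      simp only [hF]
      refine div_le_div_of_nonneg_right (signedPow_mono (by linarith) ?_) (by positivity)
      rw [hvx]
      linarith [hvb y hyb]
  -- the exterior
  set E := (4 * (θ * M)) ^ (p - 1) * (4 / r) ^ (p * s / 2) with hE
  have hE0 : 0 ≤ E := by positivity
  have boundO : ∀ y ∈ O, -(E * ‖y - x‖ ^ (-(p * s / 2) - (n : ℝ))) + I y ≤ F y := by
    intro y hy
    have hyr : r / 4 ≤ ‖x - y‖ := by
      have : ¬ dist y x < r / 4 := hy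
      rw [← dist_eq_norm, dist_comm]; linarith
    have hpos : 0 < ‖x - y‖ := by linarith
    have hE1 : 0 ≤ E * ‖y - x‖ ^ (-(p * s / 2) - (n : ℝ)) := by positivity
    by_cases hyD : y ∈ D
    · obtain ⟨l1, l2, l3⟩ := low y hyD
      have h4 : (M / 4) ^ (p - 1) ≤ signedPow p (v x - v y) :=
        rpow_le_signedPow (by linarith) (by positivity) (by linarith)
      have h6 : I y ≤ F y := by
        rw [hI, Set.indicator_of_mem hyD, hk]
        simp only [hF]
        rw [div_eq_mul_inv]
        have h5 : 0 ≤ (M / 4) ^ (p - 1) := by positivity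
        exact mul_le_mul h4 l3 (by positivity) (h5.trans h4)
      linarith
    · rw [hI, Set.indicator_of_notMem hyD, add_zero]
      -- Recentring at `x`: since `‖x - y‖ ≥ r / 4` and `‖x - x₀‖ ≤ 3 / 4 * r`, the ratio `‖y - x₀‖
      -- / r` is at most `t`.
      set t := 4 / r * ‖x - y‖ with ht
      have ht1 : 1 ≤ t := by
        rw [ht, div_mul_eq_mul_div, le_div_iff₀ hr]; linarith
      set ν := p * s / (2 * (p - 1)) with hν
      have hν0 : 0 < ν := by positivity
      have htν : 1 ≤ t ^ ν := Real.one_le_rpow ht1 hν0.le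
      have hyx : ‖y - x₀‖ ≤ t * r := by
        have h1 : ‖y - x₀‖ ≤ ‖y - x‖ + ‖x - x₀‖ := by
          have := norm_add_le (y - x) (x - x₀)
          rwa [sub_add_sub_cancel] at this
        rw [norm_sub_rev y x] at h1
        rw [ht, show 4 / r * ‖x - y‖ * r = 4 * ‖x - y‖ by field_simp]
        linarith
      have key : -(4 * (θ * M) * t ^ ν) ≤ v x - v y := by
        rw [hvx]
        have hθM : 0 < θ * M := by positivity
        by_cases hyb : y ∈ Metric.ball x₀ r
        · have h1 := hvb y hyb
          have h2 : b y ≤ m + M * (1 - 2 * θ) + 4 * θ * M * 1 ^ 2 := by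
            refine quadBarrier_le hr hM.le hθ.le ?_
            rw [← dist_eq_norm, one_mul]
            exact (Metric.mem_ball.1 hyb).le
          nlinarith
        · have h1 := hvt y hyb
          have h2 : (‖y - x₀‖ / r) ^ ν ≤ t ^ ν := by
            gcongr
            rw [div_le_iff₀ hr]; exact hyx
          have h3 : M * (1 + θ * (‖y - x₀‖ / r) ^ ν) ≤ M + θ * M * t ^ ν := by
            have := mul_le_mul_of_nonneg_left h2 hθM.le
            linarith
          nlinarith
      have h5 := neg_rpow_le_signedPow (p := p) (by linarith) (by positivity) key
      -- The tail exponent is chosen so that its `(p - 1)`-th power grows like `‖x - y‖ ^ (p * s /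
      -- 2)`, half of the available decay, and the tail remains integrable.
      have h6 : (4 * (θ * M) * t ^ ν) ^ (p - 1) = E * ‖x - y‖ ^ (p * s / 2) := by
        rw [Real.mul_rpow (by positivity) (by positivity), ← Real.rpow_mul (by positivity),
          show ν * (p - 1) = p * s / 2 by rw [hν]; field_simp, ht,
          Real.mul_rpow (by positivity) hpos.le, hE]
        ring
      have h7 : ‖y - x‖ ^ (-(p * s / 2) - (n : ℝ)) = ‖x - y‖ ^ (p * s / 2) / ‖x - y‖ ^ q := by
        rw [← Real.rpow_sub hpos, norm_sub_rev, hq]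
        congr 1; ring
      rw [h7, ← mul_div_assoc, ← h6, ← neg_div]
      simp only [hF]
      exact div_le_div_of_nonneg_right h5 (by positivity)
  -- integration
  have bi : IntegrableOn (fun y => signedPow p (b x - b y) / ‖x - y‖ ^ q) A := by
    refine Measure.integrableOn_of_bounded (M := (4 * θ * M) ^ (p - 1) / ε ^ q) ?_ ?_ ?_
    · exact ((measure_mono Set.inter_subset_right).trans_lt measure_ball_lt_top).ne
    · exact (measurable_kernel hp continuous_quadBarrier.measurable x (b x)).aestronglyMeasurable
    · refine (ae_restrict_iff' mA).2 (ae_of_all _ fun y hy => ?_)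
      have h1 : b y ≥ m + M * (1 - 2 * θ) := le_quadBarrier hM.le hθ.le y
      have h2 : b x ≤ m + M * (1 - 2 * θ) + 4 * θ * M * 1 ^ 2 :=
        quadBarrier_le hr hM.le hθ.le (by linarith)
      have h3 : b y ≤ m + M * (1 - 2 * θ) + 4 * θ * M * 1 ^ 2 := by
        refine quadBarrier_le hr hM.le hθ.le ?_
        rw [← dist_eq_norm, one_mul]
        exact (Metric.mem_ball.1 (hAball y hy)).le
      have h4 : ε ≤ ‖x - y‖ := by
        have : ¬ dist y x < ε := hy.1
        rw [← dist_eq_norm, dist_comm]; linarith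
      rw [Real.norm_eq_abs, abs_div, abs_signedPow (by linarith),
        abs_of_nonneg (by positivity : 0 ≤ ‖x - y‖ ^ q)]
      gcongr
      exact abs_le.2 ⟨by linarith, by linarith⟩
  have rc := radial_compl_ball hn (a := p * s / 2) (R := r / 4) (by positivity) (by positivity)
  have Oi : IntegrableOn (fun y => E * ‖y - x‖ ^ (-(p * s / 2) - (n : ℝ))) O := by
    have := integrableOn_sub_left x Metric.isOpen_ball.measurableSet.compl rc.1
    rw [← compl_ball_eq_preimage] at this
    exact this.const_mul E
  have On : IntegrableOn (fun y => -(E * ‖y - x‖ ^ (-(p * s / 2) - (n : ℝ)))) O := Oi.neg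
  have Oe : ∫ y in O, E * ‖y - x‖ ^ (-(p * s / 2) - (n : ℝ)) =
      E * (sphereMass n * ((r / 4) ^ (-(p * s / 2)) / (p * s / 2))) := by
    rw [integral_const_mul, ← rc.2]
    congr 1
    rw [← setIntegral_sub_left x (fun h => ‖h‖ ^ (-(p * s / 2) - (n : ℝ))) _
      Metric.isOpen_ball.measurableSet.compl, ← compl_ball_eq_preimage]
  have sA : ∫ y in A, (signedPow p (b x - b y) / ‖x - y‖ ^ q + I y) ≤ ∫ y in A, F y :=
    setIntegral_mono_on (bi.add Ii.integrableOn) (Fi.mono_set Set.inter_subset_left) mA boundA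
  have sO : ∫ y in O, (-(E * ‖y - x‖ ^ (-(p * s / 2) - (n : ℝ))) + I y) ≤ ∫ y in O, F y := by
    refine setIntegral_mono_on (On.add Ii.integrableOn) (Fi.mono_set ?_) mO boundO
    exact Set.compl_subset_compl.2 (Metric.ball_subset_ball hεr4.le)
  rw [integral_add bi Ii.integrableOn] at sA
  rw [integral_add On Ii.integrableOn, integral_neg, Oe] at sO
  have Isum : (∫ y in A, I y) + ∫ y in O, I y = k * volume.real D := by
    rw [← setIntegral_compl_ball_split hεr4.le Ii.integrableOn, hI,
      setIntegral_indicator mD, setIntegral_const, smul_eq_mul, mul_comm]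
    congr 2
    rw [hD]
    ext y; simp only [Set.mem_inter_iff]; tauto
  have core := barrier_core hn hp hs0 hs1 (m := m) hr hM hθ hx hε
  have split : truncFracPLap s p v x ε = (∫ y in A, F y) + ∫ y in O, F y := by
    rw [truncFracPLap_eq]
    exact setIntegral_compl_ball_split hεr4.le Fi
  set ω := volume.real (Metric.ball (0 : EuclideanSpace ℝ (Fin n)) 1) with hω
  have hω0 : 0 < ω := volume_unit_ball_pos
  have vol : r ^ n * (ω * (1 / 2) ^ n / 2) ≤ volume.real D := by
    have h1 : volume {y ∈ Metric.ball x₀ r | v y ≤ m} ≤ volume D + volume (Metric.ball x ε) := by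
      refine (measure_mono fun y hy => ?_).trans (measure_union_le _ _)
      by_cases h : y ∈ Metric.ball x ε
      · exact Or.inr h
      · exact Or.inl ⟨hy, h⟩
    have h2 := hvD.trans h1
    rw [volume_ball_eq _ hr, volume_ball_eq _ hε, ← ENNReal.ofReal_mul (by positivity),
      ← ENNReal.ofReal_toReal hDfin.ne, ← ENNReal.ofReal_add ENNReal.toReal_nonneg (by positivity),
      ENNReal.ofReal_le_ofReal_iff (by positivity)] at h2
    -- The smallness of `ε` ensures that removing the ball about `x` costs at most half of the
    -- guaranteed measure.
    have h3 : ε ^ n ≤ r ^ n * ((1 / 2) ^ n / 2) := by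
      have h4 : ε ≤ r * ((1 / 2) ^ n / 2) := by
        have : 0 < r * (1 / 2) ^ n := by positivity
        linarith
      calc ε ^ n ≤ (r * ((1 / 2) ^ n / 2)) ^ n := by gcongr
        _ = r ^ n * ((1 / 2) ^ n / 2) ^ n := mul_pow _ _ _
        _ ≤ _ := by
          gcongr
          exact pow_le_of_le_one (by positivity) (by linarith) (by omega)
    have h5 : ε ^ n * ω ≤ r ^ n * ((1 / 2) ^ n / 2) * ω := by gcongr
    simp only [Measure.real] at h2 ⊢
    have h6 : (volume (Metric.ball (0 : EuclideanSpace ℝ (Fin n)) 1)).toReal = ω := rfl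
    rw [h6] at h2
    linarith
  have kvol := mul_le_mul_of_nonneg_left vol hk0
  have e3 : k * (r ^ n * (ω * (1 / 2) ^ n / 2)) =
      massConstant n s p * (M ^ (p - 1) * r ^ (-(p * s))) := by
    rw [hk, massConstant, ← hω, ← hq, show M / 4 = 1 / 4 * M by ring,
      Real.mul_rpow (by norm_num) hM.le, Real.mul_rpow (by norm_num) hr.le]
    have : r ^ (-q) * r ^ n = r ^ (-(p * s)) := by
      rw [← Real.rpow_natCast, ← Real.rpow_add hr, hq]
      congr 1; ring
    rw [← this]
    ring
  have e2 : E * (sphereMass n * ((r / 4) ^ (-(p * s / 2)) / (p * s / 2))) =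
      4 ^ (p - 1) * 4 ^ (p * s) / (p * s / 2) * sphereMass n *
        (θ ^ (p - 1) * M ^ (p - 1) * r ^ (-(p * s))) := by
    have : (4 / r) ^ (p * s / 2) * (r / 4) ^ (-(p * s / 2)) = 4 ^ (p * s) * r ^ (-(p * s)) := by
      rw [← inv_div r 4, Real.inv_rpow (by positivity), ← Real.rpow_neg (by positivity),
        ← Real.rpow_add (by positivity), ← add_halves (p * s), show
        -(p * s / 2 + p * s / 2) = -(p * s / 2) + -(p * s / 2) by ring, div_eq_mul_inv r,
        Real.mul_rpow hr.le (by norm_num), Real.inv_rpow (by norm_num),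
        ← Real.rpow_neg (by norm_num)]
      rw [mul_comm]
      congr 2 <;> ring
    rw [hE, Real.mul_rpow (by norm_num) (by positivity), Real.mul_rpow hθ.le hM.le]
    calc _ = 4 ^ (p - 1) / (p * s / 2) * sphereMass n * (θ ^ (p - 1) * M ^ (p - 1)) *
          ((4 / r) ^ (p * s / 2) * (r / 4) ^ (-(p * s / 2))) := by ring
      _ = _ := by rw [this]; ring
  rw [split]
  have fin : (massConstant n s p - errorConstant n s p * θ ^ (p - 1)) *
      (M ^ (p - 1) * r ^ (-(p * s))) = massConstant n s p * (M ^ (p - 1) * r ^ (-(p * s))) -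
      (p - 1) * 12 ^ (p - 1) * (1 / 4) ^ (p - p * s) / (p - p * s) * sphereMass n *
      (θ ^ (p - 1) * M ^ (p - 1) * r ^ (-(p * s))) -
      4 ^ (p - 1) * 4 ^ (p * s) / (p * s / 2) * sphereMass n *
        (θ ^ (p - 1) * M ^ (p - 1) * r ^ (-(p * s))) := by
    rw [errorConstant]; ring
  rw [fin]
  linarith

end Barrier

/-! ### The growth lemma -/

section Growth

variable {n : ℕ}

lemma massConstant_pos {s p : ℝ} : 0 < massConstant n s p := by
  have := volume_unit_ball_pos (n := n)
  unfold massConstant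
  positivity

lemma exists_barrier_parameter (n : ℕ) (s : ℝ) {p : ℝ} (hp : 2 < p) :
    ∃ θ : ℝ, 0 < θ ∧ θ ≤ 1 / 16 ∧
      massConstant n s p / 2 ≤ massConstant n s p - errorConstant n s p * θ ^ (p - 1) := by
  have hm := massConstant_pos (n := n) (s := s) (p := p)
  have h1 : ContinuousAt (fun θ : ℝ => errorConstant n s p * θ ^ (p - 1)) 0 := by
    have : ContinuousAt (fun θ : ℝ => θ ^ (p - 1)) 0 :=
      Real.continuousAt_rpow_const _ _ (Or.inr (by linarith))
    fun_prop
  have h2 := h1.tendsto.mono_left (nhdsWithin_le_nhds (s := Set.Ioi 0))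
  rw [Real.zero_rpow (by linarith), mul_zero] at h2
  obtain ⟨θ, h3, h4⟩ := ((h2.eventually (gt_mem_nhds (half_pos hm))).and
    (Ioo_mem_nhdsGT (by norm_num : (0 : ℝ) < 1 / 16))).exists
  exact ⟨θ, h4.1, h4.2.le, by linarith⟩

lemma TailIntegrable.sub_bounded {s p C : ℝ} (hp : 1 < p) (hps : 0 < p * s)
    {u w : EuclideanSpace ℝ (Fin n) → ℝ} (hu : TailIntegrable s p u) (hwm : Measurable w)
    (hw : ∀ y, |w y| ≤ C) : TailIntegrable s p (fun y => u y - w y) := by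
  refine ⟨hu.1.sub hwm, (hu.dominating hps (2 ^ (p - 1)) (C ^ (p - 1))).mono'
    (((hu.1.sub hwm).abs.pow_const _).mul
      ((measurable_const.add measurable_norm).pow_const _)).aestronglyMeasurable
    (ae_of_all _ fun y => ?_)⟩
  have h1 := abs_signedPow_sub_le_add hp (u y) (w y)
  rw [abs_signedPow hp] at h1
  have h2 := Real.rpow_le_rpow (abs_nonneg _) (hw y) (by linarith : 0 ≤ p - 1)
  rw [Real.norm_of_nonneg (by positivity), ← add_mul, ← mul_assoc]
  exact mul_le_mul_of_nonneg_right
    (h1.trans (mul_le_mul_of_nonneg_left (by linarith) (by positivity))) (by positivity)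

/-- The part of `u` above the quadratic barrier in a ball. -/
noncomputable def excess (u : EuclideanSpace ℝ (Fin n) → ℝ) (x₀ : EuclideanSpace ℝ (Fin n))
    (r m M θ : ℝ) : EuclideanSpace ℝ (Fin n) → ℝ :=
  (Metric.ball x₀ r).indicator fun y => max (u y - quadBarrier x₀ r m M θ y) 0

section Excess

variable {u : EuclideanSpace ℝ (Fin n) → ℝ} {x₀ x y : EuclideanSpace ℝ (Fin n)} {r m M θ : ℝ}

lemma excess_nonneg : 0 ≤ excess u x₀ r m M θ y :=
  Set.indicator_nonneg (fun _ _ => le_max_right _ _) _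

lemma excess_of_mem (h : y ∈ Metric.ball x₀ r) :
    excess u x₀ r m M θ y = max (u y - quadBarrier x₀ r m M θ y) 0 := Set.indicator_of_mem h _

lemma excess_of_notMem (h : y ∉ Metric.ball x₀ r) :
    excess u x₀ r m M θ y = 0 := Set.indicator_of_notMem h _

lemma excess_pos_iff : 0 < excess u x₀ r m M θ y ↔
    y ∈ Metric.ball x₀ r ∧ quadBarrier x₀ r m M θ y < u y := by
  by_cases h : y ∈ Metric.ball x₀ r
  · rw [excess_of_mem h]; simp [h]
  · rw [excess_of_notMem h]; simp [h]

lemma sub_excess_eq (h : 0 < excess u x₀ r m M θ y) :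
    u y - excess u x₀ r m M θ y = quadBarrier x₀ r m M θ y := by
  obtain ⟨h1, h2⟩ := excess_pos_iff.1 h
  rw [excess_of_mem h1, max_eq_left (by linarith)]
  ring

lemma measurable_excess (hu : Measurable u) : Measurable (excess u x₀ r m M θ) :=
  ((hu.sub continuous_quadBarrier.measurable).max measurable_const).indicator
    Metric.isOpen_ball.measurableSet

lemma excess_le (hM : 0 < M) (hθ : 0 < θ) (hu : ∀ y ∈ Metric.ball x₀ r, u y ≤ m + M) :
    excess u x₀ r m M θ y ≤ 2 * θ * M := by
  by_cases h : y ∈ Metric.ball x₀ r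
  · rw [excess_of_mem h]
    have h1 := hu y h
    have h2 := le_quadBarrier (x₀ := x₀) (r := r) (m := m) hM.le hθ.le y
    exact max_le (by nlinarith) (by positivity)
  · rw [excess_of_notMem h]; positivity

/-- Beyond `3 / 4 * r` the barrier exceeds `m + M * (1 + θ / 4)`, hence `u`. -/
lemma norm_sub_le_of_excess_pos (hr : 0 < r) (hM : 0 < M) (hθ : 0 < θ)
    (hu : ∀ y ∈ Metric.ball x₀ r, u y ≤ m + M) (h : 0 < excess u x₀ r m M θ y) :
    ‖y - x₀‖ ≤ 3 / 4 * r := by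
  obtain ⟨h1, h2⟩ := excess_pos_iff.1 h
  have h3 := hu y h1
  by_contra! h4
  have h5 : (3 / 4 * r) ^ 2 < ‖y - x₀‖ ^ 2 := by gcongr
  have h6 : 4 * θ * M / r ^ 2 * (3 / 4 * r) ^ 2 ≤ 4 * θ * M / r ^ 2 * ‖y - x₀‖ ^ 2 := by gcongr
  rw [show 4 * θ * M / r ^ 2 * (3 / 4 * r) ^ 2 = 9 / 4 * (θ * M) by field_simp; ring] at h6
  unfold quadBarrier at h2
  nlinarith [mul_pos hθ hM]

/-- Where the excess is positive, `u` is above the barrier and so above the level `ε`. Increments of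
the excess are thus those of `(u - ε)⁺` up to increments of the barrier. If `y` leaves the ball,
then `‖x - y‖ ≥ r / 4` and the Lipschitz term alone covers the largest possible excess `2 * θ * M`.
-/
lemma excess_sub_le (hr : 0 < r) (hM : 0 < M) (hθ : 0 < θ)
    (hu : ∀ y ∈ Metric.ball x₀ r, u y ≤ m + M) {ε : ℝ} (hε : ε ≤ m + M * (1 - 2 * θ))
    (hx : 0 < excess u x₀ r m M θ x) :
    excess u x₀ r m M θ x - excess u x₀ r m M θ y ≤
      |max (u x - ε) 0 - max (u y - ε) 0| + 8 * θ * M * min 1 (‖x - y‖ / r) := by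
  obtain ⟨hxb, hxu⟩ := excess_pos_iff.1 hx
  have hx2 := sub_excess_eq hx
  have hx3 := norm_sub_le_of_excess_pos hr hM hθ hu hx
  have hbx := le_quadBarrier (x₀ := x₀) (r := r) (m := m) hM.le hθ.le x
  have hby := le_quadBarrier (x₀ := x₀) (r := r) (m := m) hM.le hθ.le y
  have habs := abs_nonneg (max (u x - ε) 0 - max (u y - ε) 0)
  have hθM := mul_pos hθ hM
  by_cases hyb : y ∈ Metric.ball x₀ r
  · have hyr : ‖y - x₀‖ ≤ r := by rw [← dist_eq_norm]; exact (Metric.mem_ball.1 hyb).le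
    have h1 := abs_quadBarrier_sub_le (m := m) hr hM.le hθ.le (by linarith : ‖x - x₀‖ ≤ r) hyr
    have h2 : |quadBarrier x₀ r m M θ x - quadBarrier x₀ r m M θ y| ≤
        8 * θ * M * min 1 (‖x - y‖ / r) := by
      rcases min_cases 1 (‖x - y‖ / r) with ⟨e, -⟩ | ⟨e, -⟩
      · rw [e, mul_one]
        have h3 : quadBarrier x₀ r m M θ x ≤ m + M * (1 - 2 * θ) + 4 * θ * M * 1 ^ 2 :=
          quadBarrier_le hr hM.le hθ.le (by linarith)
        have h4 : quadBarrier x₀ r m M θ y ≤ m + M * (1 - 2 * θ) + 4 * θ * M * 1 ^ 2 :=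
          quadBarrier_le hr hM.le hθ.le (by linarith)
        exact abs_le.2 ⟨by nlinarith, by nlinarith⟩
      · rw [e, ← mul_div_assoc, ← div_mul_eq_mul_div]
        exact h1
    have h5 := neg_le_of_abs_le h2
    have h6 := le_abs_self (max (u x - ε) 0 - max (u y - ε) 0)
    rw [max_eq_left (by linarith : 0 ≤ u x - ε)] at h6 ⊢
    have h7 : max (u y - ε) 0 ≤ excess u x₀ r m M θ y + quadBarrier x₀ r m M θ y - ε := by
      rw [excess_of_mem hyb]
      have h8 := le_max_left (u y - quadBarrier x₀ r m M θ y) 0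
      have h9 := le_max_right (u y - quadBarrier x₀ r m M θ y) 0
      exact max_le (by linarith) (by linarith)
    linarith
  · rw [excess_of_notMem hyb, sub_zero]
    have h1 : r / 4 ≤ ‖x - y‖ := by
      have h2 : r ≤ ‖y - x₀‖ := by
        rw [← dist_eq_norm]; exact not_lt.1 hyb
      have h3 := norm_add_le (y - x) (x - x₀)
      rw [sub_add_sub_cancel, norm_sub_rev y x] at h3
      linarith
    have h2 : 1 / 4 ≤ min 1 (‖x - y‖ / r) := by
      refine le_min (by norm_num) ?_
      rw [le_div_iff₀ hr]; linarith
    have h3 := excess_le (y := x) hM hθ hu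
    have h4 := mul_le_mul_of_nonneg_left h2 (by positivity : 0 ≤ 8 * θ * M)
    linarith

lemma abs_excess_sub_le {Ω : Set (EuclideanSpace ℝ (Fin n))} (hr : 0 < r) (hM : 0 < M) (hθ : 0 < θ)
    (hu : ∀ y ∈ Metric.ball x₀ r, u y ≤ m + M) {ε : ℝ} (hε : ε ≤ m + M * (1 - 2 * θ))
    (hΩ : ∀ x, 0 < excess u x₀ r m M θ x → x ∈ Ω) (x y : EuclideanSpace ℝ (Fin n)) :
    |excess u x₀ r m M θ x - excess u x₀ r m M θ y| ≤
      |max (u x - ε) 0 - max (u y - ε) 0| + 8 * θ * M * min 1 (‖x - y‖ / r) *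
        (Ω.indicator (fun _ => 1) x + Ω.indicator (fun _ => 1) y) := by
  have ind : ∀ z, 0 ≤ Ω.indicator (fun _ => (1 : ℝ)) z := fun z =>
    Set.indicator_nonneg (fun _ _ => zero_le_one) _
  have hmin : 0 ≤ 8 * θ * M * min 1 (‖x - y‖ / r) :=
    mul_nonneg (by positivity) (le_min zero_le_one (by positivity))
  have habs := abs_nonneg (max (u x - ε) 0 - max (u y - ε) 0)
  have key : ∀ a b : EuclideanSpace ℝ (Fin n), ‖a - b‖ = ‖x - y‖ →
      |max (u a - ε) 0 - max (u b - ε) 0| = |max (u x - ε) 0 - max (u y - ε) 0| →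
      Ω.indicator (fun _ => (1 : ℝ)) a ≤
        Ω.indicator (fun _ => (1 : ℝ)) x + Ω.indicator (fun _ => (1 : ℝ)) y →
      excess u x₀ r m M θ a - excess u x₀ r m M θ b ≤
      |max (u x - ε) 0 - max (u y - ε) 0| + 8 * θ * M * min 1 (‖x - y‖ / r) *
        (Ω.indicator (fun _ => 1) x + Ω.indicator (fun _ => 1) y) := by
    intro a b h1 h2 h3
    rcases (excess_nonneg (u := u) (x₀ := x₀) (y := a) (r := r) (m := m) (M := M)
      (θ := θ)).eq_or_lt with h | h
    · rw [← h]
      have := excess_nonneg (u := u) (x₀ := x₀) (y := b) (r := r) (m := m) (M := M) (θ := θ)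
      have h4 := mul_nonneg hmin (add_nonneg (ind x) (ind y))
      linarith
    · have h4 := excess_sub_le (y := b) hr hM hθ hu hε h
      rw [Set.indicator_of_mem (hΩ a h)] at h3
      rw [h1, h2] at h4
      have h5 := mul_le_mul_of_nonneg_left h3 hmin
      linarith
  refine abs_le.2 ⟨?_, key x y rfl rfl (by linarith [ind y])⟩
  have := key y x (norm_sub_rev _ _) (abs_sub_comm _ _) (by linarith [ind x])
  linarith

end Excess

/-- Improvement of the upper bound of a subsolution that is small on a fixed fraction of a ball. -/
def GrowthProperty (n : ℕ) (s p θ κ : ℝ) : Prop :=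
  ∀ (Ω : Set (EuclideanSpace ℝ (Fin n))) (u : EuclideanSpace ℝ (Fin n) → ℝ) (B : ℝ),
      IsOpen Ω → Bornology.IsBounded Ω → ExteriorTangentSphere Ω → IsSubsolution s p B Ω u →
    ∀ (x₀ : EuclideanSpace ℝ (Fin n)) (r m M : ℝ), 0 < r → 0 < M →
      (Metric.ball x₀ r ⊆ Ω ∨ 0 ≤ m) → B < κ * (M ^ (p - 1) * r ^ (-(p * s))) →
      (∀ y ∈ Metric.ball x₀ r, u y ≤ m + M) →
      (∀ y ∉ Metric.ball x₀ r,
        u y ≤ m + M * (1 + θ * (‖y - x₀‖ / r) ^ (p * s / (2 * (p - 1))))) →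
      ENNReal.ofReal ((1 / 2) ^ n) * volume (Metric.ball x₀ r) ≤
        volume {y ∈ Metric.ball x₀ r | u y ≤ m} →
      ∀ y ∈ Metric.ball x₀ (r / 2), u y ≤ m + (1 - θ) * M

/-- If `u` exceeded the barrier in the half ball, `u - excess` would be a strict supersolution
wherever the excess is positive. This is excluded at a maximum point in the interior case and by
weak comparison in the boundary case. -/
theorem exists_growth_constants (hn : 1 ≤ n) {s p : ℝ} (hp : 2 < p) (hs0 : 0 < s) (hs1 : s < 1) :
    ∃ θ κ : ℝ, 0 < θ ∧ θ ≤ 1 / 16 ∧ 0 < κ ∧ GrowthProperty n s p θ κ := by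
  obtain ⟨θ, hθ, hθ1, hκ⟩ := exists_barrier_parameter n s hp
  have hps : 0 < p * s := by positivity
  refine ⟨θ, massConstant n s p / 2, hθ, hθ1, half_pos massConstant_pos, ?_⟩
  intro Ω u B ho hb hs hu x₀ r m M hr hM hcase hB hin hout hD y₀ hy₀
  have hθM := mul_pos hθ hM
  set B' := massConstant n s p / 2 * (M ^ (p - 1) * r ^ (-(p * s)))
  set b := quadBarrier x₀ r m M θ with hbdef
  have hhalf : Metric.ball x₀ (r / 2) ⊆ Metric.ball x₀ r := Metric.ball_subset_ball (by linarith)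
  suffices h : u y₀ ≤ b y₀ by
    have h1 : b y₀ ≤ m + M * (1 - 2 * θ) + 4 * θ * M * (1 / 2) ^ 2 := by
      refine quadBarrier_le hr hM.le hθ.le ?_
      rw [← dist_eq_norm]
      have := Metric.mem_ball.1 hy₀
      linarith
    linarith
  by_contra! hlt
  set w := excess u x₀ r m M θ with hw
  have hwy₀ : 0 < w y₀ := excess_pos_iff.2 ⟨hhalf hy₀, hlt⟩
  have hwm : Measurable w := measurable_excess hu.tail.1
  have hw0 : ∀ y, 0 ≤ w y := fun y => excess_nonneg
  have hv : TailIntegrable s p (fun y => u y - w y) :=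
    hu.tail.sub_bounded (by linarith) hps hwm (C := 2 * θ * M) fun y => by
      rw [abs_of_nonneg (hw0 y)]; exact excess_le hM hθ hin
  have hH : ∀ ε, 0 < ε → ε < r * (1 / 2) ^ n / 4 → ∀ x, 0 < w x →
      B' ≤ truncFracPLap s p (fun y => u y - w y) x ε := by
    intro ε hε hε1 x hx
    refine le_trans ?_ (barrier_lower_bound hn hp hs0 hs1 hr hM hθ hθ1 hv (m := m) ?_ ?_ ?_
      (norm_sub_le_of_excess_pos hr hM hθ hin hx) (sub_excess_eq hx) hε hε1)
    · exact mul_le_mul_of_nonneg_right hκ (by positivity)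
    · intro y hy
      have := le_max_left (u y - b y) 0
      rw [hw, excess_of_mem hy]
      linarith
    · intro y hy
      have := hw0 y
      linarith [hout y hy]
    · refine hD.trans (measure_mono fun y hy => ⟨hy.1, ?_⟩)
      have h1 := hw0 y
      have h2 : u y ≤ m := hy.2
      show u y - w y ≤ m
      linarith
  have hε0 : 0 < r * (1 / 2) ^ n / 4 := by positivity
  rcases hcase with hint | hm
  · have hsub : Metric.closedBall x₀ (3 / 4 * r) ⊆ Metric.ball x₀ r :=
      Metric.closedBall_subset_ball (by linarith)
    have hmemS : ∀ y, 0 < w y → y ∈ Metric.closedBall x₀ (3 / 4 * r) := fun y hy => by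
      rw [Metric.mem_closedBall, dist_eq_norm]
      exact norm_sub_le_of_excess_pos hr hM hθ hin hy
    -- The excess is positive only in a smaller closed ball, on which `u - b` is continuous, so a
    -- maximum is attained.
    obtain ⟨x₁, hx₁, hmax⟩ := (isCompact_closedBall x₀ (3 / 4 * r)).exists_isMaxOn ⟨y₀, hmemS y₀ hwy₀⟩
      ((hu.cont.mono (hsub.trans hint)).sub
        (continuous_quadBarrier (x₀ := x₀) (r := r) (m := m) (M := M) (θ := θ)).continuousOn)
    have hle : ∀ y, w y ≤ w x₁ := by
      intro y
      rcases (hw0 y).eq_or_lt with h | h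
      · rw [← h]; exact hw0 x₁
      · have h1 : u y - b y ≤ u x₁ - b x₁ := hmax (hmemS y h)
        have h2 := le_max_left (u x₁ - b x₁) 0
        have h3 := sub_excess_eq h
        have h4 : w x₁ = max (u x₁ - b x₁) 0 := excess_of_mem (hsub hx₁)
        rw [h4]
        linarith
    have hwx₁ : 0 < w x₁ := hwy₀.trans_le (hle y₀)
    have hx₁Ω : x₁ ∈ Ω := hint (hsub hx₁)
    obtain ⟨ε, hε1, hε2⟩ := ((hu.upper {x₁} (by simpa using hx₁Ω) isCompact_singleton
      ((B' - B) / 2) (by linarith)).and (Ioo_mem_nhdsGT hε0)).exists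
    have h1 := hε1 x₁ rfl
    have h2 := hH ε hε2.1 hε2.2 x₁ hwx₁
    -- At a maximum of `w` every increment of `u - w` from `x₁` is at most that of `u`, already
    -- before `ε` tends to zero.
    have h3 : truncFracPLap s p (fun y => u y - w y) x₁ ε ≤ truncFracPLap s p u x₁ ε := by
      rw [truncFracPLap_eq, truncFracPLap_eq]
      refine setIntegral_mono (hv.integrableOn hp hps x₁ _ hε2.1)
        (hu.tail.integrableOn hp hps x₁ _ hε2.1) fun y => ?_
      refine div_le_div_of_nonneg_right (signedPow_mono (by linarith) ?_) (by positivity)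
      linarith [hle y]
    linarith
  -- As `m ≥ 0` the barrier is bounded below by a positive level. Hence the excess vanishes outside
  -- `Ω`, and its seminorm is controlled by the truncation of `u` at that level.
  · have hc : 0 < M * (1 - 2 * θ) := mul_pos hM (by linarith)
    have hbpos : ∀ y, M * (1 - 2 * θ) ≤ b y := fun y => by
      have := le_quadBarrier (x₀ := x₀) (r := r) (m := m) hM.le hθ.le y
      linarith
    have hΩw : ∀ x, 0 < w x → x ∈ Ω := by
      intro x hx
      by_contra h
      have h1 := (excess_pos_iff.1 hx).2
      rw [hu.zero_outside x h] at h1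
      linarith [hbpos x]
    have hwu : ∀ x, w x ≤ |u x| := by
      intro x
      rcases (hw0 x).eq_or_lt with h | h
      · rw [← h]; exact abs_nonneg _
      · have h1 := sub_excess_eq h
        have h2 := le_abs_self (u x)
        have h3 : M * (1 - 2 * θ) ≤ quadBarrier x₀ r m M θ x := hbpos x
        linarith
    have hG : FiniteGagliardo s p w :=
      (hu.gagliardo _ hc).of_le hn (by linarith) hs0 hs1 ho hb hr
        (by positivity : 0 ≤ 8 * θ * M) ((hu.tail.1.sub measurable_const).max measurable_const) hwm
        (abs_excess_sub_le hr hM hθ hin (by linarith) hΩw)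
    have hLip : ∀ x y, 0 < w x → 0 < w y →
        |(u x - w x) - (u y - w y)| ≤ 8 * θ * M / r * ‖x - y‖ := by
      intro x y hx hy
      rw [sub_excess_eq hx, sub_excess_eq hy]
      have h1 := norm_sub_le_of_excess_pos hr hM hθ hin hx
      have h2 := norm_sub_le_of_excess_pos hr hM hθ hin hy
      exact abs_quadBarrier_sub_le hr hM.le hθ.le (by linarith) (by linarith)
    have hae := hu.ae_eq_zero hn hp hs0 hs1 ho hb hs hwm hw0 hwu hG (by positivity) hLip hB (by
      filter_upwards [Ioo_mem_nhdsGT hε0] with ε hε x hx using hH ε hε.1 hε.2 x hx)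
    -- Weak comparison gives zero only almost everywhere; continuity in `Ω` makes the set of
    -- positive excess open, so it must be empty.
    have hopen : IsOpen (Ω ∩ (Metric.ball x₀ r ∩ {y | 0 < u y - b y})) := by
      have h1 : IsOpen (Ω ∩ {y | 0 < u y - b y}) :=
        (hu.cont.sub continuous_quadBarrier.continuousOn).isOpen_inter_preimage ho isOpen_Ioi
      rw [Set.inter_left_comm]
      exact Metric.isOpen_ball.inter h1
    have hpos := hopen.measure_pos volume ⟨y₀, hΩw _ hwy₀, hhalf hy₀, sub_pos.2 hlt⟩
    refine hpos.ne' (measure_mono_null ?_ (ae_iff.1 hae))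
    intro y hy h
    have : 0 < w y := excess_pos_iff.2 ⟨hy.2.1, sub_pos.1 hy.2.2⟩
    exact this.ne' h

end Growth

/-! ### Boundedness and decay at the boundary -/

section Regularity

variable {n : ℕ} {Ω : Set (EuclideanSpace ℝ (Fin n))}

/-- Subsolutions are bounded above. -/
theorem IsSubsolution.exists_le (hn : 1 ≤ n) {s p B : ℝ} (hp : 2 < p) (hs0 : 0 < s)
    (hs1 : s < 1) (ho : IsOpen Ω) (hb : Bornology.IsBounded Ω) (hs : ExteriorTangentSphere Ω)
    {u : EuclideanSpace ℝ (Fin n) → ℝ} (hu : IsSubsolution s p B Ω u) :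
    ∃ M : ℝ, 0 < M ∧ ∀ x, u x ≤ M := by
  have hps : 0 < p * s := by positivity
  obtain ⟨D, hD, hdiam⟩ := exists_diam_bound hb
  -- A ball of radius `R` about any point of `Ω` contains `Ω`. Outside it `u = 0`, so a truncation
  -- at height `M` has operator at least `M ^ (p - 1) * c` where it equals `M`; the choice of `M`
  -- makes this exceed `B`.
  set R := D + 1
  have hR : 0 < R := by positivity
  set c := sphereMass n * (R ^ (-(p * s)) / (p * s)) with hc
  have hc0 : 0 < c := by
    have := sphereMass_pos hn
    positivity
  set M := max 1 (B / c + 1)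
  have hM1 : 1 ≤ M := le_max_left _ _
  have hM0 : 0 < M := by linarith
  have hB : B < M ^ (p - 1) * c := by
    have h1 : M ≤ M ^ (p - 1) := by
      have := Real.rpow_le_rpow_of_exponent_le hM1 (by linarith : 1 ≤ p - 1)
      rwa [Real.rpow_one] at this
    have h2 : B / c + 1 ≤ M := le_max_right _ _
    have h3 : B / c < M ^ (p - 1) := by linarith
    rwa [div_lt_iff₀ hc0] at h3
  refine ⟨M, hM0, ?_⟩
  set w : EuclideanSpace ℝ (Fin n) → ℝ := fun y => max (u y - M) 0 with hw
  have hwm : Measurable w := (hu.tail.1.sub measurable_const).max measurable_const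
  have hw0 : ∀ y, 0 ≤ w y := fun y => le_max_right _ _
  have hpos : ∀ y, 0 < w y ↔ M < u y := fun y => by simp [hw]
  have heq : ∀ y, 0 < w y → u y - w y = M := fun y hy => by
    have := (hpos y).1 hy
    simp only [hw]
    rw [max_eq_left (by linarith)]
    ring
  have hvM : ∀ y, u y - w y ≤ M := fun y => by
    have := le_max_left (u y - M) 0
    simp only [hw]
    linarith
  have hwu : ∀ y, w y ≤ |u y| := fun y =>
    max_le (by linarith [le_abs_self (u y)]) (abs_nonneg _)
  have hv : TailIntegrable s p (fun y => u y - w y) :=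
    hu.tail.mono (by linarith) zero_le_two (hu.tail.1.sub hwm) fun y => by
      have := abs_sub (u y) (w y)
      rw [abs_of_nonneg (hw0 y)] at this
      linarith [hwu y]
  have hae := hu.ae_eq_zero hn hp hs0 hs1 ho hb hs hwm hw0 hwu (hu.gagliardo M hM0) le_rfl
    (fun x y hx hy => by simp [heq x hx, heq y hy]) hB (by
      filter_upwards [Ioo_mem_nhdsGT hR] with ε hε x hx
      have hxΩ : x ∈ Ω := by
        by_contra h
        have := (hpos x).1 hx
        rw [hu.zero_outside x h] at this
        linarith
      have hi := hv.integrableOn hp hps x (u x - w x) hε.1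
      have hsub : (Metric.ball x R)ᶜ ⊆ (Metric.ball x ε)ᶜ :=
        Set.compl_subset_compl.2 (Metric.ball_subset_ball hε.2.le)
      have h1 : ∫ y in (Metric.ball x R)ᶜ, M ^ (p - 1) * ‖y - x‖ ^ (-(p * s) - (n : ℝ)) =
          M ^ (p - 1) * c := by
        rw [integral_const_mul, hc, ← (radial_compl_ball hn hps hR).2,
          ← setIntegral_sub_left x (fun h => ‖h‖ ^ (-(p * s) - (n : ℝ))) _
            Metric.isOpen_ball.measurableSet.compl, ← compl_ball_eq_preimage]
      rw [truncFracPLap_eq, ← h1]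
      refine le_trans (le_of_eq ?_) (setIntegral_mono_set hi (ae_of_all _ fun y => ?_)
        (ae_of_all _ hsub))
      · refine setIntegral_congr_fun Metric.isOpen_ball.measurableSet.compl fun y hy => ?_
        have hyR : R ≤ ‖y - x‖ := by rw [← dist_eq_norm]; exact not_lt.1 hy
        have hyΩ : y ∉ Ω := fun h => by
          have := hdiam y h x hxΩ
          linarith
        have hwy : u y - w y = 0 := by
          simp only [hw]
          rw [hu.zero_outside y hyΩ, max_eq_right (by linarith), sub_zero]
        have hpos' : 0 < ‖y - x‖ := hR.trans_le hyR
        simp only [hwy, heq x hx, sub_zero]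
        rw [signedPow_of_nonneg (by linarith) hM0.le, norm_sub_rev x y, div_eq_mul_inv,
          ← Real.rpow_neg hpos'.le]
        congr 2
        ring
      · refine div_nonneg (signedPow_nonneg ?_) (by positivity)
        rw [heq x hx]
        linarith [hvM y])
  by_contra! h
  obtain ⟨x, hx⟩ := h
  have hxΩ : x ∈ Ω := by
    by_contra h
    rw [hu.zero_outside x h] at hx
    linarith
  have hopen : IsOpen (Ω ∩ {y | M < u y}) := hu.cont.isOpen_inter_preimage ho isOpen_Ioi
  refine (hopen.measure_pos volume ⟨x, hxΩ, hx⟩).ne' (measure_mono_null ?_ (ae_iff.1 hae))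
  intro y hy h
  exact ((hpos y).2 hy.2).ne' h

/-- Concave Bernoulli inequality for `x ^ ν = (x ^ μ) ^ (ν / μ)`. -/
lemma rpow_le_one_add_mul {x ν μ : ℝ} (hx : 0 < x) (hν : 0 ≤ ν) (hμ : 0 < μ) (h : ν ≤ μ) :
    x ^ ν ≤ 1 + ν / μ * x ^ μ := by
  have hx' := Real.rpow_nonneg hx.le μ
  have h1 := rpow_one_add_le_one_add_mul_self (s := x ^ μ - 1) (by linarith) (p := ν / μ)
    (by positivity) (by rwa [div_le_one hμ])
  rw [add_sub_cancel, ← Real.rpow_mul hx.le, mul_div_cancel₀ _ hμ.ne'] at h1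
  have h2 : 0 ≤ ν / μ := by positivity
  linarith

/-- The first condition lets the gain of the growth lemma survive halving the radius. The second
makes the Hölder bound inherited from larger scales an admissible tail. Both hold for `ν` near zero.
-/
lemma exists_holder_exponent {s θ μ : ℝ} (hs : 0 < s) (hθ : 0 < θ) (hμ : 0 < μ) :
    ∃ ν : ℝ, 0 < ν ∧ ν < s ∧ (1 - θ / 2) * 4 ^ ν ≤ 1 ∧
      ∀ t : ℝ, 1 ≤ t → (4 * t) ^ ν ≤ 1 + θ / 2 * t ^ μ := by
  have h1 : Tendsto (fun ν : ℝ => (1 - θ / 2) * 4 ^ ν) (𝓝[>] 0) (𝓝 (1 - θ / 2)) := by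
    have : ContinuousAt (fun ν : ℝ => (1 - θ / 2) * 4 ^ ν) 0 := by
      have : ContinuousAt (fun ν : ℝ => (4 : ℝ) ^ ν) 0 :=
        Real.continuousAt_const_rpow (by norm_num)
      fun_prop
    simpa using this.tendsto.mono_left (nhdsWithin_le_nhds (s := Set.Ioi 0))
  have h2 : Tendsto (fun ν : ℝ => ν / μ * 4 ^ μ) (𝓝[>] 0) (𝓝 0) := by
    have : ContinuousAt (fun ν : ℝ => ν / μ * 4 ^ μ) 0 := by fun_prop
    simpa using this.tendsto.mono_left (nhdsWithin_le_nhds (s := Set.Ioi 0))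
  obtain ⟨ν, e1, e2, e3⟩ := ((h1.eventually (gt_mem_nhds (by linarith : 1 - θ / 2 < 1))).and
    ((h2.eventually (gt_mem_nhds (half_pos hθ))).and
      (Ioo_mem_nhdsGT (lt_min hs hμ)))).exists
  refine ⟨ν, e3.1, e3.2.trans_le (min_le_left _ _), e1.le, fun t ht => ?_⟩
  have ht0 : 0 < t := by linarith
  refine (rpow_le_one_add_mul (by positivity) e3.1.le hμ (e3.2.le.trans (min_le_right _ _))).trans ?_
  rw [Real.mul_rpow (by norm_num) ht0.le, ← mul_assoc]
  have := Real.rpow_nonneg ht0.le μ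
  gcongr

/-- With `M ≥ C * r ^ ν` the natural scale is at least `C ^ (p - 1) * r ^ e`. The exponent `e` is
nonpositive because `ν < s`, so the smallest value is at `r = R`. -/
lemma exists_scale_constant {s p κ ν R : ℝ} (B : ℝ) (hp : 2 < p) (hκ : 0 < κ)
    (hs0 : 0 < s) (hνs : ν < s) (hR : 0 < R) :
    ∃ C : ℝ, 1 ≤ C ∧ ∀ r M, 0 < r → r ≤ R → C * r ^ ν ≤ M →
      B < κ * (M ^ (p - 1) * r ^ (-(p * s))) := by
  set e := ν * (p - 1) - p * s with he
  have he0 : e ≤ 0 := by nlinarith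
  have hRe : 0 < R ^ e := Real.rpow_pos_of_pos hR e
  refine ⟨max 1 (B / (κ * R ^ e) + 1), le_max_left _ _, fun r M hr hrR hM => ?_⟩
  set C := max 1 (B / (κ * R ^ e) + 1)
  have hC1 : 1 ≤ C := le_max_left _ _
  have hC0 : 0 < C := by linarith
  have h1 : C ≤ C ^ (p - 1) := by
    have := Real.rpow_le_rpow_of_exponent_le hC1 (by linarith : 1 ≤ p - 1)
    rwa [Real.rpow_one] at this
  have h2 : B / (κ * R ^ e) < C ^ (p - 1) := by
    have : B / (κ * R ^ e) + 1 ≤ C := le_max_right _ _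
    linarith
  rw [div_lt_iff₀ (by positivity)] at h2
  have h3 : R ^ e ≤ r ^ e := Real.rpow_le_rpow_of_nonpos hr hrR he0
  have h4 : (C * r ^ ν) ^ (p - 1) ≤ M ^ (p - 1) :=
    Real.rpow_le_rpow (by positivity) hM (by linarith)
  rw [Real.mul_rpow hC0.le (by positivity), ← Real.rpow_mul hr.le] at h4
  calc B < C ^ (p - 1) * (κ * R ^ e) := h2
    _ ≤ C ^ (p - 1) * (κ * r ^ e) := by gcongr
    _ = κ * (C ^ (p - 1) * r ^ (ν * (p - 1)) * r ^ (-(p * s))) := by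
        rw [he, sub_eq_add_neg (ν * (p - 1)), Real.rpow_add hr]; ring
    _ ≤ _ := by gcongr

lemma exists_halving_le {R a : ℝ} (ha : 0 < a) : ∃ k : ℕ, R / 2 ^ k ≤ a := by
  have h : Tendsto (fun k : ℕ => R * (1 / 2 : ℝ) ^ k) atTop (𝓝 (R * 0)) :=
    (tendsto_pow_atTop_nhds_zero_of_lt_one (by norm_num) (by norm_num)).const_mul R
  rw [mul_zero] at h
  obtain ⟨k, hk⟩ := (h.eventually (gt_mem_nhds ha)).exists
  exact ⟨k, by rw [div_eq_mul_one_div, ← one_div_pow]; exact hk.le⟩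

lemma two_mul_rpow_eq {r ν : ℝ} (hr : 0 < r) : (2 * r) ^ ν = 4 ^ ν * (r / 2) ^ ν := by
  rw [← Real.mul_rpow (by norm_num) (by positivity)]
  congr 1; ring

/-- Hölder decay of subsolutions at the boundary. -/
theorem IsSubsolution.boundary_decay (hn : 1 ≤ n) {s p B θ κ ν : ℝ} (hp : 2 < p) (hs0 : 0 < s)
    (hs1 : s < 1) (ho : IsOpen Ω) (hb : Bornology.IsBounded Ω) (hs : ExteriorTangentSphere Ω)
    {u : EuclideanSpace ℝ (Fin n) → ℝ} (hu : IsSubsolution s p B Ω u) (hθ : 0 < θ) (hκ : 0 < κ)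
    (hG : GrowthProperty n s p θ κ) (hν : 0 < ν) (hνs : ν < s) (hν4 : (1 - θ / 2) * 4 ^ ν ≤ 1)
    (hνt : ∀ t : ℝ, 1 ≤ t → (4 * t) ^ ν ≤ 1 + θ / 2 * t ^ (p * s / (2 * (p - 1)))) :
    ∃ C : ℝ, 0 < C ∧ ∀ x₀ ∈ frontier Ω, ∀ y, u y ≤ C * (2 * ‖y - x₀‖) ^ ν := by
  obtain ⟨M₀, hM₀, huM⟩ := hu.exists_le hn hp hs0 hs1 ho hb hs
  obtain ⟨ρ, hρ, hball⟩ := hs.exists_ball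
  obtain ⟨C₀, hC₀, hscale⟩ := exists_scale_constant B hp hκ hs0 hνs hρ (ν := ν)
  have hρν : 0 < ρ ^ ν := by positivity
  set C := max C₀ (M₀ / ρ ^ ν)
  have hCC₀ : C₀ ≤ C := le_max_left _ _
  have hC : 0 < C := by linarith
  refine ⟨C, hC, fun x₀ hx₀ => ?_⟩
  -- The maximum records in one formula the bound reached on the current ball and the growth outside
  -- it, which are the two hypotheses of the growth lemma.
  have step : ∀ k : ℕ, ∀ y, u y ≤ C * (max (ρ / 2 ^ k) (2 * ‖y - x₀‖)) ^ ν := by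
    intro k
    induction k with
    | zero =>
      intro y
      have h1 : M₀ ≤ C * ρ ^ ν := by
        have : M₀ / ρ ^ ν ≤ C := le_max_right _ _
        rwa [div_le_iff₀ hρν] at this
      refine (huM y).trans (h1.trans ?_)
      gcongr
      simp
    | succ k ih =>
      set r := ρ / 2 ^ k with hr
      have hr0 : 0 < r := by positivity
      have hrρ : r ≤ ρ := div_le_self hρ.le (one_le_pow₀ (by norm_num))
      have hr2 : ρ / 2 ^ (k + 1) = r / 2 := by rw [hr, pow_succ]; field_simp
      rw [hr2]
      set M := C * (2 * r) ^ ν with hM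
      have hM0 : 0 < M := by positivity
      have main := hG Ω u B ho hb hs hu x₀ r 0 M hr0 hM0 (Or.inr le_rfl)
        (hscale r M hr0 hrρ (by rw [hM]; gcongr; linarith)) ?_ ?_ ?_
      · intro y
        by_cases hy : y ∈ Metric.ball x₀ (r / 2)
        · refine (main y hy).trans ?_
          have h1 : C * (r / 2) ^ ν ≤ C * max (r / 2) (2 * ‖y - x₀‖) ^ ν := by
            gcongr
            exact le_max_left _ _
          refine le_trans ?_ h1
          rw [zero_add, hM, two_mul_rpow_eq hr0]
          have h2 : (1 - θ) * 4 ^ ν ≤ 1 := by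
            have : (0 : ℝ) ≤ 4 ^ ν := by positivity
            nlinarith
          calc (1 - θ) * (C * (4 ^ ν * (r / 2) ^ ν)) = ((1 - θ) * 4 ^ ν) * (C * (r / 2) ^ ν) := by ring
            _ ≤ 1 * (C * (r / 2) ^ ν) := by gcongr
            _ = _ := one_mul _
        · have h1 : r / 2 ≤ ‖y - x₀‖ := by rw [← dist_eq_norm]; exact not_lt.1 hy
          have h2 := ih y
          rw [max_eq_right (by linarith)] at h2 ⊢
          exact h2
      · intro y hy
        have h1 : ‖y - x₀‖ < r := by rw [← dist_eq_norm]; exact hy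
        refine (ih y).trans ?_
        rw [zero_add, hM]
        gcongr
        exact max_le (by linarith) (by linarith)
      · intro y hy
        have h1 : r ≤ ‖y - x₀‖ := by rw [← dist_eq_norm]; exact not_lt.1 hy
        have ht : 1 ≤ ‖y - x₀‖ / r := by rwa [one_le_div hr0]
        have h2 := ih y
        rw [max_eq_right (by linarith)] at h2
        rw [zero_add]
        refine h2.trans ?_
        have h3 : (2 * ‖y - x₀‖) ^ ν = (2 * r) ^ ν * (‖y - x₀‖ / r) ^ ν := by
          rw [← Real.mul_rpow (by positivity) (by positivity)]
          congr 1
          field_simp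
        rw [h3, ← mul_assoc]
        refine mul_le_mul_of_nonneg_left ?_ hM0.le
        have h4 : (‖y - x₀‖ / r) ^ ν ≤ (4 * (‖y - x₀‖ / r)) ^ ν := by
          gcongr
          linarith
        have h5 := hνt _ ht
        have h6 : 0 ≤ θ * (‖y - x₀‖ / r) ^ (p * s / (2 * (p - 1))) := by positivity
        linarith
      -- The exterior ball of radius `r / 2` tangent at `x₀` lies in the ball of radius `r`. It
      -- carries exactly the fraction `(1 / 2) ^ n`, and `u` vanishes on it.
      · obtain ⟨c, hc, hdis⟩ := hball x₀ hx₀ (r / 2) (by positivity) (by linarith)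
        have h1 : Metric.ball c (r / 2) ⊆ {y ∈ Metric.ball x₀ r | u y ≤ 0} := by
          intro y hy
          refine ⟨?_, (hu.zero_outside y (Set.disjoint_left.1 hdis hy)).le⟩
          rw [Metric.mem_ball] at hy ⊢
          linarith [dist_triangle y c x₀]
        refine le_trans (le_of_eq ?_) (measure_mono h1)
        rw [volume_ball_eq _ hr0, volume_ball_eq _ (by positivity : 0 < r / 2),
          ← ENNReal.ofReal_mul (by positivity), div_eq_mul_one_div r 2, mul_pow]
        congr 1
        ring
  intro y
  rcases (norm_nonneg (y - x₀)).eq_or_lt with h | h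
  · have hy : y = x₀ := by rw [← sub_eq_zero, ← norm_eq_zero]; exact h.symm
    have : x₀ ∉ Ω := by
      rw [ho.frontier_eq] at hx₀
      exact hx₀.2
    rw [hy, hu.zero_outside x₀ this]
    positivity
  · obtain ⟨k, hk⟩ := exists_halving_le (R := ρ) (by positivity : 0 < 2 * ‖y - x₀‖)
    have := step k y
    rwa [max_eq_right hk] at this

end Regularity

/-! ### Interior oscillation decay and the Hölder estimate -/

section Interior

variable {n : ℕ} {Ω : Set (EuclideanSpace ℝ (Fin n))}

/-- Improvement of the upper bound in an interior ball, in terms of the oscillation. -/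
lemma IsSubsolution.le_of_low_level {s p B θ κ ν : ℝ} (ho : IsOpen Ω) (hb : Bornology.IsBounded Ω)
    (hs : ExteriorTangentSphere Ω) {u : EuclideanSpace ℝ (Fin n) → ℝ}
    (hu : IsSubsolution s p B Ω u) (hG : GrowthProperty n s p θ κ)
    (hνt : ∀ t : ℝ, 1 ≤ t → (4 * t) ^ ν ≤ 1 + θ / 2 * t ^ (p * s / (2 * (p - 1))))
    {x₀ : EuclideanSpace ℝ (Fin n)} {r a b N : ℝ} (hr : 0 < r) (hball : Metric.ball x₀ r ⊆ Ω)
    (hN : 0 < N) (hab : N < b - a) (hB : B < κ * (((b - a) / 2) ^ (p - 1) * r ^ (-(p * s))))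
    (hin : ∀ y ∈ Metric.ball x₀ r, u y ≤ b)
    (hout : ∀ y ∉ Metric.ball x₀ r, u y ≤ a + N * (4 * (‖y - x₀‖ / r)) ^ ν)
    (hD : ENNReal.ofReal ((1 / 2) ^ n) * volume (Metric.ball x₀ r) ≤
      volume {y ∈ Metric.ball x₀ r | u y ≤ (a + b) / 2}) :
    ∀ y ∈ Metric.ball x₀ (r / 2), u y ≤ b - θ * ((b - a) / 2) := by
  have hM : 0 < (b - a) / 2 := by linarith
  have main := hG Ω u B ho hb hs hu x₀ r ((a + b) / 2) ((b - a) / 2) hr hM (Or.inl hball) hB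
    (fun y hy => by linarith [hin y hy]) (fun y hy => ?_) hD
  · intro y hy
    have := main y hy
    linarith
  · have h1 : r ≤ ‖y - x₀‖ := by rw [← dist_eq_norm]; exact not_lt.1 hy
    have ht : 1 ≤ ‖y - x₀‖ / r := by rwa [one_le_div hr]
    set t := ‖y - x₀‖ / r
    -- The tail is measured from `a`, at a distance `b - a` below the top, twice the `M` of the
    -- growth lemma; this is why `hνt` has `θ / 2`.
    have h2 : 0 ≤ (4 * t) ^ ν := by positivity
    have h3 : N * (4 * t) ^ ν ≤ (b - a) * (4 * t) ^ ν := by gcongr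
    have h4 := mul_le_mul_of_nonneg_left (hνt t ht) (by linarith : 0 ≤ b - a)
    have := hout y hy
    linarith

/-- Hölder regularity of functions that are sub- and supersolutions and decay at the boundary. -/
theorem IsSubsolution.holder (hn : 1 ≤ n) {s p B θ κ ν Cb : ℝ} (hp : 2 < p) (hs0 : 0 < s)
    (hs1 : s < 1) (ho : IsOpen Ω) (hb : Bornology.IsBounded Ω) (hs : ExteriorTangentSphere Ω)
    {u : EuclideanSpace ℝ (Fin n) → ℝ} (hu : IsSubsolution s p B Ω u)
    (hu' : IsSubsolution s p B Ω (fun x => -u x)) (hκ : 0 < κ)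
    (hG : GrowthProperty n s p θ κ) (hν : 0 < ν) (hνs : ν < s) (hν4 : (1 - θ / 2) * 4 ^ ν ≤ 1)
    (hνt : ∀ t : ℝ, 1 ≤ t → (4 * t) ^ ν ≤ 1 + θ / 2 * t ^ (p * s / (2 * (p - 1))))
    (hCb : 0 < Cb) (hbd : ∀ x₀ ∈ frontier Ω, ∀ y, |u y| ≤ Cb * (2 * ‖y - x₀‖) ^ ν) :
    ∃ C : ℝ, 0 < C ∧ ∀ x₀ ∈ Ω, ∀ y, |u y - u x₀| ≤ C * (2 * ‖y - x₀‖) ^ ν := by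
  obtain ⟨D, hD, hdiam⟩ := exists_diam_bound (hb.closure)
  obtain ⟨C₀, hC₀, hscale⟩ := exists_scale_constant B hp hκ hs0 hνs hD (ν := ν)
  have hν1 : ν ≤ 1 := by linarith
  -- The term `8 * Cb` starts the iteration from the boundary decay. The term `4 * C₀` makes half
  -- the target oscillation `N` large enough for the scale condition.
  set C := max (4 * C₀) (8 * Cb)
  have hCC₀ : 4 * C₀ ≤ C := le_max_left _ _
  have hCCb : 8 * Cb ≤ C := le_max_right _ _
  have hC : 0 < C := by linarith
  refine ⟨C, hC, fun x₀ hx₀ => ?_⟩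
  obtain ⟨z, hz, hzd⟩ := exists_frontier_dist_eq hn ho hb hx₀
  have hd := infDist_compl_pos hn ho hb hx₀
  have hballΩ : Metric.ball x₀ (Metric.infDist x₀ Ωᶜ) ⊆ Ω :=
    Set.disjoint_compl_right_iff_subset.1 Metric.disjoint_ball_infDist
  rw [← hzd] at hd hballΩ
  set d := dist x₀ z
  have hdD : d ≤ D := by
    have := hdiam x₀ (subset_closure hx₀) z (frontier_subset_closure hz)
    rwa [← dist_eq_norm] at this
  have step : ∀ k : ℕ, ∀ y y', |u y - u y'| ≤
      C * (max (d / 2 ^ k) (2 * max ‖y - x₀‖ ‖y' - x₀‖)) ^ ν := by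
    intro k
    induction k with
    | zero =>
      intro y y'
      set m := max (d / 2 ^ 0) (2 * max ‖y - x₀‖ ‖y' - x₀‖) with hm
      have hm0 : 0 < m := lt_max_of_lt_left (by positivity)
      have hdm : d ≤ m := by rw [hm]; simp
      -- At the first scale the ball about `x₀` reaches the boundary point `z`, so the values of `u`
      -- themselves are bounded by decay from `z`.
      have key : ∀ a, 2 * ‖a - x₀‖ ≤ m → |u a| ≤ 4 * Cb * m ^ ν := by
        intro a ha
        have h1 : ‖a - z‖ ≤ 2 * m := by
          have := dist_triangle a x₀ z
          rw [dist_eq_norm, dist_eq_norm a x₀] at this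
          linarith [norm_nonneg (a - x₀)]
        refine (hbd z hz a).trans ?_
        have h2 : (4 : ℝ) ^ ν ≤ 4 := by
          have := Real.rpow_le_rpow_of_exponent_le (by norm_num : (1 : ℝ) ≤ 4) hν1
          rwa [Real.rpow_one] at this
        calc Cb * (2 * ‖a - z‖) ^ ν ≤ Cb * (4 * m) ^ ν :=
              mul_le_mul_of_nonneg_left
                (Real.rpow_le_rpow (by positivity) (by linarith) hν.le) hCb.le
          _ = Cb * (4 ^ ν * m ^ ν) := by rw [Real.mul_rpow (by norm_num) hm0.le]
          _ ≤ Cb * (4 * m ^ ν) := by gcongr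
          _ = _ := by ring
      have h1 := key y (le_trans (by gcongr; exact le_max_left _ _) (le_max_right _ _))
      have h2 := key y' (le_trans (by gcongr; exact le_max_right _ _) (le_max_right _ _))
      have h3 := abs_sub (u y) (u y')
      have h4 : 8 * Cb * m ^ ν ≤ C * m ^ ν := by gcongr
      linarith
    | succ k ih =>
      set r := d / 2 ^ k with hr
      have hr0 : 0 < r := by positivity
      have hrd : r ≤ d := div_le_self hd.le (one_le_pow₀ (by norm_num))
      have hr2 : d / 2 ^ (k + 1) = r / 2 := by rw [hr, pow_succ]; field_simp
      rw [hr2]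
      have hball : Metric.ball x₀ r ⊆ Ω := (Metric.ball_subset_ball hrd).trans hballΩ
      have hmem : ∀ y ∈ Metric.ball x₀ r, ‖y - x₀‖ < r := fun y hy => by
        rw [← dist_eq_norm]; exact hy
      set N := C * (r / 2) ^ ν with hN
      have hN0 : 0 < N := by positivity
      have hx₀r : x₀ ∈ Metric.ball x₀ r := Metric.mem_ball_self hr0
      have osc : ∀ y ∈ Metric.ball x₀ r, ∀ y' ∈ Metric.ball x₀ r, u y - u y' ≤ 4 ^ ν * N := by
        intro y hy y' hy'
        refine (le_abs_self _).trans ((ih y y').trans ?_)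
        rw [hN, mul_left_comm, ← two_mul_rpow_eq hr0]
        have h1 := hmem y hy
        have h2 := hmem y' hy'
        gcongr
        refine max_le (by linarith) ?_
        gcongr
        exact max_le h1.le h2.le
      have oscOut : ∀ y ∉ Metric.ball x₀ r, ∀ y' ∈ Metric.ball x₀ r,
          |u y - u y'| ≤ N * (4 * (‖y - x₀‖ / r)) ^ ν := by
        intro y hy y' hy'
        have h1 : r ≤ ‖y - x₀‖ := by rw [← dist_eq_norm]; exact not_lt.1 hy
        have h2 := hmem y' hy'
        refine (ih y y').trans (le_of_eq ?_)
        rw [max_eq_left (by linarith : ‖y' - x₀‖ ≤ ‖y - x₀‖), max_eq_right (by linarith), hN,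
          mul_assoc, ← Real.mul_rpow (by positivity) (by positivity)]
        congr 2
        field_simp
        ring
      set a := sInf (u '' Metric.ball x₀ r) with ha
      set b := sSup (u '' Metric.ball x₀ r) with hb'
      have hne : (u '' Metric.ball x₀ r).Nonempty := ⟨_, x₀, hx₀r, rfl⟩
      have bddA : BddAbove (u '' Metric.ball x₀ r) := by
        refine ⟨u x₀ + 4 ^ ν * N, ?_⟩
        rintro _ ⟨y, hy, rfl⟩
        linarith [osc y hy x₀ hx₀r]
      have bddB : BddBelow (u '' Metric.ball x₀ r) := by
        refine ⟨u x₀ - 4 ^ ν * N, ?_⟩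
        rintro _ ⟨y, hy, rfl⟩
        linarith [osc x₀ hx₀r y hy]
      have hua : ∀ y ∈ Metric.ball x₀ r, a ≤ u y := fun y hy => csInf_le bddB ⟨y, hy, rfl⟩
      have hub : ∀ y ∈ Metric.ball x₀ r, u y ≤ b := fun y hy => le_csSup bddA ⟨y, hy, rfl⟩
      have hab : b - a ≤ 4 ^ ν * N := by
        have h1 : b ≤ a + 4 ^ ν * N := by
          refine csSup_le hne ?_
          rintro _ ⟨y, hy, rfl⟩
          have : u y - 4 ^ ν * N ≤ a := by
            refine le_csInf hne ?_
            rintro _ ⟨y', hy', rfl⟩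
            linarith [osc y hy y' hy']
          linarith
        linarith
      have outA : ∀ y ∉ Metric.ball x₀ r, u y ≤ a + N * (4 * (‖y - x₀‖ / r)) ^ ν := by
        intro y hy
        have : u y - N * (4 * (‖y - x₀‖ / r)) ^ ν ≤ a := by
          refine le_csInf hne ?_
          rintro _ ⟨y', hy', rfl⟩
          linarith [le_abs_self (u y - u y'), oscOut y hy y' hy']
        linarith
      have outB : ∀ y ∉ Metric.ball x₀ r, b - N * (4 * (‖y - x₀‖ / r)) ^ ν ≤ u y := by
        intro y hy
        have : b ≤ u y + N * (4 * (‖y - x₀‖ / r)) ^ ν := by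
          refine csSup_le hne ?_
          rintro _ ⟨y', hy', rfl⟩
          linarith [neg_abs_le (u y - u y'), oscOut y hy y' hy']
        linarith
      have half : Metric.ball x₀ (r / 2) ⊆ Metric.ball x₀ r :=
        Metric.ball_subset_ball (by linarith)
      -- Only pairs with both points in the half ball need a new bound; for the others the maximum
      -- is unchanged from the previous scale.
      have reduce : (∃ a' b', b' - a' ≤ N ∧ ∀ y ∈ Metric.ball x₀ (r / 2), a' ≤ u y ∧ u y ≤ b') →
          ∀ y y', |u y - u y'| ≤ C * (max (r / 2) (2 * max ‖y - x₀‖ ‖y' - x₀‖)) ^ ν := by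
        rintro ⟨a', b', h1, h2⟩ y y'
        by_cases hy : y ∈ Metric.ball x₀ (r / 2) ∧ y' ∈ Metric.ball x₀ (r / 2)
        · have h3 := h2 y hy.1
          have h4 := h2 y' hy.2
          have h5 : |u y - u y'| ≤ N := abs_le.2 ⟨by linarith, by linarith⟩
          refine h5.trans ?_
          rw [hN]
          gcongr
          exact le_max_left _ _
        · have h3 : r / 2 ≤ max ‖y - x₀‖ ‖y' - x₀‖ := by
            rw [← dist_eq_norm, ← dist_eq_norm]
            by_contra! h
            rw [max_lt_iff] at h
            exact hy h
          have h4 := ih y y'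
          rw [max_eq_right (by linarith)] at h4 ⊢
          exact h4
      apply reduce
      rcases le_or_gt (b - a) N with hsmall | hbig
      · exact ⟨a, b, hsmall, fun y hy => ⟨hua y (half hy), hub y (half hy)⟩⟩
      have hBs : B < κ * (((b - a) / 2) ^ (p - 1) * r ^ (-(p * s))) := by
        refine hscale r _ hr0 (hrd.trans hdD) ?_
        have h1 : r ^ ν ≤ 2 * (r / 2) ^ ν := by
          have h2 : (2 : ℝ) ^ ν ≤ 2 := by
            have := Real.rpow_le_rpow_of_exponent_le (by norm_num : (1 : ℝ) ≤ 2) hν1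
            rwa [Real.rpow_one] at this
          calc r ^ ν = 2 ^ ν * (r / 2) ^ ν := by
                rw [← Real.mul_rpow (by norm_num) (by positivity)]
                congr 1; ring
            _ ≤ _ := by gcongr
        have h3 : 0 ≤ (r / 2) ^ ν := by positivity
        calc C₀ * r ^ ν ≤ C₀ * (2 * (r / 2) ^ ν) := by gcongr
          _ = (4 * C₀) * (r / 2) ^ ν / 2 := by ring
          _ ≤ N / 2 := by rw [hN]; gcongr
          _ ≤ (b - a) / 2 := by linarith
      -- The growth lemma lowers the oscillation by `θ * ((b - a) / 2)`; what remains fits into `N`.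
      have hfin : (1 - θ / 2) * (b - a) ≤ N := by
        rcases le_total 0 (1 - θ / 2) with h | h
        · calc (1 - θ / 2) * (b - a) ≤ (1 - θ / 2) * (4 ^ ν * N) := by gcongr
            _ = ((1 - θ / 2) * 4 ^ ν) * N := by ring
            _ ≤ 1 * N := by gcongr
            _ = N := one_mul N
        · nlinarith
      have hcover : volume (Metric.ball x₀ r) ≤
          volume {y ∈ Metric.ball x₀ r | u y ≤ (a + b) / 2} +
          volume {y ∈ Metric.ball x₀ r | -u y ≤ (-b + -a) / 2} := by
        refine (measure_mono fun y hy => ?_).trans (measure_union_le _ _)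
        rcases le_total (u y) ((a + b) / 2) with h | h
        · exact Or.inl ⟨hy, h⟩
        · exact Or.inr ⟨hy, by linarith⟩
      -- One of the two sides of the mid-level fills at least half of the ball, and half is at least
      -- `(1 / 2) ^ n` because `n ≥ 1`.
      have hmass : ENNReal.ofReal ((1 / 2) ^ n) * volume (Metric.ball x₀ r) ≤
            volume {y ∈ Metric.ball x₀ r | u y ≤ (a + b) / 2} ∨
          ENNReal.ofReal ((1 / 2) ^ n) * volume (Metric.ball x₀ r) ≤
            volume {y ∈ Metric.ball x₀ r | -u y ≤ (-b + -a) / 2} := by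
        by_contra! h
        refine absurd (hcover.trans_lt (ENNReal.add_lt_add h.1 h.2)) (not_lt.2 ?_)
        rw [← add_mul, ← ENNReal.ofReal_add (by positivity) (by positivity)]
        refine mul_le_of_le_one_left' ?_
        rw [ENNReal.ofReal_le_one]
        have : ((1 : ℝ) / 2) ^ n ≤ (1 / 2) ^ 1 :=
          pow_le_pow_of_le_one (by norm_num) (by norm_num) hn
        linarith
      rcases hmass with hmass | hmass
      · have := hu.le_of_low_level ho hb hs hG hνt hr0 hball hN0 hbig hBs hub outA hmass
        exact ⟨a, b - θ * ((b - a) / 2), by linarith, fun y hy => ⟨hua y (half hy), this y hy⟩⟩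
      · have := hu'.le_of_low_level ho hb hs hG hνt (a := -b) (b := -a) hr0 hball hN0
          (by linarith) (by rwa [neg_sub_neg]) (fun y hy => by linarith [hua y hy])
          (fun y hy => by linarith [outB y hy]) hmass
        refine ⟨a + θ * ((b - a) / 2), b, by linarith, fun y hy => ⟨?_, hub y (half hy)⟩⟩
        have := this y hy
        linarith
  intro y
  rcases (norm_nonneg (y - x₀)).eq_or_lt with h | h
  · have hy : y = x₀ := by rw [← sub_eq_zero, ← norm_eq_zero]; exact h.symm
    rw [hy, sub_self, abs_zero]
    positivity
  · obtain ⟨k, hk⟩ := exists_halving_le (R := d) (by positivity : 0 < 2 * ‖y - x₀‖)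
    have := step k y x₀
    rw [sub_self, norm_zero, max_eq_left h.le, max_eq_right hk] at this
    exact this

end Interior

/-! ### Assembly of the theorem -/

theorem theorem2 (n : ℕ) (hn : 1 ≤ n) (K s p : ℝ) (hK : 0 < K) (hs0 : 0 < s) (hs1 : s < 1)
    (hp : 2 < p) (Ω : Set (EuclideanSpace ℝ (Fin n)))
    (hΩo : IsOpen Ω) (hΩc : IsConnected Ω) (hΩb : Bornology.IsBounded Ω)
    (hΩs : ExteriorTangentSphere Ω)
    (f u : EuclideanSpace ℝ (Fin n) → ℝ)
    (hf : eLpNorm f ⊤ (volume.restrict Ω) < ⊤)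
    (hu : IsDirichletSolution K s p Ω f u) :
    (∃ B : ℝ, ∀ x, |u x| ≤ B) ∧
    ∃ ν : ℝ, 0 < ν ∧ ν < s ∧
      (∃ c δ : ℝ, 0 < c ∧ 0 < δ ∧
        ∀ x ∈ Ω, Metric.infDist x (frontier Ω) < δ →
          |u x| ≤ c * Metric.infDist x (frontier Ω) ^ ν) ∧
      (∃ C : ℝ, 0 < C ∧
        ∀ x ∈ closure Ω, ∀ y ∈ closure Ω, |u x - u y| ≤ C * dist x y ^ ν) := by
  have hfb := hu.abs_rhs_le hn hK hp hs0 hs1 hΩo hf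
  set B := (eLpNorm f ⊤ (volume.restrict Ω)).toReal
  have hsub := hu.isSubsolution hn hK hp hs0 hs1 hΩo hfb
  have hsub' := hu.neg.isSubsolution hn hK hp hs0 hs1 hΩo (B := B) fun x hx => by
    rw [abs_neg]; exact hfb x hx
  obtain ⟨M₁, hM₁, h₁⟩ := hsub.exists_le hn hp hs0 hs1 hΩo hΩb hΩs
  obtain ⟨M₂, hM₂, h₂⟩ := hsub'.exists_le hn hp hs0 hs1 hΩo hΩb hΩs
  refine ⟨⟨max M₁ M₂, fun x => abs_le.2 ⟨?_, (h₁ x).trans (le_max_left _ _)⟩⟩, ?_⟩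
  · have := (h₂ x).trans (le_max_right M₁ M₂)
    linarith
  obtain ⟨θ, κ, hθ, hθ1, hκ, hG⟩ := exists_growth_constants hn hp hs0 hs1
  have hμ : 0 < p * s / (2 * (p - 1)) := by
    have : 0 < p - 1 := by linarith
    positivity
  obtain ⟨ν, hν, hνs, hν4, hνt⟩ := exists_holder_exponent hs0 hθ hμ
  obtain ⟨C₁, hC₁, hb₁⟩ := hsub.boundary_decay hn hp hs0 hs1 hΩo hΩb hΩs hθ hκ hG hν hνs hν4 hνt
  obtain ⟨C₂, hC₂, hb₂⟩ := hsub'.boundary_decay hn hp hs0 hs1 hΩo hΩb hΩs hθ hκ hG hν hνs hν4 hνt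
  have hCb : 0 < max C₁ C₂ := lt_max_of_lt_left hC₁
  have hbd : ∀ x₀ ∈ frontier Ω, ∀ y, |u y| ≤ max C₁ C₂ * (2 * ‖y - x₀‖) ^ ν := by
    intro x₀ hx₀ y
    have h0 : 0 ≤ (2 * ‖y - x₀‖) ^ ν := by positivity
    have e1 := mul_le_mul_of_nonneg_right (le_max_left C₁ C₂) h0
    have e2 := mul_le_mul_of_nonneg_right (le_max_right C₁ C₂) h0
    exact abs_le.2 ⟨by linarith [hb₂ x₀ hx₀ y], by linarith [hb₁ x₀ hx₀ y]⟩
  have h2ν : (0 : ℝ) < 2 ^ ν := by positivity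
  -- The decay bound holds at all distances, so `δ = 1` is an arbitrary choice.
  refine ⟨ν, hν, hνs, ⟨max C₁ C₂ * 2 ^ ν, 1, by positivity, one_pos, fun x hx _ => ?_⟩, ?_⟩
  · have hne : (frontier Ω).Nonempty := by
      obtain ⟨y, hy, -⟩ := exists_frontier_dist_eq hn hΩo hΩb hx
      exact ⟨y, hy⟩
    obtain ⟨y, hy, hd⟩ := isClosed_frontier.exists_infDist_eq_dist hne x
    have := hbd y hy x
    rwa [Real.mul_rpow zero_le_two (norm_nonneg _), ← mul_assoc, ← dist_eq_norm, ← hd] at this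
  · obtain ⟨C, hC, hH⟩ := hsub.holder hn hp hs0 hs1 hΩo hΩb hΩs hsub' hκ hG hν hνs hν4 hνt hCb hbd
    have hdist : ∀ x y : EuclideanSpace ℝ (Fin n),
        C * (2 * ‖x - y‖) ^ ν = C * 2 ^ ν * dist x y ^ ν := fun x y => by
      rw [Real.mul_rpow zero_le_two (norm_nonneg _), ← mul_assoc, ← dist_eq_norm]
    refine ⟨C * 2 ^ ν, by positivity, fun x _ y _ => ?_⟩
    -- The Hölder estimate needs only one of the points in `Ω`; if neither is, both values are zero.
    by_cases hy : y ∈ Ω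
    · rw [← hdist]
      exact hH y hy x
    by_cases hx : x ∈ Ω
    · rw [abs_sub_comm, dist_comm, ← hdist]
      exact hH x hx y
    · rw [hu.zero_outside x hx, hu.zero_outside y hy, sub_self, abs_zero]
      positivity
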